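/- **Setting.** Let $(\chi,\rho)$ be a dyadic partition of unity on $\mathbb R$: $\chi,\rho\in C_c^\infty(\mathbb R)$ are nonnegative and even, $\operatorname{supp}\chi$ is contained in a ball and $\operatorname{supp}\rho$ in an annulus $\{a\le|z|\le b\}$, $0<a<b$, $\chi(z)+\sum_{j\ge0}\rho(2^{-j}z)=1$ for all $z$, $\operatorname{supp}\chi\cap\operatorname{supp}\rho(2^{-j}\cdot)=\emptyset$ for $j\ge1$ and $\operatorname{supp}\rho(2^{-i}\cdot)\cap\operatorname{supp}\rho(2^{-j}\cdot)=\emptyset$ for $|i-j|>1$. Put $\rho_{-1}=\chi$, $\rho_j=\rho(2^{-j}\cdot)$ for $j\ge 0$, let $K_j(x)=\frac1{2\pi}\int_{\mathbb R}e^{ixz}\rho_j(z)\,dz$ and $\Delta_ju=K_j*u$ for a tempered distribution $u$ and $j\ge-1$. For $\gamma\in\mathbb R$ let $\mathscr C^\gamma$ be the space of tempered distributions $u$ on $\mathbb R$ with $\|u\|_\gamma=\sup_{j\ge-1}2^{j\gamma}\|\Delta_ju\|_{L^\infty}<\infty$. Functions and distributions may take values in complex Banach spaces $E$ (for $u$)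 and $F$ (for $v$), and products are formed with a fixed bounded bilinear map $E\times F\to G$ into a complex Banach space $G$; the case $E=F=G=\mathbb C$ contains that of real-valued functions, and $\mathbb C^m\times\mathbb C^n\to\mathbb C^{m\times n}$, $(x,y)\mapsto x\otimes y$, that of $\mathbb R^m$- and $\mathbb R^n$-valued ones. Set $$u\prec v=v\succ u=\sum_{j\ge-1}\ \sum_{-1\le i\le j-2}\Delta_iu\,\Delta_jv,\qquad u\circ v=\sum_{|i-j|\le1}\Delta_iu\,\Delta_jv,$$ the series being understood in the sense of distributions. If $w$ is the distributional derivative of a continuous function $U$, write $\int_s^tw(r)\,dr=U(t)-U(s)$. **Statement.** Let $(u^\varepsilon,v^\varepsilon)_{\varepsilon>0}$ be a family of smooth functions on $\mathbb R$ and let $$A^\varepsilon_{s,t}=\int_s^t\int_s^{r_2}du^\varepsilon(r_1)\,dv^\varepsilon(r_2),\qquad s,t\in\mathbb R .$$ Let $\alpha,\beta\in(0,1)$ with $\alpha+\beta<1$ and let $u\in\mathscr C^\alpha$, $v\in\mathscr C^\beta$, $\eta\in\mathscr C^{\alpha+\beta-1}$. Then $(u^\varepsilon,v^\varepsilon,u^\varepsilon\circ\partial_tv^\varepsilon)$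 converges to $(u,v,\eta)$ in $\mathscr C^\alpha\times\mathscr C^\beta\times\mathscr C^{\alpha+\beta-1}$ as $\varepsilon\to0$ if and only if $(u^\varepsilon,v^\varepsilon)$ converges to $(u,v)$ in $\mathscr C^\alpha\times\mathscr C^\beta$ and moreover $$\lim_{\varepsilon\to0}\ \sup_{s\ne t\in\mathbb R,\ |s-t|\le1}\frac{|A_{s,t}-A^\varepsilon_{s,t}|}{|t-s|^{\alpha+\beta}}=0,$$ where $A_{s,t}=\int_s^t\big(\eta+(u\prec\partial_tv)+(u\succ\partial_tv)\big)(r)\,dr-u(s)\,(v(t)-v(s))$ for $s,t\in\mathbb R$. Here convergence of a family of functions, or of the series $u^\varepsilon\circ\partial_tv^\varepsilon$, to $w$ in $\mathscr C^\gamma$ means that for all small $\varepsilon$ they are given by tempered distributions $w^\varepsilon$, with $\|w^\varepsilon-w\|_\gamma\to0$. -/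

import Mathlib

open Filter Topology MeasureTheory
open scoped SchwartzMap ENNReal ContDiff FourierTransform

noncomputable section

namespace Paracontrolled

/-- A dyadic partition of unity `(χ, ρ)` on `ℝ`; "radial" means even in dimension one. -/
structure DyadicPartition where
  χ : ℝ → ℝ
  ρ : ℝ → ℝ
  χ_smooth : ContDiff ℝ ∞ χ
  ρ_smooth : ContDiff ℝ ∞ ρ
  χ_nonneg : ∀ z, 0 ≤ χ z
  ρ_nonneg : ∀ z, 0 ≤ ρ z
  χ_even : ∀ z, χ (-z) = χ z
  ρ_even : ∀ z, ρ (-z) = ρ z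
  χ_supp : ∃ b : ℝ, tsupport χ ⊆ {z | |z| ≤ b}
  ρ_supp : ∃ a b : ℝ, 0 < a ∧ a < b ∧ tsupport ρ ⊆ {z | a ≤ |z| ∧ |z| ≤ b}
  hasSum_one : ∀ z, HasSum (fun j : ℕ => ρ (z / 2 ^ j)) (1 - χ z)
  disjoint_χ : ∀ j : ℕ, 1 ≤ j → Disjoint (tsupport χ) (tsupport fun z => ρ (z / 2 ^ j))
  disjoint_ρ : ∀ i j : ℕ, i + 1 < j →
    Disjoint (tsupport fun z => ρ (z / 2 ^ i)) (tsupport fun z => ρ (z / 2 ^ j))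

namespace DyadicPartition

variable (P : DyadicPartition)

/-- The Littlewood-Paley symbols. Indices are shifted by one throughout: `symbol 0` is
`ρ_{-1} = χ` and `symbol (j + 1)` is `ρ_j = ρ (2 ^ (-j) ·)`. -/
def symbol : ℕ → ℝ → ℝ
  | 0 => P.χ
  | j + 1 => fun z => P.ρ (z / 2 ^ j)

theorem symbol_contDiff (j : ℕ) : ContDiff ℝ ∞ (P.symbol j) := by
  cases j with
  | zero => exact P.χ_smooth
  | succ j => exact P.ρ_smooth.comp (contDiff_id.div_const _)

theorem symbol_hasCompactSupport (j : ℕ) : HasCompactSupport (P.symbol j) := by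
  have key : ∀ (f : ℝ → ℝ) (b : ℝ), tsupport f ⊆ {z | |z| ≤ b} → HasCompactSupport f := by
    intro f b h
    refine HasCompactSupport.intro (isCompact_closedBall (0 : ℝ) b) fun x hx => ?_
    by_contra hne
    exact hx (by simpa using h (subset_tsupport f hne))
  cases j with
  | zero =>
    obtain ⟨b, hb⟩ := P.χ_supp
    exact key _ b hb
  | succ j =>
    obtain ⟨a, b, -, -, h⟩ := P.ρ_supp
    have hρ : HasCompactSupport P.ρ := key _ b fun z hz => (h hz).2
    have h2 : (2 ^ j : ℝ)⁻¹ ≠ 0 := by positivity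
    have := hρ.comp_homeomorph (Homeomorph.mulRight₀ ((2 ^ j : ℝ)⁻¹) h2)
    simpa [symbol, Function.comp_def, div_eq_mul_inv] using this

/-- The symbol as a Schwartz function of the frequency `ξ`, where `z = 2 π ξ` (the Fourier transform
`𝓕` of Mathlib is normalized with `exp (-2 π i x ξ)`, the symbols are functions of `z` in
`exp (-i x z)`). -/
def symbolSchwartz (j : ℕ) : 𝓢(ℝ, ℂ) :=
  HasCompactSupport.toSchwartzMap (f := fun ξ : ℝ => ((P.symbol j (2 * Real.pi * ξ) : ℝ) : ℂ))
    (by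
      have h2 : (2 * Real.pi : ℝ) ≠ 0 := by positivity
      have h := (P.symbol_hasCompactSupport j).comp_homeomorph (Homeomorph.mulLeft₀ _ h2)
      exact h.comp_left (g := fun x : ℝ => (x : ℂ)) Complex.ofReal_zero)
    (by
      have h := (P.symbol_contDiff j).comp
        (contDiff_const.mul contDiff_id : ContDiff ℝ ∞ fun ξ : ℝ => 2 * Real.pi * ξ)
      exact Complex.ofRealCLM.contDiff.comp h)

/-- The Littlewood-Paley kernel `K_j`, the inverse Fourier transform of the symbol `ρ_j`. -/
def kernel (j : ℕ) : 𝓢(ℝ, ℂ) := 𝓕⁻ (P.symbolSchwartz j)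

/-- The Schwartz function `y ↦ K_j (x - y)`. -/
def kernelAt (j : ℕ) (x : ℝ) : 𝓢(ℝ, ℂ) :=
  SchwartzMap.compCLMOfAntilipschitz (K := 1) (g := fun y : ℝ => x - y) ℂ (by fun_prop)
    (AntilipschitzWith.of_le_mul_dist fun a b => by
      rw [NNReal.coe_one, one_mul, dist_sub_left]) (P.kernel j)

theorem kernelAt_apply (j : ℕ) (x y : ℝ) : P.kernelAt j x y = P.kernel j (x - y) := rfl

end DyadicPartition

variable {E F G : Type*} [NormedAddCommGroup E] [NormedSpace ℂ E]
  [NormedAddCommGroup F] [NormedSpace ℂ F] [NormedAddCommGroup G] [NormedSpace ℂ G]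

/-- The Littlewood-Paley block `Δ_j u = K_j * u`, which is a smooth function
(`block P 0` is `Δ_{-1}` and `block P (j + 1)` is `Δ_j`). -/
def block (P : DyadicPartition) (j : ℕ) (u : 𝓢'(ℝ, E)) (x : ℝ) : E := u (P.kernelAt j x)

/-- The Hölder-Besov norm of `B^γ_{∞,∞}`, that is `sup_{j ≥ -1} 2 ^ (j γ) ‖Δ_j u‖_{L^∞}`
(the blocks are continuous, so that their `L^∞` norm is their supremum). -/
def besovNorm (P : DyadicPartition) (γ : ℝ) (u : 𝓢'(ℝ, E)) : ℝ≥0∞ :=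
  ⨆ j : ℕ, ENNReal.ofReal ((2 : ℝ) ^ (((j : ℝ) - 1) * γ)) * ⨆ x : ℝ, ‖block P j u x‖ₑ

/-- The tempered distribution `T` is given by the function `f`: the two agree on all test functions
of compact support, which determine a tempered distribution. -/
def Represents (T : 𝓢'(ℝ, E)) (f : ℝ → E) : Prop :=
  ∀ φ : 𝓢(ℝ, ℂ), HasCompactSupport φ → T φ = ∫ x, φ x • f x

/-- `T` is the sum of the series of functions `f 0 + f 1 + ...`, in the sense of distributions. -/
def IsSeriesSum (f : ℕ → ℝ → E) (T : 𝓢'(ℝ, E)) : Prop :=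
  ∀ φ : 𝓢(ℝ, ℂ), HasCompactSupport φ →
    Tendsto (fun n => ∑ j ∈ Finset.range n, ∫ x, φ x • f j x) atTop (𝓝 (T φ))

/-- `w` is the paraproduct `∑_{j ≥ -1} ∑_{i = -1}^{j - 2} Δ_i u Δ_j v`, products being taken with
the bilinear map `B`. -/
def IsParaproduct (P : DyadicPartition) (B : E →L[ℂ] F →L[ℂ] G)
    (u : 𝓢'(ℝ, E)) (v : 𝓢'(ℝ, F)) (w : 𝓢'(ℝ, G)) : Prop :=
  IsSeriesSum (fun j x => ∑ i ∈ Finset.range (j - 1), B (block P i u x) (block P j v x)) w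

/-- `w` is the resonant product `∑_{|i - j| ≤ 1} Δ_i u Δ_j v`. -/
def IsResonantProduct (P : DyadicPartition) (B : E →L[ℂ] F →L[ℂ] G)
    (u : 𝓢'(ℝ, E)) (v : 𝓢'(ℝ, F)) (w : 𝓢'(ℝ, G)) : Prop :=
  IsSeriesSum (fun j x => ∑ i ∈ Finset.Icc (j - 1) (j + 1), B (block P i u x) (block P j v x)) w

open Classical in
/-- The paraproduct `u ≺ v` (zero if the series does not converge). -/
def paraLow (P : DyadicPartition) (B : E →L[ℂ] F →L[ℂ] G)
    (u : 𝓢'(ℝ, E)) (v : 𝓢'(ℝ, F)) : 𝓢'(ℝ, G) :=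
  if h : ∃ w, IsParaproduct P B u v w then h.choose else 0

/-- The paraproduct `u ≻ v = v ≺ u`. -/
def paraHigh (P : DyadicPartition) (B : E →L[ℂ] F →L[ℂ] G)
    (u : 𝓢'(ℝ, E)) (v : 𝓢'(ℝ, F)) : 𝓢'(ℝ, G) :=
  paraLow P B.flip v u

open Classical in
/-- The continuous function that gives the distribution `u` (zero if there is none). -/
def toContinuousFun (u : 𝓢'(ℝ, E)) : ℝ → E :=
  if h : ∃ f : ℝ → E, Continuous f ∧ Represents u f then h.choose else 0

/-- `U` is a continuous function whose distributional derivative is `w`. -/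
def IsAntiderivative (w : 𝓢'(ℝ, E)) (U : ℝ → E) : Prop :=
  Continuous U ∧ ∀ φ : 𝓢(ℝ, ℂ), HasCompactSupport φ → w φ = -∫ x, deriv φ x • U x

open Classical in
/-- The integral `∫_s^t w (r) dr = U (t) - U (s)` of a distribution `w` that is the derivative of a
continuous function `U` (zero if there is none). -/
def distIntegral (w : 𝓢'(ℝ, E)) (s t : ℝ) : E :=
  if h : ∃ U : ℝ → E, IsAntiderivative w U then h.choose t - h.choose s else 0

/-- Convergence as `ε → 0`, `ε > 0`, to `T` in the norm of `B^γ_{∞,∞}` of a family of objects that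
need not be tempered distributions a priori: `D ε W` says that the object with index `ε` is the
tempered distribution `W`. -/
def BesovTendsto (P : DyadicPartition) (γ : ℝ) (D : ℝ → 𝓢'(ℝ, E) → Prop) (T : 𝓢'(ℝ, E)) : Prop :=
  ∃ W : ℝ → 𝓢'(ℝ, E), (∀ᶠ ε in 𝓝[>] (0 : ℝ), D ε (W ε)) ∧
    Tendsto (fun ε => besovNorm P γ (W ε - T)) (𝓝[>] 0) (𝓝 0)

/-- Convergence of a family of functions in `B^γ_{∞,∞}`. -/
def FunBesovTendsto (P : DyadicPartition) (γ : ℝ) (f : ℝ → ℝ → E) (T : 𝓢'(ℝ, E)) : Prop :=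
  BesovTendsto P γ (fun ε U => Represents U (f ε)) T

/-- Convergence of the resonant products `f ε ∘ ∂ (g ε)` in `B^γ_{∞,∞}`. -/
def ResonantBesovTendsto (P : DyadicPartition) (B : E →L[ℂ] F →L[ℂ] G) (γ : ℝ)
    (f : ℝ → ℝ → E) (g : ℝ → ℝ → F) (T : 𝓢'(ℝ, G)) : Prop :=
  BesovTendsto P γ (fun ε W => ∃ (U : 𝓢'(ℝ, E)) (V : 𝓢'(ℝ, F)),
    Represents U (f ε) ∧ Represents V (g ε) ∧
      IsResonantProduct P B U (TemperedDistribution.derivCLM F V) W) T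

/-- The iterated integral `∫_s^t ∫_s^{r₂} df(r₁) dg(r₂)` of smooth functions. -/
def iteratedIntegral (B : E →L[ℂ] F →L[ℂ] G) (f : ℝ → E) (g : ℝ → F) (s t : ℝ) : G :=
  ∫ r₂ in s..t, B (∫ r₁ in s..r₂, deriv f r₁) (deriv g r₂)

/-- The area `∫_s^t (η + u ≺ ∂v + u ≻ ∂v)(r) dr - u(s) (v(t) - v(s))`. -/
def area (P : DyadicPartition) (B : E →L[ℂ] F →L[ℂ] G)
    (u : 𝓢'(ℝ, E)) (v : 𝓢'(ℝ, F)) (η : 𝓢'(ℝ, G)) (s t : ℝ) : G :=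
  distIntegral (η + paraLow P B u (TemperedDistribution.derivCLM F v)
      + paraHigh P B u (TemperedDistribution.derivCLM F v)) s t
    - B (toContinuousFun u s) (toContinuousFun v t - toContinuousFun v s)

/-- `sup_{s ≠ t, |t - s| ≤ 1} ‖A(s,t)‖ / |t - s| ^ κ`. -/
def localHolderNorm (κ : ℝ) (A : ℝ → ℝ → G) : ℝ≥0∞ :=
  ⨆ (s : ℝ) (t : ℝ) (_ : s ≠ t) (_ : |t - s| ≤ 1), ENNReal.ofReal (‖A s t‖ / |t - s| ^ κ)

end Paracontrolled

end

/-! For smooth `u'`, `v'` the Littlewood-Paley decomposition of a product is an identity, `u' ∂v' =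
u' ≺ ∂v' + u' ≻ ∂v' + u' ∘ ∂v'`. The iterated integral of `(u', v')` is therefore the area in which
`η` is replaced by `u' ∘ ∂v'` (`isResonantProduct_iff_represents`, `area_eq_iteratedIntegral`). So
`A - A^ε` is the integral of `η - u^ε ∘ ∂v^ε` plus the difference of the values at `(u, v)` and at
`(u^ε, v^ε)` of the expression `R(u, v)_{s,t} = ∫_s^t (u ≺ ∂v + u ≻ ∂v) - u(s) (v(t) - v(s))`.

The expression `R` is bilinear and bounded from `C^α × C^β` to functions of order `|t - s|^(α+β)`
(`exists_paraproduct_antiderivative`). Integration by parts in `u ≺ ∂v` and the expansion of `u(s)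
(v(t) - v(s))` into pairs of blocks cancel the terms of lower order. What is left at frequency `2^k`
gains the minimum of `2^(-k)` and `|t - s|`: the first because a product of blocks with separated
frequencies is the derivative of a function smaller by `2^(-k)`, the second trivially.
`exists_sum_min_le` sums these bounds to `|t - s|^(α+β)`, since `0 < α + β < 1`. By bilinearity,
convergence of `(u^ε, v^ε)` makes the difference of the `R` terms small in this norm.

There remains the correspondence between `C^(γ-1)` and uniform local `γ`-Hölder continuity of an
antiderivative, with bounds in both directions for `0 < γ < 1`
(`exists_isAntiderivative_of_blockBound`, `exists_blockBound_of_increments`). With `γ = α + β` it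
turns smallness of `η - u^ε ∘ ∂v^ε` into smallness of the area difference and back. In the converse
direction the resonant series is not known to converge. A candidate limit is obtained by subtracting
from `η` the derivative of a small Hölder function; the product and both paraproduct series
converge, so the resonant series must sum to that candidate. -/

noncomputable section

namespace Paracontrolled

/-! ### Weak integrals under continuous linear maps -/

section GraphIntegral

variable {V X E : Type*} [AddCommGroup V] [Module ℂ V] [TopologicalSpace V]
  [NormedAddCommGroup X] [NormedSpace ℂ X] [CompleteSpace X]
  [NormedAddCommGroup E] [NormedSpace ℂ E] [CompleteSpace E]

/-- A continuous linear map commutes with a weak integral that is a Bochner integral after an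
embedding which controls the map. -/
theorem map_eq_integral_of_embedding (ι : V →L[ℂ] X) (T : V →L[ℂ] E) (C : ℝ)
    (hT : ∀ f, ‖T f‖ ≤ C * ‖ι f‖) (F : ℝ → V) (hF : Continuous F) (φ : ℝ → ℂ)
    (hφ : Continuous φ) (hφc : HasCompactSupport φ) (h : V)
    (hh : ι h = ∫ x, φ x • ι (F x)) : T h = ∫ x, φ x • T (F x) := by
  -- `V` carries no completeness assumption, so the integral is taken in the closure of the graph of
  -- `(ι, T)`. The bound on `T`, centred at `h`, survives in this closure. The integral has first
  -- component `ι h`, hence its second component is `T h`.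
  set S : Submodule ℂ (X × E) := (LinearMap.range (ι.prod T).toLinearMap).topologicalClosure
  have hS : IsClosed (S : Set (X × E)) := Submodule.isClosed_topologicalClosure _
  have : CompleteSpace S := hS.completeSpace_coe
  let Φ : ℝ → S := fun x => ⟨(ι (F x), T (F x)), Submodule.le_topologicalClosure _ ⟨F x, rfl⟩⟩
  have hΦ : Continuous Φ :=
    Continuous.subtype_mk ((ι.continuous.comp hF).prodMk (T.continuous.comp hF)) _
  have hint : Integrable (fun x => φ x • Φ x) :=
    (hφ.smul hΦ).integrable_of_hasCompactSupport hφc.smul_right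
  have h1 : ((∫ x, φ x • Φ x : S) : X × E).1 = ∫ x, φ x • ι (F x) :=
    (ContinuousLinearMap.integral_comp_comm
      ((ContinuousLinearMap.fst ℂ X E).comp S.subtypeL) hint).symm
  have h2 : ((∫ x, φ x • Φ x : S) : X × E).2 = ∫ x, φ x • T (F x) :=
    (ContinuousLinearMap.integral_comp_comm
      ((ContinuousLinearMap.snd ℂ X E).comp S.subtypeL) hint).symm
  have key : ∀ p ∈ S, ‖p.2 - T h‖ ≤ C * ‖p.1 - ι h‖ := by
    have hcl : IsClosed {p : X × E | ‖p.2 - T h‖ ≤ C * ‖p.1 - ι h‖} :=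
      isClosed_le (by fun_prop) (by fun_prop)
    intro p hp
    refine closure_minimal ?_ hcl hp
    rintro _ ⟨f, rfl⟩
    simpa using hT (f - h)
  have := key _ (∫ x, φ x • Φ x : S).2
  rw [h1, h2, hh, sub_self, norm_zero, mul_zero] at this
  exact (sub_eq_zero.1 (norm_le_zero_iff.1 this)).symm

end GraphIntegral

/-! ### Translations and convolutions in Schwartz space -/

section Schwartz

theorem seminorm_le_derivCLM_iterate (k l : ℕ) (f : 𝓢(ℝ, ℂ)) {M : ℝ} (hM : 0 ≤ M)
    (h : ∀ x, |x| ^ k * ‖(SchwartzMap.derivCLM ℂ ℂ)^[l] f x‖ ≤ M) :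
    SchwartzMap.seminorm ℂ k l f ≤ M := by
  refine SchwartzMap.seminorm_le_bound' ℂ k l f hM fun x => ?_
  have : ∀ (l : ℕ) (f : 𝓢(ℝ, ℂ)), iteratedDeriv l f = (SchwartzMap.derivCLM ℂ ℂ)^[l] f := by
    intro l
    induction l with
    | zero => intro f; simp
    | succ l ih =>
      intro f
      rw [iteratedDeriv_succ', Function.iterate_succ_apply, ← ih]
      congr 1
  rw [this]
  exact h x

theorem derivCLM_iterate_compSubConst (l : ℕ) (a : ℝ) (f : 𝓢(ℝ, ℂ)) :
    (SchwartzMap.derivCLM ℂ ℂ)^[l] (SchwartzMap.compSubConstCLM ℂ a f) =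
      SchwartzMap.compSubConstCLM ℂ a ((SchwartzMap.derivCLM ℂ ℂ)^[l] f) := by
  induction l generalizing f with
  | zero => rfl
  | succ l ih =>
    rw [Function.iterate_succ_apply, Function.iterate_succ_apply, ← ih]
    congr 1
    ext x
    simp only [SchwartzMap.derivCLM_apply, SchwartzMap.compSubConstCLM_apply]
    rw [← deriv_comp_sub_const]
    rfl

/-- Translation is continuous on Schwartz space. -/
theorem continuous_compSubConst (f : 𝓢(ℝ, ℂ)) :
    Continuous fun a : ℝ => SchwartzMap.compSubConstCLM ℂ a f := by
  have at_zero : ∀ f : 𝓢(ℝ, ℂ),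
      Tendsto (fun a : ℝ => SchwartzMap.compSubConstCLM ℂ a f) (𝓝 0) (𝓝 f) := by
    intro f
    rw [(schwartz_withSeminorms ℂ ℝ ℂ).tendsto_nhds]
    rintro ⟨k, l⟩ ε hε
    set g := (SchwartzMap.derivCLM ℂ ℂ)^[l] f
    set M := SchwartzMap.seminorm ℂ k 1 g + SchwartzMap.seminorm ℂ 0 1 g
    have hM : 0 ≤ M := add_nonneg (apply_nonneg _ _) (apply_nonneg _ _)
    have hb : ∀ a : ℝ, |a| ≤ 1 →
        SchwartzMap.seminorm ℂ k l (SchwartzMap.compSubConstCLM ℂ a f - f) ≤ 2 ^ k * M * |a| := by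
      intro a ha
      refine seminorm_le_derivCLM_iterate k l _ (by positivity) fun x => ?_
      rw [iterate_map_sub, derivCLM_iterate_compSubConst]
      change |x| ^ k * ‖g (x - a) - g x‖ ≤ _
      -- The weight `|x| ^ k` is frozen at `x`, so only `g` is differentiated on the ball of radius
      -- `|a| ≤ 1`; there `|x| ≤ |y| + 1` passes the weight on to the point `y`.
      have hmv := Convex.norm_image_sub_le_of_norm_deriv_le (f := fun y => ((|x| ^ k : ℝ) : ℂ) * g y)
        (s := Metric.closedBall x |a|) (x := x) (y := x - a) (C := 2 ^ k * M)
        (fun y _ => (g.differentiable y).const_mul _) ?_ (convex_closedBall _ _)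
        (by simp) (by simp)
      · rw [← mul_sub, norm_mul, Complex.norm_real, Real.norm_of_nonneg (by positivity)] at hmv
        simpa using hmv
      · intro y hy
        rw [deriv_const_mul _ (g.differentiable y), norm_mul, Complex.norm_real,
          Real.norm_of_nonneg (by positivity)]
        have hxy : |x| ≤ |y| + 1 := by
          have h1 : |y - x| ≤ |a| := by simpa [Real.dist_eq] using hy
          have h2 : |x| ≤ |y| + |y - x| := by
            have := abs_sub_abs_le_abs_sub x y
            rw [abs_sub_comm] at this
            linarith
          linarith
        have h1 := SchwartzMap.le_seminorm' ℂ k 1 g y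
        have h2 := SchwartzMap.le_seminorm' ℂ 0 1 g y
        rw [iteratedDeriv_one] at h1 h2
        rw [pow_zero, one_mul] at h2
        calc |x| ^ k * ‖deriv g y‖ ≤ (|y| + 1) ^ k * ‖deriv g y‖ := by gcongr
          _ ≤ (2 ^ k * (|y| ^ k + 1)) * ‖deriv g y‖ := by
            gcongr
            calc (|y| + 1) ^ k ≤ 2 ^ (k - 1) * (|y| ^ k + 1 ^ k) :=
                  add_pow_le (abs_nonneg y) zero_le_one k
              _ ≤ 2 ^ k * (|y| ^ k + 1) := by
                rw [one_pow]
                gcongr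
                · norm_num
                · omega
          _ ≤ 2 ^ k * M := by
            rw [mul_assoc]
            gcongr
            rw [add_mul, one_mul]
            exact add_le_add h1 h2
    have hδ : 0 < ε / (2 ^ k * M + 1) := by positivity
    filter_upwards [Metric.ball_mem_nhds (0 : ℝ) (lt_min hδ one_pos)] with a ha
    rw [mem_ball_zero_iff, Real.norm_eq_abs, lt_min_iff] at ha
    refine (hb a ha.2.le).trans_lt ?_
    have h3 := ha.1
    rw [lt_div_iff₀ (by positivity)] at h3
    nlinarith [abs_nonneg a]
  rw [continuous_iff_continuousAt]
  intro a
  have h := (at_zero (SchwartzMap.compSubConstCLM ℂ a f)).comp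
    ((continuous_sub_right a).tendsto' a 0 (sub_self a))
  refine h.congr fun b => ?_
  ext x
  simp

/-- The reflection `y ↦ K (-y)` of a Schwartz function. -/
def reflection (K : 𝓢(ℝ, ℂ)) : 𝓢(ℝ, ℂ) :=
  SchwartzMap.compCLMOfContinuousLinearEquiv ℂ (ContinuousLinearEquiv.neg ℝ) K

@[simp] theorem reflection_apply (K : 𝓢(ℝ, ℂ)) (y : ℝ) : reflection K y = K (-y) := rfl

/-- The Schwartz function `y ↦ K (x - y)`. -/
def reflAt (K : 𝓢(ℝ, ℂ)) (x : ℝ) : 𝓢(ℝ, ℂ) := SchwartzMap.compSubConstCLM ℂ x (reflection K)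

@[simp] theorem reflAt_apply (K : 𝓢(ℝ, ℂ)) (x y : ℝ) : reflAt K x y = K (x - y) := by
  simp [reflAt]

theorem DyadicPartition.kernelAt_eq (P : DyadicPartition) (j : ℕ) (x : ℝ) :
    P.kernelAt j x = reflAt (P.kernel j) x := by
  ext y
  simp [DyadicPartition.kernelAt_apply]

theorem continuous_reflAt (K : 𝓢(ℝ, ℂ)) : Continuous (reflAt K) := continuous_compSubConst _

/-- Scalar convolution of Schwartz functions. -/
def conv (f g : 𝓢(ℝ, ℂ)) : 𝓢(ℝ, ℂ) := SchwartzMap.convolution (ContinuousLinearMap.mul ℂ ℂ) f g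

theorem conv_apply (f g : 𝓢(ℝ, ℂ)) (x : ℝ) : conv f g x = ∫ t, f t * g (x - t) := by
  rw [conv, SchwartzMap.convolution_apply]
  rfl

theorem fourier_conv (f g : 𝓢(ℝ, ℂ)) (ξ : ℝ) : 𝓕 (conv f g) ξ = 𝓕 f ξ * 𝓕 g ξ := by
  rw [conv, SchwartzMap.fourier_convolution]
  rfl

theorem fourier_ext {f g : 𝓢(ℝ, ℂ)} (h : ∀ ξ, 𝓕 f ξ = 𝓕 g ξ) : f = g := by
  have : 𝓕 f = 𝓕 g := SchwartzMap.ext h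
  have h2 := congrArg (fun F : 𝓢(ℝ, ℂ) => 𝓕⁻ F) this
  simpa using h2

theorem conv_comm (f g : 𝓢(ℝ, ℂ)) : conv f g = conv g f :=
  fourier_ext fun ξ => by rw [fourier_conv, fourier_conv, mul_comm]

theorem fourier_derivCLM (f : 𝓢(ℝ, ℂ)) (ξ : ℝ) :
    𝓕 (SchwartzMap.derivCLM ℂ ℂ f) ξ = (2 * Real.pi * Complex.I * ξ) * 𝓕 f ξ := by
  have h := Real.fourier_deriv (f := (f : ℝ → ℂ)) f.integrable f.differentiable
    (SchwartzMap.derivCLM ℂ ℂ f).integrable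
  refine Eq.trans (b := 𝓕 (deriv (f : ℝ → ℂ)) ξ) rfl ?_
  simpa [SchwartzMap.fourier_coe] using congrFun h ξ

theorem derivCLM_conv (f g : 𝓢(ℝ, ℂ)) :
    SchwartzMap.derivCLM ℂ ℂ (conv f g) = conv f (SchwartzMap.derivCLM ℂ ℂ g) :=
  fourier_ext fun ξ => by
    rw [fourier_derivCLM, fourier_conv, fourier_conv, fourier_derivCLM]
    ring

theorem derivCLM_iterate_conv (l : ℕ) (f g : 𝓢(ℝ, ℂ)) :
    (SchwartzMap.derivCLM ℂ ℂ)^[l] (conv f g) = conv f ((SchwartzMap.derivCLM ℂ ℂ)^[l] g) := by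
  induction l generalizing g with
  | zero => rfl
  | succ l ih => rw [Function.iterate_succ_apply, Function.iterate_succ_apply, derivCLM_conv, ih]

/-- The map `f ↦ x ^ k f ^ (l)` into bounded continuous functions. -/
def weightedDeriv (k l : ℕ) : 𝓢(ℝ, ℂ) →L[ℂ] BoundedContinuousFunction ℝ ℂ :=
  (SchwartzMap.toBoundedContinuousFunctionCLM ℂ ℝ ℂ).comp
    ((SchwartzMap.smulLeftCLM ℂ (fun x : ℝ => (x : ℂ) ^ k)).comp ((SchwartzMap.derivCLM ℂ ℂ) ^ l))

theorem weightedDeriv_apply (k l : ℕ) (f : 𝓢(ℝ, ℂ)) (x : ℝ) :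
    weightedDeriv k l f x = (x : ℂ) ^ k * (SchwartzMap.derivCLM ℂ ℂ)^[l] f x := by
  have h : Function.HasTemperateGrowth fun x : ℝ => (x : ℂ) ^ k := by fun_prop
  simp only [weightedDeriv, ContinuousLinearMap.comp_apply,
    SchwartzMap.toBoundedContinuousFunctionCLM_apply]
  have h2 : ∀ (l : ℕ) (g : 𝓢(ℝ, ℂ)),
      (SchwartzMap.derivCLM ℂ ℂ ^ l) g = (SchwartzMap.derivCLM ℂ ℂ)^[l] g := by
    intro l
    induction l with
    | zero => intro g; rfl
    | succ l ih => intro g; rw [pow_succ, mul_apply_eq_comp, ih,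
        Function.iterate_succ_apply]
  rw [SchwartzMap.smulLeftCLM_apply_apply h, h2, smul_eq_mul]

variable {E : Type*} [NormedAddCommGroup E] [NormedSpace ℂ E]

/-- Continuity of `T` involves only finitely many Schwartz seminorms. The corresponding weighted
derivatives map Schwartz space into one Banach space whose norm controls `T`, as
`map_eq_integral_of_embedding` requires. -/
theorem exists_weightedDeriv_bound (T : 𝓢(ℝ, ℂ) →L[ℂ] E) :
    ∃ (s : Finset (ℕ × ℕ)) (C : ℝ), ∀ f,
      ‖T f‖ ≤ C * ‖(fun i : s => weightedDeriv i.1.1 i.1.2 f)‖ := by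
  obtain ⟨s, C, -, h⟩ := Seminorm.bound_of_continuous (schwartz_withSeminorms ℂ ℝ ℂ)
    ((normSeminorm ℂ E).comp T.toLinearMap) (by
      change Continuous fun f => ‖T f‖
      fun_prop)
  refine ⟨s, C, fun f => (h f).trans ?_⟩
  rw [smul_apply]
  change (C : ℝ) * _ ≤ _
  gcongr
  refine Seminorm.finset_sup_apply_le (norm_nonneg _) fun i hi => ?_
  refine le_trans ?_ (norm_le_pi_norm (fun i : s => weightedDeriv i.1.1 i.1.2 f) ⟨i, hi⟩)
  refine seminorm_le_derivCLM_iterate i.1 i.2 f (norm_nonneg _) fun x => ?_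
  have := (weightedDeriv i.1 i.2 f).norm_coe_le_norm x
  rw [weightedDeriv_apply] at this
  simpa using this

variable [CompleteSpace E]

/-- The convolution is the integral of the translates of `f` against `φ`. After the map into
finitely many spaces of bounded continuous functions this is a Bochner integral, and the identity
can be checked at every point. -/
theorem map_conv_eq_integral (T : 𝓢(ℝ, ℂ) →L[ℂ] E) (φ f : 𝓢(ℝ, ℂ)) (hφ : HasCompactSupport φ) :
    T (conv φ f) = ∫ x, φ x • T (SchwartzMap.compSubConstCLM ℂ x f) := by
  obtain ⟨s, C, hC⟩ := exists_weightedDeriv_bound T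
  let ι : 𝓢(ℝ, ℂ) →L[ℂ] (s → BoundedContinuousFunction ℝ ℂ) :=
    ContinuousLinearMap.pi fun i => weightedDeriv i.1.1 i.1.2
  refine map_eq_integral_of_embedding ι T C hC (fun x => SchwartzMap.compSubConstCLM ℂ x f)
    (continuous_compSubConst f) φ φ.continuous hφ _ ?_
  have hint : Integrable fun x => φ x • ι (SchwartzMap.compSubConstCLM ℂ x f) :=
    (φ.continuous.smul (ι.continuous.comp
      (continuous_compSubConst f))).integrable_of_hasCompactSupport hφ.smul_right
  ext i y
  have h := ContinuousLinearMap.integral_comp_comm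
    ((BoundedContinuousFunction.evalCLM ℂ y).comp
      (ContinuousLinearMap.proj (R := ℂ) (φ := fun _ : s => BoundedContinuousFunction ℝ ℂ) i)) hint
  refine Eq.trans ?_ h
  change weightedDeriv i.1.1 i.1.2 (conv φ f) y =
    ∫ x, φ x • weightedDeriv i.1.1 i.1.2 (SchwartzMap.compSubConstCLM ℂ x f) y
  simp only [weightedDeriv_apply, derivCLM_iterate_conv, derivCLM_iterate_compSubConst,
    conv_apply, SchwartzMap.compSubConstCLM_apply, smul_eq_mul]
  rw [← integral_const_mul]
  congr 1
  ext x
  ring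

end Schwartz

/-! ### Density of compactly supported test functions -/

section Cutoff

/-- The Schwartz function `x ↦ f (c * x)`, for `c ≠ 0`. -/
def rescale (c : ℝˣ) (f : 𝓢(ℝ, ℂ)) : 𝓢(ℝ, ℂ) :=
  SchwartzMap.compCLMOfContinuousLinearEquiv ℂ (ContinuousLinearEquiv.unitsEquivAut ℝ c) f

@[simp] theorem rescale_apply (c : ℝˣ) (f : 𝓢(ℝ, ℂ)) (x : ℝ) : rescale c f x = f (c * x) := by
  simp [rescale, mul_comm]

/-- The product of Schwartz functions. -/
def pmul (f g : 𝓢(ℝ, ℂ)) : 𝓢(ℝ, ℂ) := SchwartzMap.pairing (ContinuousLinearMap.mul ℂ ℂ) f g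

@[simp] theorem pmul_apply (f g : 𝓢(ℝ, ℂ)) (x : ℝ) : pmul f g x = f x * g x := rfl

/-- Where `c * |x| < r` the function vanishes near `x`; elsewhere `c * |x| / r ≥ 1` pays for a
uniform bound, and differentiation only adds factors `c ≤ 1`. -/
theorem norm_iteratedDeriv_cutoff_sub_one_le (χ : 𝓢(ℝ, ℂ)) {r : ℝ} (hr : 0 < r)
    (hχ : ∀ x, |x| < r → χ x = 1) (i : ℕ) :
    ∃ M, 0 ≤ M ∧ ∀ (c : ℝ), 0 < c → c ≤ 1 → ∀ x,
      ‖iteratedFDeriv ℝ i (fun y => χ (c * y) - 1) x‖ ≤ M * (c * |x|) := by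
  refine ⟨(SchwartzMap.seminorm ℂ 0 i χ + 1) / r, by positivity, fun c hc hc1 x => ?_⟩
  rw [norm_iteratedFDeriv_eq_norm_iteratedDeriv]
  rcases lt_or_ge (c * |x|) r with h | h
  · have hev : (fun y => χ (c * y) - 1) =ᶠ[𝓝 x] fun _ => 0 := by
      have hop : IsOpen {y : ℝ | c * |y| < r} := isOpen_lt (by fun_prop) (by fun_prop)
      filter_upwards [hop.mem_nhds h] with y hy
      rw [hχ _ (by rwa [abs_mul, abs_of_pos hc]), sub_self]
    rw [hev.iteratedDeriv_eq i]
    simp only [iteratedDeriv_const, ite_self, norm_zero]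
    positivity
  · have hs : ContDiff ℝ i fun y => χ y - 1 := (χ.smooth i).sub contDiff_const
    rw [iteratedDeriv_comp_const_smul (f := fun y => χ y - 1) hs c]
    have h1 : ‖iteratedDeriv i (fun y => χ y - 1) (c * x)‖ ≤ SchwartzMap.seminorm ℂ 0 i χ + 1 := by
      rw [iteratedDeriv_fun_sub (χ.smooth i).contDiffAt contDiffAt_const]
      refine (norm_sub_le _ _).trans (add_le_add ?_ ?_)
      · simpa using SchwartzMap.le_seminorm' ℂ 0 i χ (c * x)
      · rw [iteratedDeriv_const]
        split_ifs <;> simp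
    rw [norm_smul, div_mul_eq_mul_div, le_div_iff₀ hr]
    have h2 : ‖c ^ i‖ ≤ 1 := by
      rw [norm_pow, Real.norm_of_nonneg hc.le]
      exact pow_le_one₀ hc.le hc1
    calc _ ≤ 1 * (SchwartzMap.seminorm ℂ 0 i χ + 1) * r := by gcongr
      _ ≤ _ := by rw [one_mul]; gcongr

/-- Multiplication with a wide cutoff function approximates the identity of Schwartz space. -/
theorem tendsto_cutoff_mul (χ : 𝓢(ℝ, ℂ)) {r : ℝ} (hr : 0 < r) (hχ : ∀ x, |x| < r → χ x = 1)
    (c : ℕ → ℝˣ) (hc : ∀ n, 0 < (c n : ℝ)) (hc1 : ∀ n, (c n : ℝ) ≤ 1)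
    (hc0 : Tendsto (fun n => (c n : ℝ)) atTop (𝓝 0)) (f : 𝓢(ℝ, ℂ)) :
    Tendsto (fun n => pmul (rescale (c n) χ) f) atTop (𝓝 f) := by
  choose M hM0 hM using norm_iteratedDeriv_cutoff_sub_one_le χ hr hχ
  rw [(schwartz_withSeminorms ℂ ℝ ℂ).tendsto_nhds]
  rintro ⟨k, l⟩ ε hε
  -- The factor `|x|` lost in the cutoff estimate is absorbed by the weight `k + 1`; the factor `c
  -- n` that remains tends to zero.
  set D : ℝ := ∑ i ∈ Finset.range (l + 1),
    (l.choose i : ℝ) * M i * SchwartzMap.seminorm ℂ (k + 1) (l - i) f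
  have hD : 0 ≤ D := Finset.sum_nonneg fun i _ =>
    mul_nonneg (mul_nonneg (by positivity) (hM0 i)) (apply_nonneg _ _)
  have hb : ∀ n, SchwartzMap.seminorm ℂ k l (pmul (rescale (c n) χ) f - f) ≤ c n * D := by
    intro n
    refine SchwartzMap.seminorm_le_bound ℂ k l _ (mul_nonneg (hc n).le hD) fun x => ?_
    have heq : ((pmul (rescale (c n) χ) f - f : 𝓢(ℝ, ℂ)) : ℝ → ℂ) =
        fun y => (χ (c n * y) - 1) * f y := by
      ext y
      simp [sub_mul]
    rw [heq]
    have h1 := norm_iteratedFDeriv_mul_le (𝕜 := ℝ) (N := l) (f := fun y => χ (c n * y) - 1) (g := f)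
      (((χ.smooth l).comp (contDiff_const.mul contDiff_id)).sub contDiff_const) (f.smooth l) x
      le_rfl
    refine (mul_le_mul_of_nonneg_left h1 (by positivity)).trans ?_
    rw [Finset.mul_sum, Finset.mul_sum]
    refine Finset.sum_le_sum fun i _ => ?_
    have h2 := hM i (c n) (hc n) (hc1 n) x
    have h3 := SchwartzMap.le_seminorm ℂ (k + 1) (l - i) f x
    calc ‖x‖ ^ k * (l.choose i * ‖iteratedFDeriv ℝ i (fun y => χ (c n * y) - 1) x‖ *
          ‖iteratedFDeriv ℝ (l - i) f x‖)
        ≤ ‖x‖ ^ k * (l.choose i * (M i * (c n * |x|)) * ‖iteratedFDeriv ℝ (l - i) f x‖) := by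
          gcongr
      _ = c n * (l.choose i * M i * (‖x‖ ^ (k + 1) * ‖iteratedFDeriv ℝ (l - i) f x‖)) := by
          rw [Real.norm_eq_abs]; ring
      _ ≤ _ := by
          have := hM0 i
          have := hc n
          gcongr
  have hlim : Tendsto (fun n => (c n : ℝ) * D) atTop (𝓝 0) := by
    simpa using hc0.mul_const D
  filter_upwards [hlim.eventually_lt_const hε] with n hn
  exact (hb n).trans_lt hn

/-- The unit `2 ^ n`. -/
def twoPow (n : ℕ) : ℝˣ := Units.mk0 ((2 : ℝ) ^ n) (by positivity)

@[simp] theorem coe_twoPow (n : ℕ) : (twoPow n : ℝ) = 2 ^ n := rfl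

@[simp] theorem coe_twoPow_inv (n : ℕ) : ((twoPow n)⁻¹ : ℝˣ) = ((2 : ℝ) ^ n)⁻¹ := by
  simp

theorem tendsto_cutoff_mul_two_pow (χ : 𝓢(ℝ, ℂ)) {r : ℝ} (hr : 0 < r)
    (hχ : ∀ x, |x| < r → χ x = 1) (f : 𝓢(ℝ, ℂ)) :
    Tendsto (fun n => pmul (rescale (twoPow n)⁻¹ χ) f) atTop (𝓝 f) := by
  refine tendsto_cutoff_mul χ hr hχ (fun n => (twoPow n)⁻¹) (fun n => ?_) (fun n => ?_) ?_ f
  · rw [coe_twoPow_inv]; positivity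
  · rw [coe_twoPow_inv]; exact inv_le_one_of_one_le₀ (one_le_pow₀ one_le_two)
  · simp only [coe_twoPow_inv]
    exact tendsto_inv_atTop_zero.comp (tendsto_pow_atTop_atTop_of_one_lt one_lt_two)

theorem exists_cutoff : ∃ χ : 𝓢(ℝ, ℂ), HasCompactSupport χ ∧ (∀ x, |x| < 1 → χ x = 1) ∧
    ∀ x, ‖χ x‖ ≤ 1 := by
  let b : ContDiffBump (0 : ℝ) := ⟨1, 2, one_pos, one_lt_two⟩
  have hc : HasCompactSupport fun x => ((b x : ℝ) : ℂ) :=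
    b.hasCompactSupport.comp_left (g := fun x : ℝ => (x : ℂ)) Complex.ofReal_zero
  have hd : ContDiff ℝ ∞ fun x => ((b x : ℝ) : ℂ) := Complex.ofRealCLM.contDiff.comp b.contDiff
  refine ⟨hc.toSchwartzMap hd, hc, fun x hx => ?_, fun x => ?_⟩
  · change ((b x : ℝ) : ℂ) = 1
    rw [b.one_of_mem_closedBall (by simpa [b] using hx.le), Complex.ofReal_one]
  · change ‖((b x : ℝ) : ℂ)‖ ≤ 1
    rw [Complex.norm_real, Real.norm_of_nonneg b.nonneg]
    exact b.le_one

theorem exists_tendsto_hasCompactSupport (φ : 𝓢(ℝ, ℂ)) :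
    ∃ ψ : ℕ → 𝓢(ℝ, ℂ), (∀ n, HasCompactSupport (ψ n)) ∧ Tendsto ψ atTop (𝓝 φ) := by
  obtain ⟨χ, hc, h1, -⟩ := exists_cutoff
  refine ⟨fun n => pmul (rescale (twoPow n)⁻¹ χ) φ, fun n => ?_,
    tendsto_cutoff_mul_two_pow χ one_pos h1 φ⟩
  have : HasCompactSupport (rescale (twoPow n)⁻¹ χ) :=
    (hc.comp_homeomorph (ContinuousLinearEquiv.unitsEquivAut ℝ (twoPow n)⁻¹).toHomeomorph :)
  exact this.mul_right

variable {E : Type*} [NormedAddCommGroup E] [NormedSpace ℂ E]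

/-- Continuous linear maps on Schwartz space are determined by the test functions. -/
theorem clm_ext_of_hasCompactSupport {T S : 𝓢(ℝ, ℂ) →L[ℂ] E}
    (h : ∀ φ : 𝓢(ℝ, ℂ), HasCompactSupport φ → T φ = S φ) (φ : 𝓢(ℝ, ℂ)) : T φ = S φ := by
  obtain ⟨ψ, hc, hψ⟩ := exists_tendsto_hasCompactSupport φ
  refine tendsto_nhds_unique ((T.continuous.tendsto φ).comp hψ) ?_
  refine ((S.continuous.tendsto φ).comp hψ).congr fun n => ?_
  exact (h _ (hc n)).symm

theorem distribution_ext {T S : 𝓢'(ℝ, E)}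
    (h : ∀ φ : 𝓢(ℝ, ℂ), HasCompactSupport φ → T φ = S φ) : T = S :=
  DFunLike.ext _ _ fun φ => clm_ext_of_hasCompactSupport (T := ⟨T.toLinearMap, T.continuous⟩)
    (S := ⟨S.toLinearMap, S.continuous⟩) h φ

end Cutoff

/-! ### Integration of Schwartz functions against functions of linear growth -/

section Smear

variable {E F G : Type*} [NormedAddCommGroup E] [NormedSpace ℂ E]
  [NormedAddCommGroup F] [NormedSpace ℂ F] [NormedAddCommGroup G] [NormedSpace ℂ G]

theorem integrable_weight_mul (K : 𝓢(ℝ, ℂ)) : Integrable fun x : ℝ => (1 + |x|) * ‖K x‖ := by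
  have h0 := K.integrable (μ := volume) |>.norm
  have h1 := K.integrable_pow_mul volume 1
  refine (h0.add h1).congr (Eventually.of_forall fun x => ?_)
  simp [add_mul]

theorem integrable_smul_of_growth (K : 𝓢(ℝ, ℂ)) {f : ℝ → E} (hf : Continuous f) {C : ℝ}
    (hC : ∀ x, ‖f x‖ ≤ C * (1 + |x|)) : Integrable fun x => K x • f x := by
  refine ((integrable_weight_mul K).const_mul C).mono'
    (K.continuous.smul hf).aestronglyMeasurable (Eventually.of_forall fun x => ?_)
  rw [norm_smul]
  nlinarith [hC x, norm_nonneg (K x)]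

theorem norm_integral_smul_le (K : 𝓢(ℝ, ℂ)) {f : ℝ → E} {C : ℝ}
    (hC : ∀ x, ‖f x‖ ≤ C * (1 + |x|)) :
    ‖∫ x, K x • f x‖ ≤ C * ∫ x : ℝ, (1 + |x|) * ‖K x‖ := by
  rw [← integral_const_mul]
  refine norm_integral_le_of_norm_le ((integrable_weight_mul K).const_mul C)
    (Eventually.of_forall fun x => ?_)
  rw [norm_smul]
  nlinarith [hC x, norm_nonneg (K x)]

theorem exists_seminorm_bound_weight : ∃ (s : Finset (ℕ × ℕ)) (D : ℝ), 0 ≤ D ∧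
    ∀ K : 𝓢(ℝ, ℂ), ∫ x : ℝ, (1 + |x|) * ‖K x‖ ≤ D * (s.sup (schwartzSeminormFamily ℂ ℝ ℂ)) K := by
  have h := fun k : ℕ => SchwartzMap.integral_pow_mul_iteratedFDeriv_le (D := ℝ) (V := ℂ) ℂ
    (μ := volume)
  set d := (volume : Measure ℝ).integrablePower
  set I : ℝ := ∫ x : ℝ, (1 + ‖x‖) ^ (-(d : ℝ))
  have hI : 0 ≤ I := integral_nonneg fun x => by positivity
  let s : Finset (ℕ × ℕ) := {(0, 0), (0 + d, 0), (1 + d, 0)}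
  refine ⟨s, 2 * (2 ^ d * I * 2), by positivity, fun K => ?_⟩
  have hp : ∀ m ∈ s, SchwartzMap.seminorm ℂ m.1 m.2 K ≤ (s.sup (schwartzSeminormFamily ℂ ℝ ℂ)) K :=
    fun m hm => Seminorm.le_def.1 (Finset.le_sup (f := schwartzSeminormFamily ℂ ℝ ℂ) hm) K
  have e0 := SchwartzMap.integral_pow_mul_iteratedFDeriv_le ℂ volume K 0 0
  have e1 := SchwartzMap.integral_pow_mul_iteratedFDeriv_le ℂ volume K 1 0
  have a0 := hp (0, 0) (by simp [s])
  have a1 := hp (0 + d, 0) (by simp [s])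
  have a2 := hp (1 + d, 0) (by simp [s])
  simp only [norm_iteratedFDeriv_zero, pow_zero, one_mul, pow_one] at e0 e1
  have hsum : ∫ x : ℝ, (1 + |x|) * ‖K x‖ = (∫ x, ‖K x‖) + ∫ x : ℝ, ‖x‖ * ‖K x‖ := by
    rw [← integral_add (K.integrable.norm) (by simpa using K.integrable_pow_mul volume 1)]
    simp [add_mul]
  rw [hsum]
  set Q := (s.sup (schwartzSeminormFamily ℂ ℝ ℂ)) K
  have f0 : ∫ x, ‖K x‖ ≤ 2 ^ d * I * (Q + Q) := e0.trans (by gcongr)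
  have f1 : ∫ x : ℝ, ‖x‖ * ‖K x‖ ≤ 2 ^ d * I * (Q + Q) := e1.trans (by gcongr)
  linarith

/-- The tempered distribution given by a continuous function of linear growth. -/
theorem exists_distribution_of_growth {f : ℝ → E} (hf : Continuous f) {C : ℝ}
    (hC : ∀ x, ‖f x‖ ≤ C * (1 + |x|)) :
    ∃ T : 𝓢'(ℝ, E), ∀ φ : 𝓢(ℝ, ℂ), T φ = ∫ x, φ x • f x := by
  obtain ⟨s, D, hD, hs⟩ := exists_seminorm_bound_weight
  have hC0 : 0 ≤ C := by
    have := (norm_nonneg _).trans (hC 0)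
    simpa using this
  let A : 𝓢(ℝ, ℂ) →L[ℂ] E := SchwartzMap.mkCLMtoNormedSpace (σ := RingHom.id ℂ)
    (fun φ => ∫ x, φ x • f x)
    (fun φ ψ => by
      simp only [add_apply, add_smul]
      exact integral_add (integrable_smul_of_growth φ hf hC) (integrable_smul_of_growth ψ hf hC))
    (fun a φ => by
      simp only [smul_apply, smul_assoc, RingHom.id_apply]
      exact integral_smul a _)
    ⟨s, C * D, by positivity, fun φ => by
      refine (norm_integral_smul_le φ hC).trans ?_
      rw [mul_assoc]
      gcongr
      exact hs φ⟩
  exact ⟨(A : 𝓢'(ℝ, E)), fun φ => rfl⟩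

end Smear

/-! ### Convolution with distributions, and spectra of products -/

section Convolve

variable {E F G : Type*} [NormedAddCommGroup E] [NormedSpace ℂ E]
  [NormedAddCommGroup F] [NormedSpace ℂ F] [NormedAddCommGroup G] [NormedSpace ℂ G]

/-- The convolution `K * T` of a tempered distribution with a Schwartz function. -/
def smear (T : 𝓢'(ℝ, E)) (K : 𝓢(ℝ, ℂ)) (x : ℝ) : E := T (reflAt K x)

theorem block_eq_smear (P : DyadicPartition) (j : ℕ) (T : 𝓢'(ℝ, E)) :
    block P j T = smear T (P.kernel j) := by
  ext x
  rw [block, P.kernelAt_eq, smear]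

theorem continuous_smear (T : 𝓢'(ℝ, E)) (K : 𝓢(ℝ, ℂ)) : Continuous (smear T K) :=
  T.continuous.comp (continuous_reflAt K)

theorem reflAt_add (K L : 𝓢(ℝ, ℂ)) (x : ℝ) : reflAt (K + L) x = reflAt K x + reflAt L x := by
  ext; simp

theorem smear_add_kernel (T : 𝓢'(ℝ, E)) (K L : 𝓢(ℝ, ℂ)) (x : ℝ) :
    smear T (K + L) x = smear T K x + smear T L x := by
  simp only [smear, reflAt_add, map_add]

theorem smear_derivCLM (T : 𝓢'(ℝ, E)) (K : 𝓢(ℝ, ℂ)) :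
    smear (TemperedDistribution.derivCLM E T) K = smear T (SchwartzMap.derivCLM ℂ ℂ K) := by
  ext x
  rw [smear, smear, TemperedDistribution.derivCLM_apply_apply]
  congr 1
  ext y
  have h : HasDerivAt (reflAt K x) (deriv K (x - y) * (-1)) y := by
    have h1 : HasDerivAt (fun y : ℝ => K (x - y)) ((-1 : ℝ) • deriv K (x - y)) y :=
      HasDerivAt.scomp y (K.hasDerivAt (x - y)) ((hasDerivAt_id y).const_sub x)
    have h2 : (reflAt K x : ℝ → ℂ) = fun y => K (x - y) := funext fun y => reflAt_apply K x y
    rw [h2]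
    simpa using h1
  change -(SchwartzMap.derivCLM ℂ ℂ (reflAt K x) y) = _
  rw [SchwartzMap.derivCLM_apply, h.deriv, reflAt_apply, SchwartzMap.derivCLM_apply]
  ring

/-- The convolution of a Schwartz function with a function. -/
def convolve (K : 𝓢(ℝ, ℂ)) (f : ℝ → E) (x : ℝ) : E := ∫ y, K y • f (x - y)

theorem convolve_eq (K : 𝓢(ℝ, ℂ)) (f : ℝ → E) (x : ℝ) :
    convolve K f x = ∫ z, K (x - z) • f z := by
  rw [convolve, ← integral_sub_left_eq_self _ volume x]
  simp

theorem integrable_smul_of_bounded (K : 𝓢(ℝ, ℂ)) {f : ℝ → E} (hf : Continuous f) {M : ℝ}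
    (hM : ∀ x, ‖f x‖ ≤ M) : Integrable fun x => K x • f x := by
  have hM0 : 0 ≤ M := (norm_nonneg _).trans (hM 0)
  exact integrable_smul_of_growth K hf (C := M) fun x =>
    (hM x).trans (le_mul_of_one_le_right hM0 (by simp))

theorem norm_integral_smul_le_of_bounded (K : 𝓢(ℝ, ℂ)) {f : ℝ → E} {M : ℝ}
    (hM : ∀ x, ‖f x‖ ≤ M) : ‖∫ x, K x • f x‖ ≤ (∫ x, ‖K x‖) * M := by
  rw [← integral_mul_const]
  refine norm_integral_le_of_norm_le (K.integrable.norm.mul_const M)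
    (Eventually.of_forall fun x => ?_)
  rw [norm_smul]
  exact mul_le_mul_of_nonneg_left (hM x) (norm_nonneg _)

theorem norm_convolve_le (K : 𝓢(ℝ, ℂ)) {f : ℝ → E} {M : ℝ} (hM : ∀ x, ‖f x‖ ≤ M) (x : ℝ) :
    ‖convolve K f x‖ ≤ (∫ x, ‖K x‖) * M :=
  norm_integral_smul_le_of_bounded K fun y => hM (x - y)

theorem hasDerivAt_convolve (K : 𝓢(ℝ, ℂ)) {f : ℝ → E} (hf : Continuous f) {M : ℝ}
    (hM : ∀ x, ‖f x‖ ≤ M) (x : ℝ) :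
    HasDerivAt (convolve K f) (convolve (SchwartzMap.derivCLM ℂ ℂ K) f x) x := by
  have hM0 : 0 ≤ M := (norm_nonneg _).trans (hM 0)
  set K' := SchwartzMap.derivCLM ℂ ℂ K
  set S := SchwartzMap.seminorm ℂ 0 0 K' + SchwartzMap.seminorm ℂ 2 0 K'
  have hS : ∀ w, (1 + w ^ 2) * ‖K' w‖ ≤ S := by
    intro w
    have h0 := SchwartzMap.le_seminorm' ℂ 0 0 K' w
    have h2 := SchwartzMap.le_seminorm' ℂ 2 0 K' w
    simp only [iteratedDeriv_zero, pow_zero, one_mul, sq_abs] at h0 h2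
    rw [add_mul, one_mul]
    exact add_le_add h0 h2
  rw [convolve_eq, funext (convolve_eq K f)]
  -- The derivative of `K` decays like `1 / (1 + w ^ 2)`. For `|y - x| < 1` one has `1 + (x - z) ^ 2
  -- ≤ 3 * (1 + (y - z) ^ 2)`, whence the factor 3 and a dominating function that does not depend on
  -- `y`.
  refine (hasDerivAt_integral_of_dominated_loc_of_deriv_le (𝕜 := ℝ)
    (bound := fun z => 3 * S * M * (1 + (x - z) ^ 2)⁻¹)
    (F := fun x z => K (x - z) • f z) (F' := fun x z => K' (x - z) • f z)
    (Metric.ball_mem_nhds x one_pos) ?_ ?_ ?_ ?_ ?_ ?_).2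
  · exact Eventually.of_forall fun y => Continuous.aestronglyMeasurable (by fun_prop)
  · have := integrable_smul_of_bounded (reflAt K x) hf hM
    simpa using this
  · exact Continuous.aestronglyMeasurable (by fun_prop)
  · refine Eventually.of_forall fun z y hy => ?_
    rw [norm_smul]
    have h1 : |y - x| < 1 := by simpa [Real.dist_eq] using hy
    have h2 : 1 + (x - z) ^ 2 ≤ 3 * (1 + (y - z) ^ 2) := by
      have : (y - x) ^ 2 ≤ 1 := by
        rw [← sq_abs]; nlinarith [abs_nonneg (y - x)]
      nlinarith [sq_nonneg ((y - x) + (y - z)), sq_nonneg (y - z)]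
    have h3 := hS (y - z)
    have h4 : ‖K' (y - z)‖ ≤ 3 * S * (1 + (x - z) ^ 2)⁻¹ := by
      rw [← div_eq_mul_inv, le_div_iff₀ (by positivity)]
      nlinarith [norm_nonneg (K' (y - z))]
    calc ‖K' (y - z)‖ * ‖f z‖ ≤ (3 * S * (1 + (x - z) ^ 2)⁻¹) * M :=
          mul_le_mul h4 (hM z) (norm_nonneg _) ((norm_nonneg _).trans h4)
      _ = _ := by ring
  · exact (integrable_inv_one_add_sq.comp_sub_left x).const_mul _
  · refine Eventually.of_forall fun z y _ => ?_
    have h1 : HasDerivAt (fun y : ℝ => K (y - z)) (K' (y - z)) y :=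
      (K.hasDerivAt (y - z)).comp_sub_const y z
    exact h1.smul_const (f z)

theorem continuous_convolve (K : 𝓢(ℝ, ℂ)) {f : ℝ → E} (hf : Continuous f) {M : ℝ}
    (hM : ∀ x, ‖f x‖ ≤ M) : Continuous (convolve K f) :=
  continuous_iff_continuousAt.2 fun x => (hasDerivAt_convolve K hf hM x).continuousAt

theorem integral_convolve_derivCLM [CompleteSpace E] (L : 𝓢(ℝ, ℂ)) {f : ℝ → E} (hf : Continuous f)
    {M : ℝ} (hM : ∀ x, ‖f x‖ ≤ M) (s t : ℝ) :
    ∫ r in s..t, convolve (SchwartzMap.derivCLM ℂ ℂ L) f r = convolve L f t - convolve L f s :=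
  intervalIntegral.integral_eq_sub_of_hasDerivAt (fun x _ => hasDerivAt_convolve L hf hM x)
    ((continuous_convolve _ hf hM).intervalIntegrable s t)

theorem map_conv_reflection_eq_integral [CompleteSpace E] (T : 𝓢'(ℝ, E)) (φ K : 𝓢(ℝ, ℂ))
    (hφ : HasCompactSupport φ) : T (conv φ (reflection K)) = ∫ x, φ x • smear T K x :=
  map_conv_eq_integral ⟨T.toLinearMap, T.continuous⟩ φ (reflection K) hφ

/-- Once `smear T K` is bounded, both sides are continuous in `φ`, so density of the compactly
supported functions removes the support condition. -/
theorem map_conv_reflection_eq_integral_of_bounded [CompleteSpace E] (T : 𝓢'(ℝ, E))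
    (K : 𝓢(ℝ, ℂ)) {M : ℝ} (hM : ∀ x, ‖smear T K x‖ ≤ M) (φ : 𝓢(ℝ, ℂ)) :
    T (conv φ (reflection K)) = ∫ x, φ x • smear T K x := by
  have hM0 : 0 ≤ M := (norm_nonneg _).trans (hM 0)
  obtain ⟨S, hS⟩ := exists_distribution_of_growth (C := M) (continuous_smear T K) fun x =>
    (hM x).trans (le_mul_of_one_le_right hM0 (by simp))
  rw [← hS]
  let A : 𝓢(ℝ, ℂ) →L[ℂ] E := (⟨T.toLinearMap, T.continuous⟩ : 𝓢(ℝ, ℂ) →L[ℂ] E).comp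
    (SchwartzMap.convolution (ContinuousLinearMap.mul ℂ ℂ).flip (reflection K))
  exact clm_ext_of_hasCompactSupport (T := A) (S := ⟨S.toLinearMap, S.continuous⟩)
    (fun φ hφ => (map_conv_reflection_eq_integral T φ K hφ).trans (hS φ).symm) φ

theorem reflAt_conv (K₁ K₂ : 𝓢(ℝ, ℂ)) (x : ℝ) :
    reflAt (conv K₁ K₂) x = conv (reflAt K₁ x) (reflection K₂) := by
  ext y
  rw [reflAt_apply, conv_apply, conv_apply, ← integral_sub_left_eq_self _ volume x]
  refine integral_congr_ae (Eventually.of_forall fun z => ?_)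
  simp only [reflAt_apply, reflection_apply]
  congr 2
  ring

/-- Associativity of convolution. The test function `reflAt K₁ x` need not have compact support, so
the version for bounded `smear T K₂` is the one that applies. -/
theorem smear_conv [CompleteSpace E] (T : 𝓢'(ℝ, E)) (K₁ K₂ : 𝓢(ℝ, ℂ)) {M : ℝ}
    (hM : ∀ x, ‖smear T K₂ x‖ ≤ M) : smear T (conv K₁ K₂) = convolve K₁ (smear T K₂) := by
  ext x
  rw [smear, reflAt_conv, map_conv_reflection_eq_integral_of_bounded T K₂ hM, convolve_eq]
  simp

theorem fourier_compSubConst (a : ℝ) (K : 𝓢(ℝ, ℂ)) (ζ : ℝ) :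
    𝓕 (SchwartzMap.compSubConstCLM ℂ a K) ζ = Real.fourierChar (-(a * ζ)) • 𝓕 K ζ := by
  rw [SchwartzMap.fourier_coe, SchwartzMap.fourier_coe, Real.fourier_real_eq, Real.fourier_real_eq,
    Circle.smul_def, ← integral_smul,
    ← integral_sub_right_eq_self (fun v => _ • Real.fourierChar (-(v * ζ)) • K v) a]
  refine integral_congr_ae (Eventually.of_forall fun v => ?_)
  simp only [SchwartzMap.compSubConstCLM_apply]
  rw [← Circle.smul_def, smul_smul, ← AddChar.map_add_eq_mul]
  congr 2
  ring

theorem fourier_fourier_apply (f : 𝓢(ℝ, ℂ)) (x : ℝ) : 𝓕 (𝓕 f) x = f (-x) := by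
  have h : 𝓕⁻ (𝓕 f) (-x) = 𝓕 (𝓕 f) x := by
    rw [SchwartzMap.fourierInv_apply_eq]
    simp
  rw [← h]
  simp

theorem fourierInv_apply_eq_neg (f : 𝓢(ℝ, ℂ)) (x : ℝ) : 𝓕⁻ f x = 𝓕 f (-x) := by
  rw [SchwartzMap.fourierInv_apply_eq]
  simp

/-- The Fourier support of a product is contained in the sum of the Fourier supports. -/
theorem conv_pmul_eq_self (M K₁ K₂ : 𝓢(ℝ, ℂ))
    (hM : ∀ ξ ζ, 𝓕 K₁ ξ ≠ 0 → 𝓕 K₂ ζ ≠ 0 → 𝓕 M (ξ + ζ) = 1) : conv M (pmul K₁ K₂) = pmul K₁ K₂ := by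
  refine fourier_ext fun η => ?_
  rw [fourier_conv]
  by_cases h0 : 𝓕 (pmul K₁ K₂) η = 0
  · rw [h0, mul_zero]
  suffices 𝓕 M η = 1 by rw [this, one_mul]
  -- The transform of a product is the convolution of the transforms. If it is nonzero at `η`, some
  -- splitting of `η` into two frequencies has both factors nonzero, and there `M` has transform 1.
  have h1 : pmul K₁ K₂ = 𝓕 (conv (𝓕⁻ K₁) (𝓕⁻ K₂)) := by
    ext ξ
    rw [fourier_conv]
    simp
  rw [h1, fourier_fourier_apply, conv_apply] at h0
  obtain ⟨t, ht⟩ : ∃ t, (𝓕⁻ K₁) t * (𝓕⁻ K₂) (-η - t) ≠ 0 := by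
    by_contra! hc
    exact h0 (by simp [hc])
  rw [fourierInv_apply_eq_neg, fourierInv_apply_eq_neg] at ht
  have := hM (-t) (-(-η - t)) (left_ne_zero_of_mul ht) (right_ne_zero_of_mul ht)
  rwa [show -t + -(-η - t) = η by ring] at this

/-- Translating `K₂` by `p - q` multiplies its Fourier transform by a phase and keeps its support,
so `conv_pmul_eq_self` applies to the translate. This decouples the arguments of the two factors, as
is needed before integrating against `f` and `g`. -/
theorem integral_mul_mul_eq (M K₁ K₂ : 𝓢(ℝ, ℂ))
    (hM : ∀ ξ ζ, 𝓕 K₁ ξ ≠ 0 → 𝓕 K₂ ζ ≠ 0 → 𝓕 M (ξ + ζ) = 1) (p q : ℝ) :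
    ∫ w, M w * (K₁ (p - w) * K₂ (q - w)) = K₁ p * K₂ q := by
  have h := conv_pmul_eq_self M K₁ (SchwartzMap.compSubConstCLM ℂ (p - q) K₂) (fun ξ ζ h1 h2 => by
    refine hM ξ ζ h1 fun h3 => h2 ?_
    rw [fourier_compSubConst, h3, smul_zero])
  have h2 := congrArg (fun f : 𝓢(ℝ, ℂ) => f p) h
  simp only [conv_apply, pmul_apply, SchwartzMap.compSubConstCLM_apply] at h2
  have e : ∀ w, p - w - (p - q) = q - w := fun w => by ring
  simpa only [e, sub_sub_cancel] using h2

/-- The spectrum of a product of band-limited functions is contained in the sum of the spectra. -/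
theorem convolve_bilin_eq_self [CompleteSpace E] [CompleteSpace F] [CompleteSpace G]
    (B : E →L[ℂ] F →L[ℂ] G) (M K₁ K₂ : 𝓢(ℝ, ℂ))
    (hM : ∀ ξ ζ, 𝓕 K₁ ξ ≠ 0 → 𝓕 K₂ ζ ≠ 0 → 𝓕 M (ξ + ζ) = 1)
    {f : ℝ → E} {g : ℝ → F} (hf : Continuous f) (hg : Continuous g) {Mf Mg : ℝ}
    (hMf : ∀ x, ‖f x‖ ≤ Mf) (hMg : ∀ x, ‖g x‖ ≤ Mg) (x : ℝ) :
    convolve M (fun y => B (convolve K₁ f y) (convolve K₂ g y)) x =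
      B (convolve K₁ f x) (convolve K₂ g x) := by
  -- Both convolutions become one integral against `H (a, b) = B (f a) (g b)`. After Fubini, the
  -- inner integral over `w` is `integral_mul_mul_eq` at the points `x - a` and `x - b`.
  let Φ : ℝ × (ℝ × ℝ) → ℂ := fun p => M p.1 * (K₁ (x - p.1 - p.2.1) * K₂ (x - p.1 - p.2.2))
  let H : ℝ × ℝ → G := fun q => B (f q.1) (g q.2)
  have hΦc : Continuous Φ := by fun_prop
  have hHc : Continuous H := (B.continuous.comp (by fun_prop : Continuous fun q : ℝ × ℝ => f q.1)).clm_apply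
    (by fun_prop)
  have i1 : ∀ c : ℝ, Integrable fun a => K₁ (c - a) := fun c => K₁.integrable.comp_sub_left c
  have i2 : ∀ c : ℝ, Integrable fun a => K₂ (c - a) := fun c => K₂.integrable.comp_sub_left c
  have hΦ : Integrable Φ := by
    refine (integrable_prod_iff hΦc.aestronglyMeasurable).2 ⟨Eventually.of_forall fun w => ?_, ?_⟩
    · exact ((i1 (x - w)).mul_prod (i2 (x - w))).const_mul (M w)
    · have : (fun w => ∫ q, ‖Φ (w, q)‖) = fun w => ‖M w‖ * ((∫ a, ‖K₁ a‖) * ∫ b, ‖K₂ b‖) := by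
        ext w
        simp only [Φ, norm_mul]
        rw [integral_const_mul]
        congr 1
        have h1 := integral_prod_mul (μ := volume) (ν := volume)
          (fun a => ‖K₁ (x - w - a)‖) (fun b => ‖K₂ (x - w - b)‖)
        rw [integral_sub_left_eq_self (fun a => ‖K₁ a‖) volume (x - w),
          integral_sub_left_eq_self (fun a => ‖K₂ a‖) volume (x - w)] at h1
        exact h1
      rw [this]
      exact M.integrable.norm.mul_const _
  have hH : ∀ q, ‖H q‖ ≤ ‖B‖ * Mf * Mg := fun q => by
    refine (B.le_opNorm₂ _ _).trans ?_
    have := (norm_nonneg _).trans (hMf 0)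
    gcongr
    · exact hMf _
    · exact hMg _
  have hΦH : Integrable fun p : ℝ × (ℝ × ℝ) => Φ p • H p.2 := by
    refine (hΦ.norm.mul_const (‖B‖ * Mf * Mg)).mono'
      (hΦc.smul (hHc.comp continuous_snd)).aestronglyMeasurable (Eventually.of_forall fun p => ?_)
    rw [norm_smul]
    exact mul_le_mul_of_nonneg_left (hH _) (norm_nonneg _)
  have key : ∀ c : ℝ, B (convolve K₁ f c) (convolve K₂ g c) =
      ∫ q : ℝ × ℝ, (K₁ (c - q.1) * K₂ (c - q.2)) • H q := by
    intro c
    rw [convolve_eq, convolve_eq]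
    have j1 := integrable_smul_of_bounded (reflAt K₁ c) hf hMf
    have j2 := integrable_smul_of_bounded (reflAt K₂ c) hg hMg
    simp only [reflAt_apply] at j1 j2
    have h := integral_prod_bilin B j1 j2
    rw [← h]
    refine integral_congr_ae (Eventually.of_forall fun q => ?_)
    simp [H, smul_smul, mul_comm]
  rw [key, convolve]
  have h1 : ∀ w, M w • B (convolve K₁ f (x - w)) (convolve K₂ g (x - w)) =
      ∫ q : ℝ × ℝ, Φ (w, q) • H q := by
    intro w
    rw [key, ← integral_smul]
    simp only [Φ, smul_smul]
  simp only [h1]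
  rw [integral_integral_swap (f := fun w q => Φ (w, q) • H q) hΦH]
  refine integral_congr_ae (Eventually.of_forall fun q => ?_)
  simp only
  rw [integral_smul_const]
  congr 1
  rw [← integral_mul_mul_eq M K₁ K₂ hM]
  refine integral_congr_ae (Eventually.of_forall fun w => ?_)
  simp only [Φ]
  congr 3 <;> ring

end Convolve

/-! ### Dilations and kernels with prescribed spectrum -/

section Dilation

/-- The dilation `x ↦ 2 ^ n * K (2 ^ n * x)`, which preserves the integral. -/
def dilation (n : ℕ) (K : 𝓢(ℝ, ℂ)) : 𝓢(ℝ, ℂ) := (2 ^ n : ℝ) • rescale (twoPow n) K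

@[simp] theorem dilation_apply (n : ℕ) (K : 𝓢(ℝ, ℂ)) (x : ℝ) :
    dilation n K x = (2 ^ n : ℝ) • K (2 ^ n * x) := by
  simp [dilation]

theorem fourier_dilation (n : ℕ) (K : 𝓢(ℝ, ℂ)) (ξ : ℝ) : 𝓕 (dilation n K) ξ = 𝓕 K (ξ / 2 ^ n) := by
  rw [SchwartzMap.fourier_coe, SchwartzMap.fourier_coe, Real.fourier_real_eq, Real.fourier_real_eq]
  have h := Measure.integral_comp_mul_left
    (fun v => Real.fourierChar (-(v * (ξ / 2 ^ n))) • K v) ((2 : ℝ) ^ n)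
  have hp : (0 : ℝ) < 2 ^ n := by positivity
  rw [abs_of_pos (inv_pos.2 hp), eq_inv_smul_iff₀ hp.ne', ← integral_smul] at h
  rw [← h]
  refine integral_congr_ae (Eventually.of_forall fun v => ?_)
  simp only [dilation_apply]
  rw [smul_comm, show (2 : ℝ) ^ n * v * (ξ / 2 ^ n) = v * ξ by field_simp]

theorem integral_dilation_eq (n : ℕ) (K : 𝓢(ℝ, ℂ)) (w : ℝ → ℝ) :
    ∫ x, w (2 ^ n * x) * ‖dilation n K x‖ = ∫ x, w x * ‖K x‖ := by
  have h := Measure.integral_comp_mul_left (fun v => w v * ‖K v‖) ((2 : ℝ) ^ n)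
  have hp : (0 : ℝ) < 2 ^ n := by positivity
  rw [abs_of_pos (inv_pos.2 hp), eq_inv_smul_iff₀ hp.ne', ← integral_smul] at h
  rw [← h]
  refine integral_congr_ae (Eventually.of_forall fun v => ?_)
  simp only [dilation_apply, norm_smul, Real.norm_of_nonneg hp.le, smul_eq_mul]
  ring

theorem integral_norm_dilation (n : ℕ) (K : 𝓢(ℝ, ℂ)) : ∫ x, ‖dilation n K x‖ = ∫ x, ‖K x‖ := by
  simpa using integral_dilation_eq n K fun _ => 1

theorem integral_abs_mul_norm_dilation (n : ℕ) (K : 𝓢(ℝ, ℂ)) :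
    ∫ x, |x| * ‖dilation n K x‖ = (2 ^ n)⁻¹ * ∫ x, |x| * ‖K x‖ := by
  have hp : (0 : ℝ) < 2 ^ n := by positivity
  rw [← integral_dilation_eq n K fun x => |x|, ← integral_const_mul]
  refine integral_congr_ae (Eventually.of_forall fun v => ?_)
  simp only [abs_mul, abs_of_pos hp]
  field_simp

theorem derivCLM_dilation (n : ℕ) (K : 𝓢(ℝ, ℂ)) :
    SchwartzMap.derivCLM ℂ ℂ (dilation n K) =
      (2 ^ n : ℝ) • dilation n (SchwartzMap.derivCLM ℂ ℂ K) := by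
  ext x
  have h1 : HasDerivAt (fun y : ℝ => K (2 ^ n * y)) ((2 ^ n : ℝ) • deriv K (2 ^ n * x)) x := by
    have := HasDerivAt.scomp x (K.hasDerivAt (2 ^ n * x)) ((hasDerivAt_id x).const_mul ((2 : ℝ) ^ n))
    simpa [Function.comp_def] using this
  have h2 : (dilation n K : ℝ → ℂ) = fun y => (2 ^ n : ℝ) • K (2 ^ n * y) :=
    funext fun y => dilation_apply n K y
  rw [SchwartzMap.derivCLM_apply, h2, (h1.fun_const_smul ((2 : ℝ) ^ n)).deriv, smul_apply,
    dilation_apply, SchwartzMap.derivCLM_apply]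

/-- Schwartz functions whose derivative has Fourier transform `1` on an annulus. -/
theorem exists_fourier_derivCLM_eq_one {c C : ℝ} (hc : 0 < c) :
    ∃ L : 𝓢(ℝ, ℂ), ∀ ξ : ℝ, c ≤ |ξ| → |ξ| ≤ C → 𝓕 (SchwartzMap.derivCLM ℂ ℂ L) ξ = 1 := by
  let b₁ : ContDiffBump (0 : ℝ) := ⟨|C| + 1, |C| + 2, by positivity, by linarith⟩
  let b₂ : ContDiffBump (0 : ℝ) := ⟨c / 4, c / 2, by positivity, by linarith⟩
  -- On the annulus `m` inverts the symbol of the derivative. The factor `1 - b₂` vanishes near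
  -- zero, so the division keeps `m` smooth; `b₁` makes its support compact.
  let m : ℝ → ℂ := fun ξ => ((b₁ ξ * (1 - b₂ ξ) : ℝ) : ℂ) / (2 * Real.pi * Complex.I * ξ)
  have hb₂ : ∀ ξ : ℝ, |ξ| < c / 4 → b₂ ξ = 1 := fun ξ hξ =>
    b₂.one_of_mem_closedBall (by simpa [b₂] using hξ.le)
  have hm : ContDiff ℝ ∞ m := by
    rw [contDiff_iff_contDiffAt]
    intro ξ
    by_cases hξ : ξ = 0
    · have : m =ᶠ[𝓝 ξ] fun _ => 0 := by
        filter_upwards [Metric.ball_mem_nhds ξ (show 0 < c / 4 by positivity)] with y hy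
        have : |y| < c / 4 := by simpa [hξ] using hy
        simp [m, hb₂ y this]
      exact contDiffAt_const.congr_of_eventuallyEq this
    · have h1 : ContDiff ℝ ∞ fun ξ : ℝ => ((b₁ ξ * (1 - b₂ ξ) : ℝ) : ℂ) :=
        Complex.ofRealCLM.contDiff.comp (b₁.contDiff.mul (contDiff_const.sub b₂.contDiff))
      have h2 : ContDiff ℝ ∞ fun ξ : ℝ => (2 * Real.pi * Complex.I * ξ : ℂ) :=
        contDiff_const.mul Complex.ofRealCLM.contDiff
      have h3 : (2 * Real.pi * Complex.I * ξ : ℂ) ≠ 0 := by simp [hξ, Real.pi_ne_zero]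
      have h4 := h1.contDiffAt.mul (h2.contDiffAt.inv (x := ξ) h3)
      exact h4.congr_of_eventuallyEq (Eventually.of_forall fun y => div_eq_mul_inv _ _)
  have hmc : HasCompactSupport m := by
    refine HasCompactSupport.intro b₁.hasCompactSupport.isCompact fun ξ hξ => ?_
    simp [m, image_eq_zero_of_notMem_tsupport hξ]
  refine ⟨𝓕⁻ (hmc.toSchwartzMap hm), fun ξ h1 h2 => ?_⟩
  rw [fourier_derivCLM]
  have h3 : 𝓕 (𝓕⁻ (hmc.toSchwartzMap hm)) ξ = m ξ := by
    rw [FourierTransform.fourier_fourierInv_eq]; rfl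
  rw [h3]
  have hξ : ξ ≠ 0 := fun h => by simp [h] at h1; linarith
  have e1 : b₁ ξ = 1 := b₁.one_of_mem_closedBall (by
    simp only [b₁, mem_closedBall_zero_iff, Real.norm_eq_abs]
    linarith [le_abs_self C])
  have e2 : b₂ ξ = 0 := b₂.zero_of_le_dist (by
    simp only [b₂, dist_zero_right, Real.norm_eq_abs]
    linarith)
  simp only [m, e1, e2]
  have h4 : (2 * Real.pi * Complex.I * ξ : ℂ) ≠ 0 := by simp [hξ, Real.pi_ne_zero]
  rw [sub_zero, one_mul, Complex.ofReal_one, mul_one_div_cancel h4]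

end Dilation

/-! ### Supports of the Littlewood-Paley symbols -/

namespace DyadicPartition

variable (P : DyadicPartition)

theorem symbol_nonneg (j : ℕ) (z : ℝ) : 0 ≤ P.symbol j z := by
  cases j with
  | zero => exact P.χ_nonneg z
  | succ j => exact P.ρ_nonneg _

/-- The partition identities at `z / 2` and at `z` contain the same series except for its first
term. Iteration telescopes the sums of symbols. -/
theorem χ_half (z : ℝ) : P.χ (z / 2) = P.χ z + P.ρ z := by
  have h1 := P.hasSum_one (z / 2)
  have h2 := (hasSum_nat_add_iff' 1).2 (P.hasSum_one z)
  have h3 : (fun j : ℕ => P.ρ (z / 2 / 2 ^ j)) = fun j : ℕ => P.ρ (z / 2 ^ (j + 1)) := by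
    ext j
    rw [pow_succ', div_div]
  rw [h3] at h1
  have := h1.unique h2
  simp at this
  linarith

theorem sum_symbol (n : ℕ) (z : ℝ) :
    ∑ k ∈ Finset.range (n + 1), P.symbol k z = P.χ (z / 2 ^ n) := by
  induction n with
  | zero => simp [symbol]
  | succ n ih =>
    rw [Finset.sum_range_succ, ih, pow_succ, ← div_div, χ_half]
    rfl

theorem symbol_le_χ {i n : ℕ} (h : i ≤ n) (z : ℝ) : P.symbol i z ≤ P.χ (z / 2 ^ n) := by
  rw [← sum_symbol]
  exact Finset.single_le_sum (f := fun k => P.symbol k z) (fun k _ => P.symbol_nonneg k z)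
    (Finset.mem_range.2 (by omega))

/-- Nonnegativity excludes cancellation in the telescoped sum, so every lower symbol is supported
where the dilated `χ` is nonzero. -/
theorem χ_ne_zero_of_symbol {i n : ℕ} (h : i ≤ n) {z : ℝ} (hz : P.symbol i z ≠ 0) :
    P.χ (z / 2 ^ n) ≠ 0 :=
  (((P.symbol_nonneg i z).lt_of_ne' hz).trans_le (P.symbol_le_χ h z)).ne'

theorem exists_χ_eq_one : ∃ r > 0, ∀ z, |z| < r → P.χ z = 1 := by
  obtain ⟨a, b, ha, -, h⟩ := P.ρ_supp
  refine ⟨a, ha, fun z hz => ?_⟩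
  have h0 : ∀ j : ℕ, P.ρ (z / 2 ^ j) = 0 := by
    intro j
    by_contra hne
    have h1 := (h (subset_tsupport _ hne)).1
    have h2 : |z / 2 ^ j| ≤ |z| := by
      rw [abs_div, abs_of_pos (by positivity : (0 : ℝ) < 2 ^ j)]
      exact div_le_self (abs_nonneg z) (one_le_pow₀ one_le_two)
    linarith
  have h1 := P.hasSum_one z
  simp only [h0] at h1
  have := h1.unique hasSum_zero
  linarith

theorem exists_χ_bound : ∃ b > 0, ∀ z, P.χ z ≠ 0 → |z| ≤ b := by
  obtain ⟨b, h⟩ := P.χ_supp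
  exact ⟨max b 1, by positivity, fun z hz => (h (subset_tsupport _ hz)).trans (le_max_left _ _)⟩

theorem fourier_kernel (j : ℕ) (ξ : ℝ) :
    𝓕 (P.kernel j) ξ = ((P.symbol j (2 * Real.pi * ξ) : ℝ) : ℂ) := by
  rw [kernel, FourierTransform.fourier_fourierInv_eq]
  rfl

theorem fourier_kernel_ne_zero {j : ℕ} {ξ : ℝ} (h : 𝓕 (P.kernel j) ξ ≠ 0) :
    P.symbol j (2 * Real.pi * ξ) ≠ 0 := by
  intro h0
  rw [fourier_kernel, h0] at h
  simp at h

theorem fourier_dilation_kernel_zero (n : ℕ) (ξ : ℝ) :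
    𝓕 (dilation n (P.kernel 0)) ξ = ((P.χ (2 * Real.pi * ξ / 2 ^ n) : ℝ) : ℂ) := by
  rw [fourier_dilation, fourier_kernel, mul_div_assoc]
  rfl

theorem sum_kernel (n : ℕ) :
    ∑ k ∈ Finset.range (n + 1), P.kernel k = dilation n (P.kernel 0) := by
  refine fourier_ext fun ξ => ?_
  rw [fourier_dilation_kernel_zero, ← sum_symbol, Complex.ofReal_sum]
  simp only [← fourier_kernel]
  induction n with
  | zero => simp
  | succ n ih =>
    rw [Finset.sum_range_succ _ (n + 1), Finset.sum_range_succ _ (n + 1),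
      FourierTransform.fourier_add, add_apply, ih]

theorem kernel_succ (n : ℕ) :
    P.kernel (n + 1) = dilation (n + 1) (P.kernel 0) - dilation n (P.kernel 0) := by
  rw [← sum_kernel, ← sum_kernel, Finset.sum_range_succ _ (n + 1), add_sub_cancel_left]

/-- The support of the symbol with index `j` has radius at most `b * 2 ^ j`, while the dilated `χ`
equals 1 up to `r * 2 ^ (j + N)`. A single `N` with `b / r < 2 ^ N` serves all `j`. -/
theorem exists_dilation_conv_kernel :
    ∃ N : ℕ, ∀ j, conv (dilation (j + N) (P.kernel 0)) (P.kernel j) = P.kernel j := by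
  obtain ⟨r, hr, h1⟩ := P.exists_χ_eq_one
  obtain ⟨b, hb, h2⟩ := P.exists_χ_bound
  obtain ⟨N, hN⟩ := pow_unbounded_of_one_lt (b / r) one_lt_two
  refine ⟨N, fun j => fourier_ext fun ξ => ?_⟩
  rw [fourier_conv]
  by_cases h : 𝓕 (P.kernel j) ξ = 0
  · rw [h, mul_zero]
  have h3 := h2 _ (P.χ_ne_zero_of_symbol le_rfl (P.fourier_kernel_ne_zero h))
  rw [fourier_dilation_kernel_zero, h1, Complex.ofReal_one, one_mul]
  rw [pow_add, ← div_div, abs_div, abs_of_pos (by positivity : (0 : ℝ) < 2 ^ N),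
    div_lt_iff₀ (by positivity)]
  rw [div_lt_iff₀ hr] at hN
  linarith

/-- A compact set and a closed set that are disjoint have positive distance, and evenness of `χ`
turns a difference of frequencies into a sum. This keeps the spectrum of a paraproduct term away
from zero. -/
theorem exists_pos_le_abs_add :
    ∃ c > 0, ∀ z w, P.χ z ≠ 0 → P.ρ (w / 2) ≠ 0 → c ≤ |z + w| := by
  have hd := P.disjoint_χ 1 le_rfl
  have hc : IsCompact (tsupport P.χ) := P.symbol_hasCompactSupport 0
  obtain ⟨r, hr, h⟩ := Metric.exists_pos_forall_lt_edist hc (isClosed_tsupport _) hd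
  refine ⟨r, NNReal.coe_pos.2 hr, fun z w hz hw => ?_⟩
  have h1 : -z ∈ tsupport P.χ := subset_tsupport _ (by
    rw [Function.mem_support, P.χ_even]; exact hz)
  have h2 : w ∈ tsupport fun z => P.ρ (z / 2 ^ 1) := subset_tsupport _ (by simpa using hw)
  have h3 := h _ h1 _ h2
  rw [edist_nndist, ENNReal.coe_lt_coe, ← NNReal.coe_lt_coe, coe_nndist, Real.dist_eq] at h3
  rw [show -z - w = -(z + w) by ring, abs_neg] at h3
  exact h3.le

/-- A kernel whose derivative reproduces, at scale `2 ^ (-j)`, the blocks and the products of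
blocks with separated frequencies. -/
theorem exists_antiderivative_kernel : ∃ L : 𝓢(ℝ, ℂ),
    (∀ j, 1 ≤ j → ∀ ξ, 𝓕 (P.kernel j) ξ ≠ 0 →
      𝓕 (SchwartzMap.derivCLM ℂ ℂ L) (ξ / 2 ^ j) = 1) ∧
    ∀ i j, i + 2 ≤ j → ∀ ξ ζ, 𝓕 (P.kernel i) ξ ≠ 0 → 𝓕 (P.kernel j) ζ ≠ 0 →
      𝓕 (SchwartzMap.derivCLM ℂ ℂ L) ((ξ + ζ) / 2 ^ j) = 1 := by
  obtain ⟨a, b', ha, -, hρ⟩ := P.ρ_supp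
  obtain ⟨b, hb, hχ⟩ := P.exists_χ_bound
  obtain ⟨c, hc, hsum⟩ := P.exists_pos_le_abs_add
  have hπ : 0 < 2 * Real.pi := by positivity
  -- After division by `2 ^ j`, a single block has frequencies above `a / 2`, since its symbol is `ρ
  -- (z / 2 ^ (j - 1))`. For separated pairs the gap `c` is found at scale `2 ^ (j - 2)`, which
  -- gives `c / 4`. The upper bound adds two frequencies of size at most `b`; `2 π` converts to the
  -- normalization of `𝓕`.
  obtain ⟨L, hL⟩ := exists_fourier_derivCLM_eq_one (c := min (a / 2) (c / 4) / (2 * Real.pi))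
    (C := 2 * b / (2 * Real.pi)) (by positivity)
  have key : ∀ z : ℝ, min (a / 2) (c / 4) ≤ |z| → |z| ≤ 2 * b →
      𝓕 (SchwartzMap.derivCLM ℂ ℂ L) (z / (2 * Real.pi)) = 1 := fun z h1 h2 =>
    hL _ (by rw [abs_div, abs_of_pos hπ]; gcongr) (by rw [abs_div, abs_of_pos hπ]; gcongr)
  refine ⟨L, fun j hj ξ hξ => ?_, fun i j hij ξ ζ hξ hζ => ?_⟩
  · have h0 := P.fourier_kernel_ne_zero hξ
    have h2 := hχ _ (P.χ_ne_zero_of_symbol le_rfl h0)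
    obtain ⟨j, rfl⟩ : ∃ k, j = k + 1 := ⟨j - 1, by omega⟩
    have h1 := (hρ (subset_tsupport _ h0)).1
    have := key (2 * Real.pi * ξ / 2 ^ (j + 1)) ((min_le_left _ _).trans ?_) (by linarith)
    · rw [← this]; congr 1; field_simp
    · rw [pow_succ, ← div_div, abs_div, abs_two]
      linarith
  · have hξ' := P.fourier_kernel_ne_zero hξ
    have hζ' := P.fourier_kernel_ne_zero hζ
    have h1 := hχ _ (P.χ_ne_zero_of_symbol (by omega : i ≤ j) hξ')
    have h2 := hχ _ (P.χ_ne_zero_of_symbol le_rfl hζ')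
    -- With the shifted indices, the symbol `j = k + 2` is `ρ (z / 2 ^ (k + 1))`. At scale `2 ^ k`
    -- the separation is thus exactly that of `χ` and `ρ (· / 2)`.
    obtain ⟨j, rfl⟩ : ∃ k, j = k + 2 := ⟨j - 2, by omega⟩
    have h3 := P.χ_ne_zero_of_symbol (by omega : i ≤ j) hξ'
    have h4 : P.ρ (2 * Real.pi * ζ / 2 ^ j / 2) ≠ 0 := by
      rw [div_div, ← pow_succ]; exact hζ'
    have h5 := hsum _ _ h3 h4
    have := key (2 * Real.pi * ξ / 2 ^ (j + 2) + 2 * Real.pi * ζ / 2 ^ (j + 2))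
      ((min_le_right _ _).trans ?_) ((abs_add_le _ _).trans (by linarith))
    · rw [← this]; congr 1; field_simp
    · have e : 2 * Real.pi * ξ / 2 ^ (j + 2) + 2 * Real.pi * ζ / 2 ^ (j + 2) =
          (2 * Real.pi * ξ / 2 ^ j + 2 * Real.pi * ζ / 2 ^ j) / 4 := by
        rw [pow_add]; field_simp; ring
      rw [e, abs_div, abs_of_pos (by norm_num : (0 : ℝ) < 4)]
      linarith

end DyadicPartition

/-! ### Bernstein estimates and the gain from oscillation -/

section Blocks

variable {E F G : Type*} [NormedAddCommGroup E] [NormedSpace ℂ E]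
  [NormedAddCommGroup F] [NormedSpace ℂ F] [NormedAddCommGroup G] [NormedSpace ℂ G]

theorem continuous_block (P : DyadicPartition) (j : ℕ) (T : 𝓢'(ℝ, E)) : Continuous (block P j T) := by
  rw [block_eq_smear]
  exact continuous_smear T _

theorem smear_dilation_kernel_zero (P : DyadicPartition) (T : 𝓢'(ℝ, E)) (n : ℕ) (x : ℝ) :
    smear T (dilation n (P.kernel 0)) x = ∑ k ∈ Finset.range (n + 1), block P k T x := by
  induction n with
  | zero =>
    have : dilation 0 (P.kernel 0) = P.kernel 0 := by ext; simp
    simp [this, block_eq_smear]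
  | succ n ih =>
    have h : dilation (n + 1) (P.kernel 0) = dilation n (P.kernel 0) + P.kernel (n + 1) := by
      rw [P.kernel_succ]; abel
    rw [Finset.sum_range_succ, ← ih, h, smear_add_kernel, block_eq_smear]

theorem norm_smear_dilation_kernel_zero_le (P : DyadicPartition) (T : 𝓢'(ℝ, E)) {A : ℕ → ℝ}
    (hA : ∀ k x, ‖block P k T x‖ ≤ A k) (n : ℕ) (x : ℝ) :
    ‖smear T (dilation n (P.kernel 0)) x‖ ≤ ∑ k ∈ Finset.range (n + 1), A k := by
  rw [smear_dilation_kernel_zero]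
  exact norm_sum_le_of_le _ fun k _ => hA k x

theorem derivCLM_real_smul (c : ℝ) (K : 𝓢(ℝ, ℂ)) :
    SchwartzMap.derivCLM ℂ ℂ (c • K) = c • SchwartzMap.derivCLM ℂ ℂ K := by
  ext x
  rw [smul_apply, SchwartzMap.derivCLM_apply, SchwartzMap.derivCLM_apply]
  exact ((K.hasDerivAt x).const_smul c).deriv

theorem integral_norm_derivCLM_dilation (n : ℕ) (K : 𝓢(ℝ, ℂ)) :
    ∫ x, ‖SchwartzMap.derivCLM ℂ ℂ (dilation n K) x‖ =
      2 ^ n * ∫ x, ‖SchwartzMap.derivCLM ℂ ℂ K x‖ := by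
  rw [← integral_norm_dilation n (SchwartzMap.derivCLM ℂ ℂ K), ← integral_const_mul,
    derivCLM_dilation]
  refine integral_congr_ae (Eventually.of_forall fun x => ?_)
  simp only [smul_apply, norm_smul, Real.norm_of_nonneg (by positivity : (0 : ℝ) ≤ 2 ^ n)]

theorem continuous_bilin (B : E →L[ℂ] F →L[ℂ] G) {f : ℝ → E} {g : ℝ → F} (hf : Continuous f)
    (hg : Continuous g) : Continuous fun x => B (f x) (g x) :=
  (B.continuous.comp hf).clm_apply hg

theorem norm_bilin_le (B : E →L[ℂ] F →L[ℂ] G) {x : E} {y : F} {a b : ℝ} (hx : ‖x‖ ≤ a)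
    (hy : ‖y‖ ≤ b) : ‖B x y‖ ≤ ‖B‖ * a * b :=
  B.le_of_opNorm₂_le_of_le le_rfl hx hy

section Complete

variable [CompleteSpace E]

theorem block_eq_convolve (P : DyadicPartition) {j : ℕ} {K : 𝓢(ℝ, ℂ)}
    (hK : conv K (P.kernel j) = P.kernel j) (T : 𝓢'(ℝ, E)) {A : ℝ}
    (hA : ∀ x, ‖block P j T x‖ ≤ A) : block P j T = convolve K (block P j T) := by
  rw [block_eq_smear] at hA ⊢
  rw [← smear_conv T K (P.kernel j) hA, hK]

theorem block_derivCLM_eq_convolve (P : DyadicPartition) {j : ℕ} {K : 𝓢(ℝ, ℂ)}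
    (hK : conv K (P.kernel j) = P.kernel j) (T : 𝓢'(ℝ, E)) {A : ℝ}
    (hA : ∀ x, ‖block P j T x‖ ≤ A) : block P j (TemperedDistribution.derivCLM E T) =
      convolve (SchwartzMap.derivCLM ℂ ℂ K) (block P j T) := by
  rw [block_eq_smear] at hA
  rw [block_eq_smear, block_eq_smear, smear_derivCLM, ← smear_conv T _ (P.kernel j) hA, conv_comm,
    ← derivCLM_conv, conv_comm, hK]

theorem hasDerivAt_block (P : DyadicPartition) (j : ℕ) (T : 𝓢'(ℝ, E)) {A : ℝ}
    (hA : ∀ x, ‖block P j T x‖ ≤ A) (x : ℝ) :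
    HasDerivAt (block P j T) (block P j (TemperedDistribution.derivCLM E T) x) x := by
  obtain ⟨N, hN⟩ := P.exists_dilation_conv_kernel
  rw [block_derivCLM_eq_convolve P (hN j) T hA]
  conv => arg 1; rw [block_eq_convolve P (hN j) T hA]
  exact hasDerivAt_convolve _ (continuous_block P j T) hA x

/-- Bernstein's inequality for the blocks. -/
theorem exists_norm_block_derivCLM_le (P : DyadicPartition) : ∃ C : ℝ, 0 ≤ C ∧
    ∀ (T : 𝓢'(ℝ, E)) (j : ℕ) (A : ℝ), (∀ x, ‖block P j T x‖ ≤ A) →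
      ∀ x, ‖block P j (TemperedDistribution.derivCLM E T) x‖ ≤ C * 2 ^ j * A := by
  obtain ⟨N, hN⟩ := P.exists_dilation_conv_kernel
  refine ⟨2 ^ N * ∫ x, ‖SchwartzMap.derivCLM ℂ ℂ (P.kernel 0) x‖,
    mul_nonneg (by positivity) (integral_nonneg fun _ => norm_nonneg _), fun T j A hA x => ?_⟩
  rw [block_derivCLM_eq_convolve P (hN j) T hA]
  refine (norm_convolve_le _ hA x).trans (le_of_eq ?_)
  rw [integral_norm_derivCLM_dilation, pow_add]
  ring

/-- A function reproduced by the dilated derivative of `L` is itself the derivative of its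
convolution with `2 ^ (-j)` times the dilation of `L`, which has size `2 ^ (-j) * A`. The factor 2
counts the two end points. -/
theorem norm_integral_le_of_convolve_eq (L : 𝓢(ℝ, ℂ)) (j : ℕ) {f : ℝ → E} (hf : Continuous f)
    {A : ℝ} (hA : ∀ x, ‖f x‖ ≤ A)
    (h : f = convolve (dilation j (SchwartzMap.derivCLM ℂ ℂ L)) f) (s t : ℝ) :
    ‖∫ r in s..t, f r‖ ≤ 2 * (∫ x, ‖L x‖) * (2 ^ j)⁻¹ * A := by
  have hp : (0 : ℝ) < 2 ^ j := by positivity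
  have h1 : dilation j (SchwartzMap.derivCLM ℂ ℂ L) =
      SchwartzMap.derivCLM ℂ ℂ (((2 : ℝ) ^ j)⁻¹ • dilation j L) := by
    rw [derivCLM_real_smul, derivCLM_dilation, smul_smul, inv_mul_cancel₀ hp.ne', one_smul]
  have h2 : ∀ x, ‖convolve (((2 : ℝ) ^ j)⁻¹ • dilation j L) f x‖ ≤ (∫ x, ‖L x‖) * (2 ^ j)⁻¹ * A := by
    intro x
    refine (norm_convolve_le _ hA x).trans (le_of_eq ?_)
    congr 1
    rw [← integral_norm_dilation j L, ← integral_mul_const]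
    refine integral_congr_ae (Eventually.of_forall fun x => ?_)
    simp only [smul_apply, norm_smul, Real.norm_of_nonneg (inv_pos.2 hp).le]
    ring
  rw [h, h1, integral_convolve_derivCLM _ hf hA]
  refine (norm_sub_le _ _).trans ?_
  linarith [h2 s, h2 t]

/-- The block with index zero is excluded, since its spectrum contains the frequency zero and its
integral may grow with the interval. -/
theorem exists_norm_integral_block_le (P : DyadicPartition) : ∃ C : ℝ, 0 ≤ C ∧
    ∀ (T : 𝓢'(ℝ, E)) (j : ℕ) (A : ℝ), 1 ≤ j → (∀ x, ‖block P j T x‖ ≤ A) →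
      ∀ s t, ‖∫ r in s..t, block P j T r‖ ≤ C * (2 ^ j)⁻¹ * A := by
  obtain ⟨L, hL, -⟩ := P.exists_antiderivative_kernel
  refine ⟨2 * ∫ x, ‖L x‖, mul_nonneg zero_le_two (integral_nonneg fun _ => norm_nonneg _),
    fun T j A hj hA s t => ?_⟩
  refine norm_integral_le_of_convolve_eq L j (continuous_block P j T) hA
    (block_eq_convolve P (fourier_ext fun ξ => ?_) T hA) s t
  rw [fourier_conv, fourier_dilation]
  by_cases h : 𝓕 (P.kernel j) ξ = 0
  · rw [h, mul_zero]
  · rw [hL j hj ξ h, one_mul]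

/-- A tempered distribution is the sum of its blocks. -/
theorem tendsto_sum_integral_block (P : DyadicPartition) (T : 𝓢'(ℝ, E)) (φ : 𝓢(ℝ, ℂ))
    (hφ : HasCompactSupport φ) :
    Tendsto (fun n => ∑ j ∈ Finset.range n, ∫ x, φ x • block P j T x) atTop (𝓝 (T φ)) := by
  rw [← tendsto_add_atTop_iff_nat 1]
  have h1 : ∀ n, ∑ j ∈ Finset.range (n + 1), ∫ x, φ x • block P j T x =
      T (conv φ (reflection (dilation n (P.kernel 0)))) := by
    intro n
    rw [map_conv_reflection_eq_integral T φ _ hφ]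
    simp only [smear_dilation_kernel_zero, Finset.smul_sum]
    rw [integral_finsetSum]
    exact fun k _ => (φ.continuous.smul (continuous_block P k T)).integrable_of_hasCompactSupport
      hφ.smul_right
  simp only [h1]
  refine (T.continuous.tendsto φ).comp ?_
  -- On the Fourier side the partial sums multiply `𝓕 φ` with the dilations of `χ`, which equals 1
  -- near zero. Convergence in Schwartz space is then `tendsto_cutoff_mul_two_pow`.
  obtain ⟨r, hr, hχ⟩ := P.exists_χ_eq_one
  have h2 := tendsto_cutoff_mul_two_pow (P.symbolSchwartz 0) (r := r / (2 * Real.pi))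
    (by positivity) (fun x hx => by
      change ((P.χ (2 * Real.pi * x) : ℝ) : ℂ) = 1
      rw [hχ, Complex.ofReal_one]
      rw [lt_div_iff₀ (by positivity)] at hx
      rw [abs_mul, abs_of_pos (by positivity : 0 < 2 * Real.pi)]
      linarith) (𝓕 φ)
  have h3 := ((FourierTransform.fourierInvCLM ℂ 𝓢(ℝ, ℂ)).continuous.tendsto (𝓕 φ)).comp h2
  have h4 : FourierTransform.fourierInvCLM ℂ 𝓢(ℝ, ℂ) (𝓕 φ) = φ := by simp
  rw [h4] at h3
  refine h3.congr fun n => fourier_ext fun ξ => ?_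
  have h5 : 𝓕 (reflection (dilation n (P.kernel 0))) ξ = 𝓕 (dilation n (P.kernel 0)) (-ξ) := by
    rw [SchwartzMap.fourier_coe, SchwartzMap.fourier_coe, Real.fourier_real_eq,
      Real.fourier_real_eq, ← integral_neg_eq_self]
    refine integral_congr_ae (Eventually.of_forall fun v => ?_)
    simp only [reflection_apply, neg_neg, neg_mul, mul_neg]
  rw [fourier_conv, h5, P.fourier_dilation_kernel_zero]
  simp only [Function.comp_apply, FourierTransform.fourierInvCLM_apply,
    FourierTransform.fourier_fourierInv_eq, pmul_apply, rescale_apply, coe_twoPow_inv]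
  rw [mul_comm]
  congr 1
  change ((P.χ (2 * Real.pi * (((2 : ℝ) ^ n)⁻¹ * ξ)) : ℝ) : ℂ) = _
  rw [← P.χ_even]
  congr 2
  field_simp

variable [CompleteSpace F] [CompleteSpace G]

/-- The integral of a product of blocks with separated frequencies gains a factor `2 ^ (-j)`. -/
theorem exists_norm_integral_bilin_block_le (P : DyadicPartition) : ∃ C : ℝ, 0 ≤ C ∧
    ∀ (B : E →L[ℂ] F →L[ℂ] G) (T : 𝓢'(ℝ, E)) (S : 𝓢'(ℝ, F)) (A₁ A₂ : ℕ → ℝ),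
      (∀ k x, ‖block P k T x‖ ≤ A₁ k) → (∀ k x, ‖block P k S x‖ ≤ A₂ k) →
      ∀ i j, i + 2 ≤ j → ∀ s t, ‖∫ r in s..t, B (block P i T r) (block P j S r)‖ ≤
        C * (2 ^ j)⁻¹ * (‖B‖ * A₁ i * A₂ j) := by
  obtain ⟨L, -, hL⟩ := P.exists_antiderivative_kernel
  obtain ⟨N, hN⟩ := P.exists_dilation_conv_kernel
  refine ⟨2 * ∫ x, ‖L x‖, mul_nonneg zero_le_two (integral_nonneg fun _ => norm_nonneg _),
    fun B T S A₁ A₂ hA₁ hA₂ i j hij s t => ?_⟩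
  refine norm_integral_le_of_convolve_eq L j
    (continuous_bilin B (continuous_block P i T) (continuous_block P j S))
    (fun x => norm_bilin_le B (hA₁ i x) (hA₂ j x)) ?_ s t
  -- `T` and `S` need not be functions. Each block is therefore written as its kernel convolved with
  -- a low-frequency truncation, a bounded continuous function to which `convolve_bilin_eq_self`
  -- applies.
  have b1 := norm_smear_dilation_kernel_zero_le P T hA₁ (i + N)
  have b2 := norm_smear_dilation_kernel_zero_le P S hA₂ (j + N)
  have e1 : block P i T = convolve (P.kernel i) (smear T (dilation (i + N) (P.kernel 0))) := by
    rw [← smear_conv T _ _ b1, conv_comm, hN, block_eq_smear]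
  have e2 : block P j S = convolve (P.kernel j) (smear S (dilation (j + N) (P.kernel 0))) := by
    rw [← smear_conv S _ _ b2, conv_comm, hN, block_eq_smear]
  ext x
  rw [e1, e2]
  refine (convolve_bilin_eq_self B _ (P.kernel i) (P.kernel j) (fun ξ ζ h1 h2 => ?_)
    (continuous_smear T _) (continuous_smear S _) b1 b2 x).symm
  rw [fourier_dilation]
  exact hL i j hij ξ ζ h1 h2

end Complete

end Blocks

/-! ### Besov norms as geometric bounds on the blocks -/

section BlockBound

variable {E : Type*} [NormedAddCommGroup E] [NormedSpace ℂ E]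

/-- The blocks of `T` have size `A * 2 ^ (-j γ)`. -/
def BlockBound (P : DyadicPartition) (γ A : ℝ) (T : 𝓢'(ℝ, E)) : Prop :=
  ∀ j x, ‖block P j T x‖ ≤ A * ((2 : ℝ) ^ (-γ)) ^ j

/-- Index `j` stands for `Δ_{j-1}`, so the weight differs from `2 ^ (j γ)` by `2 ^ (-γ)`. For `|γ| ≤
1` this lies between `1 / 2` and `2`, whence the factors 2 in the comparisons below. -/
theorem two_rpow_weight (γ : ℝ) (j : ℕ) :
    (2 : ℝ) ^ (((j : ℝ) - 1) * γ) = 2 ^ (-γ) * (((2 : ℝ) ^ (-γ)) ^ j)⁻¹ := by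
  rw [← Real.rpow_natCast, ← Real.rpow_mul zero_le_two, ← Real.rpow_neg zero_le_two,
    ← Real.rpow_add two_pos]
  congr 1
  ring

theorem BlockBound.besovNorm_le {P : DyadicPartition} {γ A : ℝ} {T : 𝓢'(ℝ, E)}
    (h : BlockBound P γ A T) (hγ : -1 ≤ γ) : besovNorm P γ T ≤ ENNReal.ofReal (2 * A) := by
  refine iSup_le fun j => ?_
  rw [ENNReal.mul_iSup]
  refine iSup_le fun x => ?_
  rw [← ofReal_norm, ← ENNReal.ofReal_mul (by positivity)]
  refine ENNReal.ofReal_le_ofReal ?_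
  rw [two_rpow_weight]
  have hr : 0 < ((2 : ℝ) ^ (-γ)) ^ j := by positivity
  have h2 : (2 : ℝ) ^ (-γ) ≤ 2 := by
    calc (2 : ℝ) ^ (-γ) ≤ 2 ^ (1 : ℝ) := Real.rpow_le_rpow_of_exponent_le one_le_two (by linarith)
      _ = 2 := Real.rpow_one 2
  calc (2 : ℝ) ^ (-γ) * (((2 : ℝ) ^ (-γ)) ^ j)⁻¹ * ‖block P j T x‖
      ≤ 2 * (((2 : ℝ) ^ (-γ)) ^ j)⁻¹ * (A * ((2 : ℝ) ^ (-γ)) ^ j) := by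
        gcongr
        exact h j x
    _ = 2 * A := by field_simp

theorem blockBound_of_besovNorm_le {P : DyadicPartition} {γ A : ℝ} {T : 𝓢'(ℝ, E)}
    (h : besovNorm P γ T ≤ ENNReal.ofReal A) (hγ : γ ≤ 1) (hA : 0 ≤ A) :
    BlockBound P γ (2 * A) T := by
  intro j x
  have h1 := (le_iSup (fun j : ℕ => ENNReal.ofReal ((2 : ℝ) ^ (((j : ℝ) - 1) * γ)) *
    ⨆ x : ℝ, ‖block P j T x‖ₑ) j).trans h
  rw [ENNReal.mul_iSup] at h1
  have h2 := (le_iSup (fun x : ℝ => ENNReal.ofReal ((2 : ℝ) ^ (((j : ℝ) - 1) * γ)) *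
    ‖block P j T x‖ₑ) x).trans h1
  rw [← ofReal_norm, ← ENNReal.ofReal_mul (by positivity),
    ENNReal.ofReal_le_ofReal_iff hA, two_rpow_weight] at h2
  have hr : 0 < ((2 : ℝ) ^ (-γ)) ^ j := by positivity
  have h3 : 1 / 2 ≤ (2 : ℝ) ^ (-γ) := by
    calc (1 / 2 : ℝ) = 2 ^ (-1 : ℝ) := by rw [Real.rpow_neg_one]; norm_num
      _ ≤ _ := Real.rpow_le_rpow_of_exponent_le one_le_two (by linarith)
  have h4 : (2 : ℝ) ^ (-γ) * ‖block P j T x‖ ≤ A * ((2 : ℝ) ^ (-γ)) ^ j := by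
    rw [← div_le_iff₀ hr]
    calc _ = (2 : ℝ) ^ (-γ) * (((2 : ℝ) ^ (-γ)) ^ j)⁻¹ * ‖block P j T x‖ := by
          rw [div_eq_mul_inv]; ring
      _ ≤ A := h2
  nlinarith [norm_nonneg (block P j T x)]

theorem BlockBound.nonneg {P : DyadicPartition} {γ A : ℝ} {T : 𝓢'(ℝ, E)}
    (h : BlockBound P γ A T) : 0 ≤ A := by
  have := (norm_nonneg _).trans (h 0 0)
  simpa using this

theorem block_sub (P : DyadicPartition) (j : ℕ) (T S : 𝓢'(ℝ, E)) (x : ℝ) :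
    block P j (T - S) x = block P j T x - block P j S x := rfl

theorem block_add (P : DyadicPartition) (j : ℕ) (T S : 𝓢'(ℝ, E)) (x : ℝ) :
    block P j (T + S) x = block P j T x + block P j S x := rfl

end BlockBound

/-! ### Summation lemmas -/

section Sums

theorem sum_range_pow_le_of_one_lt {q : ℝ} (hq : 1 < q) (n : ℕ) :
    ∑ i ∈ Finset.range n, q ^ i ≤ q ^ n / (q - 1) := by
  rw [geom_sum_eq hq.ne']
  have : 0 < q - 1 := by linarith
  gcongr
  linarith

theorem sum_range_pow_le_of_lt_one {r : ℝ} (hr : 0 ≤ r) (hr1 : r < 1) (n : ℕ) :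
    ∑ i ∈ Finset.range n, r ^ i ≤ 1 / (1 - r) := by
  rw [one_div, ← tsum_geometric_of_lt_one hr hr1]
  exact (summable_geometric_of_lt_one hr hr1).sum_le_tsum _ fun i _ => by positivity

theorem two_rpow_neg_bounds {γ : ℝ} (h0 : 0 < γ) (h1 : γ < 1) :
    1 / 2 < (2 : ℝ) ^ (-γ) ∧ (2 : ℝ) ^ (-γ) < 1 := by
  constructor
  · calc (1 / 2 : ℝ) = 2 ^ (-1 : ℝ) := by rw [Real.rpow_neg_one]; norm_num
      _ < _ := Real.rpow_lt_rpow_of_exponent_lt one_lt_two (by linarith)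
  · exact Real.rpow_lt_one_of_one_lt_of_neg one_lt_two (by linarith)

/-- The sum splits at the frequency `2 ^ k ≈ 1 / h`. Below it the terms are `h * (2 * z) ^ k` and
grow geometrically because `γ < 1`; above it they are at most `z ^ k` and decay because `γ > 0`.
Both halves are comparable to the term at the splitting, of size `h ^ γ`. -/
theorem exists_sum_min_le {γ : ℝ} (h0 : 0 < γ) (h1 : γ < 1) :
    ∃ C : ℝ, 0 ≤ C ∧ ∀ h : ℝ, 0 < h → h ≤ 1 → ∀ N : ℕ,
      ∑ k ∈ Finset.range N, min ((2 : ℝ) ^ k)⁻¹ h * (2 * (2 : ℝ) ^ (-γ)) ^ k ≤ C * h ^ γ := by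
  obtain ⟨hz, hz1⟩ := two_rpow_neg_bounds h0 h1
  set z := (2 : ℝ) ^ (-γ) with hzdef
  have hz0 : 0 < z := by positivity
  have hq : 0 < 2 * z - 1 := by linarith
  have hz2 : 0 < 1 - z := by linarith
  refine ⟨2 / (2 * z - 1) + 1 / (1 - z), by positivity, fun h hh hh1 N => ?_⟩
  -- The splitting index satisfies `(1 / 2) ^ (n + 1) < h ≤ (1 / 2) ^ n`.
  obtain ⟨n, hn1, hn2⟩ := exists_nat_pow_near_of_lt_one hh hh1
    (by norm_num : (0 : ℝ) < 1 / 2) (by norm_num)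
  have hzn : z ^ (n + 1) ≤ h ^ γ := by
    have e : z ^ (n + 1) = ((1 / 2 : ℝ) ^ (n + 1)) ^ γ := by
      rw [hzdef, one_div, inv_pow, Real.inv_rpow (by positivity), ← Real.rpow_natCast,
        ← Real.rpow_natCast, ← Real.rpow_mul zero_le_two, ← Real.rpow_mul zero_le_two,
        ← Real.rpow_neg zero_le_two]
      congr 1
      ring
    rw [e]
    exact Real.rpow_le_rpow (by positivity) hn1.le h0.le
  have hnn : ∀ k : ℕ, 0 ≤ min ((2 : ℝ) ^ k)⁻¹ h * (2 * z) ^ k := fun k =>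
    mul_nonneg (le_min (by positivity) hh.le) (by positivity)
  have s1 : ∑ k ∈ Finset.range (n + 1), min ((2 : ℝ) ^ k)⁻¹ h * (2 * z) ^ k ≤
      2 / (2 * z - 1) * z ^ (n + 1) := by
    calc _ ≤ ∑ k ∈ Finset.range (n + 1), h * (2 * z) ^ k := by
          refine Finset.sum_le_sum fun k _ => ?_
          gcongr
          exact min_le_right _ _
      _ ≤ h * ((2 * z) ^ (n + 1) / (2 * z - 1)) := by
          rw [← Finset.mul_sum]
          gcongr
          exact sum_range_pow_le_of_one_lt (by linarith) _
      _ ≤ (1 / 2) ^ n * ((2 * z) ^ (n + 1) / (2 * z - 1)) := by gcongr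
      _ = ((1 / 2) ^ n * 2 ^ n) * (2 / (2 * z - 1) * z ^ (n + 1)) := by
          rw [mul_pow, pow_succ 2 n]; ring
      _ = _ := by rw [← mul_pow]; norm_num
  have s2 : ∑ k ∈ Finset.range N, min ((2 : ℝ) ^ (n + 1 + k))⁻¹ h * (2 * z) ^ (n + 1 + k) ≤
      1 / (1 - z) * z ^ (n + 1) := by
    calc _ ≤ ∑ k ∈ Finset.range N, z ^ (n + 1) * z ^ k := by
          refine Finset.sum_le_sum fun k _ => ?_
          calc _ ≤ ((2 : ℝ) ^ (n + 1 + k))⁻¹ * (2 * z) ^ (n + 1 + k) := by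
                gcongr
                exact min_le_left _ _
            _ = z ^ (n + 1) * z ^ k := by rw [mul_pow, ← pow_add]; field_simp
      _ ≤ _ := by
          rw [← Finset.mul_sum, mul_comm]
          gcongr
          exact sum_range_pow_le_of_lt_one hz0.le hz1 _
  calc _ ≤ ∑ k ∈ Finset.range (n + 1 + N), min ((2 : ℝ) ^ k)⁻¹ h * (2 * z) ^ k :=
        Finset.sum_le_sum_of_subset_of_nonneg (Finset.range_mono (by omega)) fun k _ _ => hnn k
    _ ≤ 2 / (2 * z - 1) * z ^ (n + 1) + 1 / (1 - z) * z ^ (n + 1) := by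
        rw [Finset.sum_range_add]
        exact add_le_add s1 s2
    _ ≤ _ := by
        rw [← add_mul]
        gcongr

/-- Exchange of summation: `c i` meets the tail of a geometric series beyond `i`, at most `y ^ i /
(1 - y)`. The induction also carries the part of the tail not yet summed, `y ^ N / (1 - y) * ∑ c i`.
-/
theorem sum_pow_mul_sum_le {y : ℝ} (hy0 : 0 ≤ y) (hy1 : y < 1) {c : ℕ → ℝ} (hc : ∀ i, 0 ≤ c i) (N : ℕ) :
    ∑ k ∈ Finset.range N, y ^ k * ∑ i ∈ Finset.range k, c i ≤
      1 / (1 - y) * ∑ i ∈ Finset.range N, c i * y ^ i := by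
  have h1 : 0 < 1 - y := by linarith
  have key : ∀ N, ∑ k ∈ Finset.range N, y ^ k * ∑ i ∈ Finset.range k, c i +
      y ^ N / (1 - y) * ∑ i ∈ Finset.range N, c i ≤
      1 / (1 - y) * ∑ i ∈ Finset.range N, c i * y ^ i := by
    intro N
    induction N with
    | zero => simp
    | succ N ih =>
      rw [Finset.sum_range_succ, Finset.sum_range_succ (fun i => c i),
        Finset.sum_range_succ (fun i => c i * y ^ i), mul_add]
      have e : y ^ N * ∑ i ∈ Finset.range N, c i + y ^ (N + 1) / (1 - y) *
          (∑ i ∈ Finset.range N, c i + c N) =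
          y ^ N / (1 - y) * ∑ i ∈ Finset.range N, c i + y * (1 / (1 - y) * (c N * y ^ N)) := by
        field_simp
        ring
      have e2 : y * (1 / (1 - y) * (c N * y ^ N)) ≤ 1 / (1 - y) * (c N * y ^ N) :=
        mul_le_of_le_one_left (by have := hc N; positivity) hy1.le
      linarith
  have := key N
  have h2 : 0 ≤ y ^ N / (1 - y) * ∑ i ∈ Finset.range N, c i :=
    mul_nonneg (by positivity) (Finset.sum_nonneg fun i _ => hc i)
  linarith

/-- The decomposition of a square of pairs of indices into low-high, high-low and diagonal ones. -/
theorem sum_low_high_diagonal {M : Type*} [AddCommGroup M] (f : ℕ → ℕ → M) (n : ℕ) :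
    ∑ k ∈ Finset.range (n + 1), (∑ i ∈ Finset.range (k - 1), f i k +
      ∑ i ∈ Finset.range (k - 1), f k i + ∑ i ∈ Finset.Icc (k - 1) (k + 1), f i k) =
      ∑ i ∈ Finset.range (n + 1), ∑ j ∈ Finset.range (n + 1), f i j + f (n + 1) n := by
  induction n with
  | zero =>
    -- At index zero the truncated `k - 1` is `0`, so the diagonal part is `{0, 1}`. In general the
    -- only pair outside the square is `(n + 1, n)`.
    have : Finset.Icc 0 1 = ({0, 1} : Finset ℕ) := by decide
    simp [this]
  | succ n ih =>
    have h1 : Finset.Icc (n + 1 - 1) (n + 1 + 1) = ({n, n + 1, n + 2} : Finset ℕ) := by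
      ext i; simp; omega
    have h2 : ∑ i ∈ Finset.range (n + 1 + 1), ∑ j ∈ Finset.range (n + 1 + 1), f i j =
        ∑ i ∈ Finset.range (n + 1), ∑ j ∈ Finset.range (n + 1), f i j +
          (∑ i ∈ Finset.range n, f i (n + 1) + f n (n + 1)) +
          (∑ i ∈ Finset.range n, f (n + 1) i + f (n + 1) n + f (n + 1) (n + 1)) := by
      rw [Finset.sum_range_succ _ (n + 1), Finset.sum_range_succ (fun j => f (n + 1) j) (n + 1),
        Finset.sum_range_succ (fun j => f (n + 1) j) n]
      simp only [Finset.sum_range_succ (fun j => f _ j) (n + 1)]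
      rw [Finset.sum_add_distrib, Finset.sum_range_succ (fun i => f i (n + 1)) n]
    rw [Finset.sum_range_succ, ih, h1, h2, Finset.sum_insert (by simp), Finset.sum_insert (by simp),
      Finset.sum_singleton, Nat.add_sub_cancel]
    abel

end Sums

/-! ### Antiderivatives of distributions and series -/

section Antiderivative

variable {E : Type*} [NormedAddCommGroup E] [NormedSpace ℂ E]

theorem integrable_test_smul (φ : 𝓢(ℝ, ℂ)) (hφ : HasCompactSupport φ) {f : ℝ → E}
    (hf : Continuous f) : Integrable fun x => φ x • f x :=
  (φ.continuous.smul hf).integrable_of_hasCompactSupport hφ.smul_right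

theorem integrable_deriv_test_smul (φ : 𝓢(ℝ, ℂ)) (hφ : HasCompactSupport φ) {f : ℝ → E}
    (hf : Continuous f) : Integrable fun x => deriv φ x • f x :=
  ((SchwartzMap.derivCLM ℂ ℂ φ).continuous.smul hf).integrable_of_hasCompactSupport
    hφ.deriv.smul_right

/-- The complex test function given by a real one. -/
theorem exists_schwartz_of_real {g : ℝ → ℝ} (hg : ContDiff ℝ ∞ g) (hgc : HasCompactSupport g) :
    ∃ φ : 𝓢(ℝ, ℂ), HasCompactSupport φ ∧ ∀ x, φ x = (g x : ℂ) := by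
  have hc : HasCompactSupport fun x => (g x : ℂ) :=
    hgc.comp_left (g := fun x : ℝ => (x : ℂ)) Complex.ofReal_zero
  exact ⟨hc.toSchwartzMap (Complex.ofRealCLM.contDiff.comp hg), hc, fun x => rfl⟩

theorem exists_antiderivative_of_integral_eq_zero {h : ℝ → ℝ} (hh : ContDiff ℝ ∞ h)
    (hc : HasCompactSupport h) (h0 : ∫ x, h x = 0) :
    ∃ H : ℝ → ℝ, ContDiff ℝ ∞ H ∧ HasCompactSupport H ∧ ∀ x, HasDerivAt H (h x) x := by
  obtain ⟨R, hR0, hR⟩ : ∃ R : ℝ, 0 < R ∧ ∀ x, R ≤ |x| → h x = 0 := by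
    obtain ⟨R, hR⟩ := hc.isCompact.isBounded.subset_closedBall (0 : ℝ)
    refine ⟨|R| + 1, by positivity, fun x hx => ?_⟩
    by_contra hne
    have := hR (subset_tsupport _ hne)
    rw [mem_closedBall_zero_iff, Real.norm_eq_abs] at this
    linarith [le_abs_self R]
  have hd : ∀ x, HasDerivAt (fun x => ∫ y in (-R)..x, h y) (h x) x := fun x =>
    intervalIntegral.integral_hasDerivAt_right (hh.continuous.intervalIntegrable _ _)
      (hh.continuous.stronglyMeasurableAtFilter _ _) hh.continuous.continuousAt
  refine ⟨fun x => ∫ y in (-R)..x, h y, ?_, ?_, hd⟩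
  · rw [contDiff_infty_iff_deriv]
    refine ⟨fun x => (hd x).differentiableAt, ?_⟩
    rw [funext fun x => (hd x).deriv]
    exact hh
  · refine HasCompactSupport.intro (isCompact_closedBall (0 : ℝ) R) fun x hx => ?_
    rw [mem_closedBall_zero_iff, Real.norm_eq_abs, not_le, lt_abs] at hx
    rcases hx with hx | hx
    · rw [intervalIntegral.integral_eq_integral_of_support_subset, h0]
      intro y hy
      have : |y| < R := by
        by_contra! hc
        exact hy (hR y hc)
      rw [abs_lt] at this
      exact ⟨this.1, by linarith⟩
    · refine intervalIntegral.integral_zero_ae (Eventually.of_forall fun y hy => hR y ?_)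
      rw [Set.uIoc_of_ge (by linarith)] at hy
      rw [abs_of_nonpos (by linarith [hy.2])]
      linarith [hy.2]

theorem IsAntiderivative.add {w₁ w₂ : 𝓢'(ℝ, E)} {U₁ U₂ : ℝ → E} (h₁ : IsAntiderivative w₁ U₁)
    (h₂ : IsAntiderivative w₂ U₂) : IsAntiderivative (w₁ + w₂) (fun x => U₁ x + U₂ x) := by
  refine ⟨h₁.1.add h₂.1, fun φ hφ => ?_⟩
  simp only [smul_add]
  rw [integral_add (integrable_deriv_test_smul φ hφ h₁.1) (integrable_deriv_test_smul φ hφ h₂.1),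
    neg_add, ← h₁.2 φ hφ, ← h₂.2 φ hφ]
  rfl

theorem IsAntiderivative.sub {w₁ w₂ : 𝓢'(ℝ, E)} {U₁ U₂ : ℝ → E} (h₁ : IsAntiderivative w₁ U₁)
    (h₂ : IsAntiderivative w₂ U₂) : IsAntiderivative (w₁ - w₂) (fun x => U₁ x - U₂ x) := by
  refine ⟨h₁.1.sub h₂.1, fun φ hφ => ?_⟩
  simp only [smul_sub]
  rw [integral_sub (integrable_deriv_test_smul φ hφ h₁.1) (integrable_deriv_test_smul φ hφ h₂.1),
    neg_sub]
  change w₁ φ - w₂ φ = _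
  rw [h₁.2 φ hφ, h₂.2 φ hφ]
  abel

/-- A continuous function of linear growth has a distributional derivative, whose antiderivative
it is also against test functions that do not have compact support. -/
theorem exists_isAntiderivative_of_growth {U : ℝ → E} (hU : Continuous U) {C : ℝ}
    (hC : ∀ x, ‖U x‖ ≤ C * (1 + |x|)) :
    ∃ w : 𝓢'(ℝ, E), IsAntiderivative w U ∧
      ∀ φ : 𝓢(ℝ, ℂ), w φ = -∫ x, deriv φ x • U x := by
  obtain ⟨T, hT⟩ := exists_distribution_of_growth hU hC
  have h : ∀ φ : 𝓢(ℝ, ℂ), TemperedDistribution.derivCLM E T φ = -∫ x, deriv φ x • U x := by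
    intro φ
    rw [TemperedDistribution.derivCLM_apply_apply, map_neg, hT]
    rfl
  exact ⟨TemperedDistribution.derivCLM E T, ⟨hU, fun φ _ => h φ⟩, h⟩

/-- Integration by parts of a test function. -/
theorem integral_test_smul_eq_neg (φ : 𝓢(ℝ, ℂ)) (hφ : HasCompactSupport φ) {f f' : ℝ → E}
    (hf : ∀ x, HasDerivAt f (f' x) x) (hf' : Continuous f') :
    ∫ x, φ x • f' x = -∫ x, deriv φ x • f x := by
  have hfc : Continuous f := continuous_iff_continuousAt.2 fun x => (hf x).continuousAt
  exact integral_bilinear_hasDerivAt_right_eq_neg_left_of_integrable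
    (L := ContinuousLinearMap.lsmul ℝ ℂ) (fun x _ => φ.hasDerivAt x) (fun x _ => hf x)
    (integrable_test_smul φ hφ hf') (integrable_deriv_test_smul φ hφ hfc)
    (integrable_test_smul φ hφ hfc)

variable [CompleteSpace E]

theorem hasDerivAt_integral_zero {p : ℝ → E} (hp : Continuous p) (x : ℝ) :
    HasDerivAt (fun t => ∫ r in (0 : ℝ)..t, p r) (p x) x :=
  intervalIntegral.integral_hasDerivAt_right (hp.intervalIntegrable _ _)
    (hp.stronglyMeasurableAtFilter _ _) hp.continuousAt

theorem eq_of_forall_integral_eq {f g : ℝ → E} (hf : Continuous f) (hg : Continuous g)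
    (h : ∀ φ : 𝓢(ℝ, ℂ), HasCompactSupport φ → ∫ x, φ x • f x = ∫ x, φ x • g x) : f = g := by
  refine Continuous.ae_eq_iff_eq volume hf hg |>.1 ?_
  refine ae_eq_of_integral_contDiff_smul_eq hf.locallyIntegrable hg.locallyIntegrable
    fun k hk hkc => ?_
  obtain ⟨φ, hφ, hφk⟩ := exists_schwartz_of_real hk hkc
  simpa [hφk] using h φ hφ

/-- The lemma of du Bois-Reymond. A test function `g` minus `(∫ g) * n`, with `n` a fixed bump of
integral 1, is the derivative of a test function; so `U - V` pairs with `g` as the constant `c`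
does. -/
theorem sub_eq_of_forall_integral_deriv_eq {U V : ℝ → E} (hU : Continuous U) (hV : Continuous V)
    (h : ∀ φ : 𝓢(ℝ, ℂ), HasCompactSupport φ →
      ∫ x, deriv φ x • U x = ∫ x, deriv φ x • V x) (s t : ℝ) : U t - U s = V t - V s := by
  let D : ℝ → E := fun x => U x - V x
  have hD : Continuous D := hU.sub hV
  let b : ContDiffBump (0 : ℝ) := ⟨1, 2, one_pos, one_lt_two⟩
  set n : ℝ → ℝ := b.normed volume
  have hn : ContDiff ℝ ∞ n := b.contDiff_normed
  have hnc : HasCompactSupport n := b.hasCompactSupport_normed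
  have hn1 : ∫ x, n x = 1 := b.integral_normed
  set c := ∫ x, n x • D x
  have key : D = fun _ => c := by
    refine Continuous.ae_eq_iff_eq volume hD continuous_const |>.1 ?_
    refine ae_eq_of_integral_contDiff_smul_eq hD.locallyIntegrable
      continuous_const.locallyIntegrable fun g hg hgc => ?_
    set m := ∫ x, g x
    have ig : Integrable g := hg.continuous.integrable_of_hasCompactSupport hgc
    have i_n : Integrable n := hn.continuous.integrable_of_hasCompactSupport hnc
    obtain ⟨H, hH, hHc, hHd⟩ := exists_antiderivative_of_integral_eq_zero
      (h := fun x => g x - m * n x) (hg.sub (contDiff_const.mul hn)) (hgc.sub hnc.mul_left) (by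
        rw [integral_sub ig (i_n.const_mul m), integral_const_mul, hn1]
        simp [m])
    obtain ⟨φ, hφ, hφH⟩ := exists_schwartz_of_real hH hHc
    have hφd : ∀ x, deriv φ x = ((g x - m * n x : ℝ) : ℂ) := fun x => by
      rw [funext hφH]
      exact (hHd x).ofReal_comp.deriv
    have h1 : ∫ x, deriv φ x • D x = 0 := by
      simp only [D, smul_sub]
      rw [integral_sub (integrable_deriv_test_smul φ hφ hU) (integrable_deriv_test_smul φ hφ hV),
        h φ hφ, sub_self]
    simp only [hφd, Complex.coe_smul, sub_smul, mul_smul] at h1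
    have i1 : Integrable fun x => g x • D x :=
      (hg.continuous.smul hD).integrable_of_hasCompactSupport hgc.smul_right
    have i2 : Integrable fun x => n x • D x :=
      (hn.continuous.smul hD).integrable_of_hasCompactSupport hnc.smul_right
    rw [integral_sub i1 (i2.smul m : Integrable fun x => m • n x • D x), integral_smul, sub_eq_zero] at h1
    rw [h1, integral_smul_const]
  have e1 : U t - V t = c := congrFun key t
  have e2 : U s - V s = c := congrFun key s
  rw [← sub_eq_zero, sub_sub_sub_comm, e1, e2, sub_self]

/-- Antiderivatives agree up to a constant, so the choice made in `distIntegral` does not matter. -/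
theorem IsAntiderivative.distIntegral_eq {w : 𝓢'(ℝ, E)} {U : ℝ → E} (h : IsAntiderivative w U)
    (s t : ℝ) : distIntegral w s t = U t - U s := by
  have hex : ∃ U : ℝ → E, IsAntiderivative w U := ⟨U, h⟩
  rw [distIntegral, dif_pos hex]
  refine sub_eq_of_forall_integral_deriv_eq hex.choose_spec.1 h.1 (fun φ hφ => ?_) s t
  exact neg_injective ((hex.choose_spec.2 φ hφ).symm.trans (h.2 φ hφ))

theorem Represents.toContinuousFun_eq {u : 𝓢'(ℝ, E)} {f : ℝ → E} (h : Represents u f)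
    (hf : Continuous f) : toContinuousFun u = f := by
  have hex : ∃ f : ℝ → E, Continuous f ∧ Represents u f := ⟨f, hf, h⟩
  rw [toContinuousFun, dif_pos hex]
  exact eq_of_forall_integral_eq hex.choose_spec.1 hf fun φ hφ =>
    (hex.choose_spec.2 φ hφ).symm.trans (h φ hφ)

/-- The sum of a series of continuous functions whose antiderivatives converge. -/
theorem exists_series_antiderivative {p : ℕ → ℝ → E} (hp : ∀ j, Continuous (p j)) {c : ℕ → ℝ}
    (hc : Summable c) (hpc : ∀ j t, ‖∫ r in (0 : ℝ)..t, p j r‖ ≤ c j * (1 + |t|)) :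
    ∃ (U : ℝ → E) (w : 𝓢'(ℝ, E)), IsAntiderivative w U ∧
      (∀ φ : 𝓢(ℝ, ℂ), w φ = -∫ x, deriv φ x • U x) ∧ IsSeriesSum p w ∧
      ∀ s t, HasSum (fun j => ∫ r in s..t, p j r) (U t - U s) := by
  have hpos : ∀ t : ℝ, 0 < 1 + |t| := fun t => by positivity
  set P : ℕ → ℝ → E := fun j t => ∫ r in (0 : ℝ)..t, p j r
  have hPd : ∀ j t, HasDerivAt (P j) (p j t) t := fun j t => hasDerivAt_integral_zero (hp j) t
  have hPc : ∀ j, Continuous (P j) := fun j =>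
    continuous_iff_continuousAt.2 fun t => (hPd j t).continuousAt
  have hsum : ∀ t, Summable fun j => P j t := fun t =>
    Summable.of_norm_bounded (hc.mul_right _) fun j => hpc j t
  set U : ℝ → E := fun t => ∑' j, P j t
  have htail : ∀ n t, ‖U t - ∑ j ∈ Finset.range n, P j t‖ ≤ (∑' j, c (j + n)) * (1 + |t|) := by
    intro n t
    have h1 := (hsum t).sum_add_tsum_nat_add n
    have h2 : U t - ∑ j ∈ Finset.range n, P j t = ∑' j, P (j + n) t :=
      sub_eq_of_eq_add' h1.symm
    rw [h2, ← tsum_mul_right]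
    exact tsum_of_norm_bounded (((summable_nat_add_iff n).2 hc).mul_right _).hasSum
      fun j => hpc _ t
  have hUg : ∀ t, ‖U t‖ ≤ (∑' j, c j) * (1 + |t|) := fun t => by simpa using htail 0 t
  have hU : Continuous U := by
    -- The series of antiderivatives converges uniformly only after division by `1 + |t|`;
    -- continuity is proved for the weighted series and then transferred.
    have h1 : Continuous fun t : ℝ => ∑' j, (1 + |t|)⁻¹ • P j t := by
      refine continuous_tsum (fun j => ?_) hc fun j t => ?_
      · exact (Continuous.inv₀ (by fun_prop) fun t => (hpos t).ne').smul (hPc j)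
      · rw [norm_smul, norm_inv, Real.norm_of_nonneg (hpos t).le, inv_mul_le_iff₀ (hpos t), mul_comm]
        exact hpc j t
    have h2 : U = fun t => (1 + |t|) • ∑' j, (1 + |t|)⁻¹ • P j t := by
      ext t
      rw [(hsum t).tsum_const_smul, smul_smul, mul_inv_cancel₀ (hpos t).ne', one_smul]
    rw [h2]
    exact (by fun_prop : Continuous fun t : ℝ => 1 + |t|).smul h1
  obtain ⟨w, hw, hw'⟩ := exists_isAntiderivative_of_growth hU hUg
  refine ⟨U, w, hw, hw', fun φ hφ => ?_, fun s t => ?_⟩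
  · have h1 : ∀ n, (∑ j ∈ Finset.range n, ∫ x, φ x • p j x) - w φ =
        ∫ x, deriv φ x • (U x - ∑ j ∈ Finset.range n, P j x) := by
      intro n
      simp only [smul_sub, Finset.smul_sum]
      rw [integral_sub (integrable_deriv_test_smul φ hφ hU) (integrable_finsetSum _ fun j _ =>
        integrable_deriv_test_smul φ hφ (hPc j)), integral_finsetSum _ fun j _ =>
        integrable_deriv_test_smul φ hφ (hPc j), hw']
      have h2 : ∀ j, ∫ x, φ x • p j x = -∫ x, deriv φ x • P j x := fun j =>
        integral_test_smul_eq_neg φ hφ (hPd j) (hp j)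
      simp only [h2, Finset.sum_neg_distrib]
      abel
    rw [tendsto_iff_norm_sub_tendsto_zero]
    refine squeeze_zero (fun _ => norm_nonneg _) (fun n => (congrArg norm (h1 n)).le.trans
      (norm_integral_smul_le (SchwartzMap.derivCLM ℂ ℂ φ) (htail n))) ?_
    simpa using (tendsto_sum_nat_add c).mul_const
      (∫ x : ℝ, (1 + |x|) * ‖SchwartzMap.derivCLM ℂ ℂ φ x‖)
  · have h1 : ∀ j, ∫ r in s..t, p j r = P j t - P j s := fun j =>
      (intervalIntegral.integral_interval_sub_left ((hp j).intervalIntegrable _ _)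
        ((hp j).intervalIntegrable _ _)).symm
    rw [funext h1]
    exact (hsum t).hasSum.sub (hsum s).hasSum

end Antiderivative

/-! ### Regularity of sums and of antiderivatives of blocks -/

section Area

variable {E F G : Type*} [NormedAddCommGroup E] [NormedSpace ℂ E]
  [NormedAddCommGroup F] [NormedSpace ℂ F]
  [NormedAddCommGroup G] [NormedSpace ℂ G]

theorem IsSeriesSum.unique {f : ℕ → ℝ → E} {T S : 𝓢'(ℝ, E)} (hT : IsSeriesSum f T)
    (hS : IsSeriesSum f S) : T = S :=
  distribution_ext fun φ hφ => tendsto_nhds_unique (hT φ hφ) (hS φ hφ)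

theorem IsParaproduct.paraLow_eq {P : DyadicPartition} {B : E →L[ℂ] F →L[ℂ] G} {u : 𝓢'(ℝ, E)}
    {v : 𝓢'(ℝ, F)} {w : 𝓢'(ℝ, G)} (h : IsParaproduct P B u v w) : paraLow P B u v = w := by
  have hex : ∃ w, IsParaproduct P B u v w := ⟨w, h⟩
  rw [paraLow, dif_pos hex]
  exact IsSeriesSum.unique hex.choose_spec h

/-- The integral over `[s, t]` of a continuous function is at most `|t - s|` times its bound. -/
theorem norm_integral_le_mul_abs {f : ℝ → E} {M : ℝ} (hM : ∀ x, ‖f x‖ ≤ M) (s t : ℝ) :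
    ‖∫ r in s..t, f r‖ ≤ M * |t - s| :=
  intervalIntegral.norm_integral_le_of_norm_le_const fun x _ => hM x

variable [CompleteSpace E] [CompleteSpace F] [CompleteSpace G]

theorem isSeriesSum_block (P : DyadicPartition) (T : 𝓢'(ℝ, E)) :
    IsSeriesSum (fun j => block P j T) T := fun φ hφ => tendsto_sum_integral_block P T φ hφ

/-- A distribution of positive regularity is a bounded continuous function. -/
theorem exists_represents_of_blockBound (P : DyadicPartition) {γ A : ℝ} (hγ : 0 < γ)
    {T : 𝓢'(ℝ, E)} (hT : BlockBound P γ A T) :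
    ∃ f : ℝ → E, Continuous f ∧ Represents T f ∧ (∀ t, HasSum (fun j => block P j T t) (f t)) ∧
      ∀ t n, ‖f t - ∑ j ∈ Finset.range n, block P j T t‖ ≤
        A * ((2 : ℝ) ^ (-γ)) ^ n / (1 - (2 : ℝ) ^ (-γ)) := by
  have hr1 : (2 : ℝ) ^ (-γ) < 1 := Real.rpow_lt_one_of_one_lt_of_neg one_lt_two (by linarith)
  set r := (2 : ℝ) ^ (-γ)
  have hr0 : 0 < r := by positivity
  have hA := hT.nonneg
  have hs : Summable fun j => A * r ^ j := (summable_geometric_of_lt_one hr0.le hr1).mul_left A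
  have hsum : ∀ t, Summable fun j => block P j T t := fun t => Summable.of_norm_bounded hs fun j => hT j t
  have htail : ∀ t n, ‖(∑' j, block P j T t) - ∑ j ∈ Finset.range n, block P j T t‖ ≤
      A * r ^ n / (1 - r) := by
    intro t n
    rw [sub_eq_of_eq_add' ((hsum t).sum_add_tsum_nat_add n).symm]
    have h1 : HasSum (fun j => A * r ^ n * r ^ j) (A * r ^ n * (1 - r)⁻¹) :=
      (hasSum_geometric_of_lt_one hr0.le hr1).mul_left _
    rw [div_eq_mul_inv]
    refine tsum_of_norm_bounded h1 fun j => (hT (j + n) t).trans (le_of_eq ?_)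
    ring
  have hf : Continuous fun t => ∑' j, block P j T t :=
    continuous_tsum (fun j => continuous_block P j T) hs fun j t => hT j t
  refine ⟨fun t => ∑' j, block P j T t, hf, fun φ hφ => ?_, fun t => (hsum t).hasSum, htail⟩
  refine tendsto_nhds_unique (tendsto_sum_integral_block P T φ hφ) ?_
  rw [tendsto_iff_norm_sub_tendsto_zero]
  have h1 : ∀ n, (∑ j ∈ Finset.range n, ∫ x, φ x • block P j T x) -
      ∫ x, φ x • ∑' j, block P j T x =
      -∫ x, φ x • ((∑' j, block P j T x) - ∑ j ∈ Finset.range n, block P j T x) := by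
    intro n
    simp only [smul_sub, Finset.smul_sum]
    rw [integral_sub (integrable_test_smul φ hφ hf) (integrable_finsetSum _ fun j _ =>
      integrable_test_smul φ hφ (continuous_block P j T)), integral_finsetSum _ fun j _ =>
      integrable_test_smul φ hφ (continuous_block P j T), neg_sub]
  refine squeeze_zero (fun _ => norm_nonneg _) (fun n => ?_) (g := fun n =>
    (∫ x, ‖φ x‖) * (A * r ^ n / (1 - r))) ?_
  · rw [h1, norm_neg]
    exact norm_integral_smul_le_of_bounded φ fun x => htail x n
  · have := (((tendsto_pow_atTop_nhds_zero_of_lt_one hr0.le hr1).const_mul A).div_const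
      (1 - r)).const_mul (∫ x, ‖φ x‖)
    simpa using this

theorem hasSum_block_of_represents (P : DyadicPartition) {γ A : ℝ} (hγ : 0 < γ)
    {T : 𝓢'(ℝ, E)} (hT : BlockBound P γ A T) {f : ℝ → E} (hf : Continuous f) (h : Represents T f) :
    (∀ t, HasSum (fun j => block P j T t) (f t)) ∧
      ∀ t n, ‖f t - ∑ j ∈ Finset.range n, block P j T t‖ ≤
        A * ((2 : ℝ) ^ (-γ)) ^ n / (1 - (2 : ℝ) ^ (-γ)) := by
  obtain ⟨g, hg, hg1, hg2⟩ := exists_represents_of_blockBound P hγ hT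
  have : f = g := eq_of_forall_integral_eq hf hg fun φ hφ => (h φ hφ).symm.trans (hg1 φ hφ)
  rwa [this]

/-- Each pair is bounded both by the spectral gain `2 ^ (-k)` and by the length of the interval. As
`q > 1`, the sum over the low index is dominated by its top term; this is the case where the
low-frequency factor is a derivative. -/
theorem exists_norm_integral_sum_bilin_block_le (P : DyadicPartition) (B : E →L[ℂ] F →L[ℂ] G)
    {q r : ℝ} (hq : 1 < q) (hr : 0 < r) : ∃ C : ℝ, 0 ≤ C ∧
    ∀ (T : 𝓢'(ℝ, E)) (S : 𝓢'(ℝ, F)) (A₁ A₂ : ℝ), 0 ≤ A₁ → 0 ≤ A₂ →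
      (∀ k x, ‖block P k T x‖ ≤ A₁ * q ^ k) → (∀ k x, ‖block P k S x‖ ≤ A₂ * r ^ k) →
      ∀ k s t, ‖∫ τ in s..t, ∑ i ∈ Finset.range (k - 1), B (block P i T τ) (block P k S τ)‖ ≤
        C * A₁ * A₂ * (min ((2 : ℝ) ^ k)⁻¹ |t - s| * (q * r) ^ k) := by
  obtain ⟨C, hC, h⟩ := exists_norm_integral_bilin_block_le (E := E) (F := F) (G := G) P
  have hq0 : 0 < q - 1 := by linarith
  refine ⟨(C + 1) * ‖B‖ / (q - 1), by positivity, fun T S A₁ A₂ h₁ h₂ hT hS k s t => ?_⟩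
  have hc : ∀ i, Continuous fun τ => B (block P i T τ) (block P k S τ) := fun i =>
    continuous_bilin B (continuous_block P i T) (continuous_block P k S)
  rw [intervalIntegral.integral_finsetSum fun i _ => (hc i).intervalIntegrable _ _]
  have h3 : ∀ i ∈ Finset.range (k - 1), ‖∫ τ in s..t, B (block P i T τ) (block P k S τ)‖ ≤
      (C + 1) * min ((2 : ℝ) ^ k)⁻¹ |t - s| * (‖B‖ * (A₁ * q ^ i) * (A₂ * r ^ k)) := by
    intro i hi
    have hb : 0 ≤ ‖B‖ * (A₁ * q ^ i) * (A₂ * r ^ k) := by positivity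
    rcases min_cases ((2 : ℝ) ^ k)⁻¹ |t - s| with ⟨e, -⟩ | ⟨e, -⟩
    · rw [e]
      refine (h B T S _ _ hT hS i k (by simp at hi; omega) s t).trans ?_
      gcongr
      linarith
    · rw [e]
      refine (norm_integral_le_mul_abs (fun x => norm_bilin_le B (hT i x) (hS k x)) s t).trans ?_
      rw [mul_comm]
      gcongr
      exact le_mul_of_one_le_left (abs_nonneg _) (by linarith)
  refine (norm_sum_le_of_le _ h3).trans ?_
  have h4 : ∑ i ∈ Finset.range (k - 1), q ^ i ≤ q ^ k / (q - 1) := by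
    refine (sum_range_pow_le_of_one_lt hq _).trans ?_
    gcongr
    · exact hq.le
    · omega
  calc _ = (C + 1) * min ((2 : ℝ) ^ k)⁻¹ |t - s| * ‖B‖ * A₁ * A₂ * r ^ k *
        ∑ i ∈ Finset.range (k - 1), q ^ i := by
        rw [Finset.mul_sum]
        refine Finset.sum_congr rfl fun i _ => ?_
        ring
    _ ≤ (C + 1) * min ((2 : ℝ) ^ k)⁻¹ |t - s| * ‖B‖ * A₁ * A₂ * r ^ k * (q ^ k / (q - 1)) := by
        have : 0 ≤ min ((2 : ℝ) ^ k)⁻¹ |t - s| := le_min (by positivity) (abs_nonneg _)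
        gcongr
    _ = _ := by
        rw [mul_pow]
        ring

/-- Hölder continuity of the blocks. -/
theorem exists_norm_block_sub_le (P : DyadicPartition) : ∃ C : ℝ, 0 ≤ C ∧
    ∀ (T : 𝓢'(ℝ, E)) (γ A : ℝ), BlockBound P γ A T → ∀ j s t,
      ‖block P j T t - block P j T s‖ ≤
        C * A * (min ((2 : ℝ) ^ j)⁻¹ |t - s| * (2 * (2 : ℝ) ^ (-γ)) ^ j) := by
  obtain ⟨C, hC, h⟩ := exists_norm_block_derivCLM_le (E := E) P
  -- `C` comes from Bernstein and the mean value inequality at short distances, 2 from the triangle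
  -- inequality at long ones.
  refine ⟨C + 2, by positivity, fun T γ A hT j s t => ?_⟩
  have hA := hT.nonneg
  rcases min_cases ((2 : ℝ) ^ j)⁻¹ |t - s| with ⟨e, -⟩ | ⟨e, -⟩
  · rw [e, mul_pow, inv_mul_cancel_left₀ (by positivity)]
    calc _ ≤ A * ((2 : ℝ) ^ (-γ)) ^ j + A * ((2 : ℝ) ^ (-γ)) ^ j :=
          (norm_sub_le _ _).trans (add_le_add (hT j t) (hT j s))
      _ = 2 * A * ((2 : ℝ) ^ (-γ)) ^ j := by ring
      _ ≤ _ := by gcongr; linarith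
  · rw [e]
    have h1 := Convex.norm_image_sub_le_of_norm_hasDerivWithin_le (s := Set.univ)
      (fun x _ => (hasDerivAt_block P j T (hT j) x).hasDerivWithinAt)
      (fun x _ => h T j _ (hT j) x) convex_univ (Set.mem_univ s) (Set.mem_univ t)
    refine h1.trans ?_
    rw [Real.norm_eq_abs]
    calc _ = C * A * (|t - s| * (2 * (2 : ℝ) ^ (-γ)) ^ j) := by rw [mul_pow]; ring
      _ ≤ _ := by gcongr; linarith

theorem two_rpow_neg_sub_one (γ : ℝ) : (2 : ℝ) ^ (-(γ - 1)) = 2 * (2 : ℝ) ^ (-γ) := by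
  rw [show -(γ - 1) = 1 + -γ by ring, Real.rpow_add two_pos, Real.rpow_one]

theorem two_rpow_neg_add (α β : ℝ) : (2 : ℝ) ^ (-(α + β)) = (2 : ℝ) ^ (-α) * (2 : ℝ) ^ (-β) := by
  rw [neg_add, Real.rpow_add two_pos]

theorem exists_blockBound_derivCLM (P : DyadicPartition) : ∃ C : ℝ, 0 ≤ C ∧
    ∀ (T : 𝓢'(ℝ, E)) (γ A : ℝ), BlockBound P γ A T →
      ∀ j x, ‖block P j (TemperedDistribution.derivCLM E T) x‖ ≤
        C * A * (2 * (2 : ℝ) ^ (-γ)) ^ j := by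
  obtain ⟨C, hC, h⟩ := exists_norm_block_derivCLM_le (E := E) P
  refine ⟨C, hC, fun T γ A hT j x => (h T j _ (hT j) x).trans (le_of_eq ?_)⟩
  rw [mul_pow]
  ring

/-- A distribution of regularity `γ - 1` has a locally `γ`-Hölder continuous antiderivative. -/
theorem exists_isAntiderivative_of_blockBound (P : DyadicPartition) {γ : ℝ} (h0 : 0 < γ)
    (h1 : γ < 1) : ∃ C : ℝ, 0 ≤ C ∧ ∀ (T : 𝓢'(ℝ, E)) (A : ℝ), BlockBound P (γ - 1) A T →
      ∃ U : ℝ → E, IsAntiderivative T U ∧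
        ∀ s t, s ≠ t → |t - s| ≤ 1 → ‖U t - U s‖ ≤ C * A * |t - s| ^ γ := by
  obtain ⟨C, hC, h⟩ := exists_norm_integral_block_le (E := E) P
  obtain ⟨D, hD, hsum⟩ := exists_sum_min_le h0 h1
  obtain ⟨hz, hz1⟩ := two_rpow_neg_bounds h0 h1
  set z := (2 : ℝ) ^ (-γ) with hzdef
  refine ⟨(C + 1) * D, by positivity, fun T A hT => ?_⟩
  have hA := hT.nonneg
  rw [BlockBound, two_rpow_neg_sub_one, ← hzdef] at hT
  -- This crude bound, valid on intervals of any length, gives summability. Only the block of index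
  -- zero needs the linear factor.
  have hb : ∀ j s t, ‖∫ r in s..t, block P j T r‖ ≤ (C + 1) * (A * z ^ j) * (1 + |t - s|) := by
    intro j s t
    have hp : 0 ≤ A * z ^ j := by positivity
    rcases Nat.eq_zero_or_pos j with rfl | hj
    · refine (norm_integral_le_mul_abs (hT 0) s t).trans ?_
      simp only [pow_zero, mul_one]
      nlinarith [abs_nonneg (t - s), mul_nonneg hC hA, mul_nonneg hA (abs_nonneg (t - s)),
        mul_nonneg (mul_nonneg hC hA) (abs_nonneg (t - s))]
    · refine (h T j _ hj (hT j) s t).trans ?_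
      have e : C * ((2 : ℝ) ^ j)⁻¹ * (A * (2 * z) ^ j) = C * (A * z ^ j) := by
        rw [mul_pow]; field_simp
      rw [e]
      nlinarith [abs_nonneg (t - s), mul_nonneg hC hp, mul_nonneg hp (abs_nonneg (t - s)),
        mul_nonneg (mul_nonneg hC hp) (abs_nonneg (t - s))]
  have hb' : ∀ j s t, |t - s| ≤ 1 → ‖∫ r in s..t, block P j T r‖ ≤
      (C + 1) * A * (min ((2 : ℝ) ^ j)⁻¹ |t - s| * (2 * z) ^ j) := by
    intro j s t hst
    have htriv : ‖∫ r in s..t, block P j T r‖ ≤ (C + 1) * A * (|t - s| * (2 * z) ^ j) := by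
      refine (norm_integral_le_mul_abs (hT j) s t).trans ?_
      calc _ = 1 * A * (|t - s| * (2 * z) ^ j) := by ring
        _ ≤ _ := by gcongr; linarith
    rcases min_cases ((2 : ℝ) ^ j)⁻¹ |t - s| with ⟨e, e'⟩ | ⟨e, -⟩
    -- The block of index zero has no oscillation to exploit. On intervals of length at most 1 the
    -- trivial estimate suffices, since the minimum is then 1.
    · rcases Nat.eq_zero_or_pos j with rfl | hj
      · refine htriv.trans ?_
        gcongr
        simpa using hst
      · rw [e]
        refine (h T j _ hj (hT j) s t).trans ?_
        calc _ = C * A * (((2 : ℝ) ^ j)⁻¹ * (2 * z) ^ j) := by ring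
          _ ≤ _ := by gcongr; linarith
    · rwa [e]
  have hs : Summable fun j => (C + 1) * (A * z ^ j) :=
    ((summable_geometric_of_lt_one (by positivity) hz1).mul_left A).mul_left _
  obtain ⟨U, w, hw, -, hser, hU⟩ := exists_series_antiderivative
    (fun j => continuous_block P j T) hs (fun j t => by simpa using hb j 0 t)
  have hwT : w = T := hser.unique (isSeriesSum_block P T)
  refine ⟨U, hwT ▸ hw, fun s t hne hst => ?_⟩
  refine le_of_tendsto (hU s t).tendsto_sum_nat.norm (Eventually.of_forall fun n => ?_)
  refine (norm_sum_le_of_le _ fun j _ => hb' j s t hst).trans ?_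
  rw [← Finset.mul_sum, mul_right_comm (C + 1) D A, mul_assoc _ D]
  gcongr
  exact hsum _ (abs_pos.2 (sub_ne_zero.2 hne.symm)) hst n

end Area

/-! ### The paraproducts and their integrals -/

section Area

variable {E F G : Type*} [NormedAddCommGroup E] [NormedSpace ℂ E]
  [NormedAddCommGroup F] [NormedSpace ℂ F] [NormedAddCommGroup G] [NormedSpace ℂ G]

/-- The terms of the paraproduct `u ≺ ∂v`. -/
def lowTerm (P : DyadicPartition) (B : E →L[ℂ] F →L[ℂ] G) (u : 𝓢'(ℝ, E)) (v : 𝓢'(ℝ, F)) (k : ℕ)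
    (r : ℝ) : G :=
  ∑ i ∈ Finset.range (k - 1),
    B (block P i u r) (block P k (TemperedDistribution.derivCLM F v) r)

/-- The terms of the paraproduct `u ≻ ∂v`. -/
def highTerm (P : DyadicPartition) (B : E →L[ℂ] F →L[ℂ] G) (u : 𝓢'(ℝ, E)) (v : 𝓢'(ℝ, F)) (k : ℕ)
    (r : ℝ) : G :=
  ∑ i ∈ Finset.range (k - 1),
    B (block P k u r) (block P i (TemperedDistribution.derivCLM F v) r)

theorem continuous_lowTerm (P : DyadicPartition) (B : E →L[ℂ] F →L[ℂ] G) (u : 𝓢'(ℝ, E))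
    (v : 𝓢'(ℝ, F)) (k : ℕ) : Continuous (lowTerm P B u v k) :=
  continuous_finsetSum _ fun _ _ => continuous_bilin B (continuous_block _ _ _) (continuous_block _ _ _)

theorem continuous_highTerm (P : DyadicPartition) (B : E →L[ℂ] F →L[ℂ] G) (u : 𝓢'(ℝ, E))
    (v : 𝓢'(ℝ, F)) (k : ℕ) : Continuous (highTerm P B u v k) :=
  continuous_finsetSum _ fun _ _ => continuous_bilin B (continuous_block _ _ _) (continuous_block _ _ _)

theorem sum_range_add_sum_Icc {M : Type*} [AddCommMonoid M] (f : ℕ → M) (k : ℕ) :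
    ∑ i ∈ Finset.range (k - 1), f i + ∑ i ∈ Finset.Icc (k - 1) (k + 1), f i =
      ∑ i ∈ Finset.range (k + 2), f i := by
  rw [Finset.range_eq_Ico, Finset.range_eq_Ico,
    show Finset.Icc (k - 1) (k + 1) = Finset.Ico (k - 1) (k + 2) by ext; simp; omega,
    Finset.sum_Ico_consecutive _ (by omega) (by omega)]

variable [CompleteSpace E] [CompleteSpace F] [CompleteSpace G]

/-- Integration by parts in the terms of the paraproduct. -/
theorem integral_lowTerm (P : DyadicPartition) (B : E →L[ℂ] F →L[ℂ] G) {u : 𝓢'(ℝ, E)}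
    {v : 𝓢'(ℝ, F)} {A₁ A₂ : ℕ → ℝ} (hu : ∀ k x, ‖block P k u x‖ ≤ A₁ k)
    (hv : ∀ k x, ‖block P k v x‖ ≤ A₂ k) (k : ℕ) (s t : ℝ) :
    ∫ r in s..t, lowTerm P B u v k r =
      ∑ i ∈ Finset.range (k - 1), (B (block P i u t) (block P k v t) -
        B (block P i u s) (block P k v s)) -
      ∫ r in s..t, ∑ i ∈ Finset.range (k - 1),
        B (block P i (TemperedDistribution.derivCLM E u) r) (block P k v r) := by
  have hc : Continuous fun r => ∑ i ∈ Finset.range (k - 1),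
      B (block P i (TemperedDistribution.derivCLM E u) r) (block P k v r) :=
    continuous_finsetSum _ fun _ _ =>
      continuous_bilin B (continuous_block _ _ _) (continuous_block _ _ _)
  rw [eq_sub_iff_add_eq, ← intervalIntegral.integral_add
    ((continuous_lowTerm P B u v k).intervalIntegrable _ _) (hc.intervalIntegrable _ _),
    Finset.sum_sub_distrib]
  refine intervalIntegral.integral_eq_sub_of_hasDerivAt
    (f := fun r => ∑ i ∈ Finset.range (k - 1), B (block P i u r) (block P k v r))
    (fun r _ => ?_) (((continuous_lowTerm P B u v k).add hc).intervalIntegrable _ _)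
  rw [lowTerm, ← Finset.sum_add_distrib]
  refine HasDerivAt.fun_sum fun i _ => ?_
  exact (B.bilinearRestrictScalars ℝ).hasDerivAt_of_bilinear
    (fun _ => hasDerivAt_block P i u (hu i) r) (fun _ => hasDerivAt_block P k v (hv k) r)

/-- The paraproducts `u ≺ ∂v` and `u ≻ ∂v` exist, and their integrals describe the increments of
`v` weighted with `u` up to a remainder of order `α + β`. -/
theorem exists_paraproduct_antiderivative (P : DyadicPartition) (B : E →L[ℂ] F →L[ℂ] G) {α β : ℝ}
    (hα : 0 < α) (hβ : 0 < β) (hαβ : α + β < 1) : ∃ C : ℝ, 0 ≤ C ∧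
    ∀ (u : 𝓢'(ℝ, E)) (v : 𝓢'(ℝ, F)) (A₁ A₂ : ℝ), BlockBound P α A₁ u → BlockBound P β A₂ v →
      ∃ U₁ U₂ : ℝ → G,
        IsSeriesSum (lowTerm P B u v) (paraLow P B u (TemperedDistribution.derivCLM F v)) ∧
        IsSeriesSum (highTerm P B u v) (paraHigh P B u (TemperedDistribution.derivCLM F v)) ∧
        IsAntiderivative (paraLow P B u (TemperedDistribution.derivCLM F v)) U₁ ∧
        IsAntiderivative (paraHigh P B u (TemperedDistribution.derivCLM F v)) U₂ ∧
        ∀ (f : ℝ → E) (g : ℝ → F), (∀ t, HasSum (fun j => block P j u t) (f t)) →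
          (∀ t, HasSum (fun j => block P j v t) (g t)) → ∀ s t, s ≠ t → |t - s| ≤ 1 →
          ‖(U₁ t - U₁ s) + (U₂ t - U₂ s) - B (f s) (g t - g s)‖ ≤
            C * A₁ * A₂ * |t - s| ^ (α + β) := by
  obtain ⟨hx, hx1⟩ := two_rpow_neg_bounds hα (by linarith)
  obtain ⟨hy, hy1⟩ := two_rpow_neg_bounds hβ (by linarith)
  obtain ⟨hz, hz1⟩ := two_rpow_neg_bounds (add_pos hα hβ) hαβ
  obtain ⟨Cs, hCs, hsum⟩ := exists_sum_min_le (add_pos hα hβ) hαβ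
  rw [two_rpow_neg_add] at hz hz1 hsum
  obtain ⟨D₁, hD₁, hd₁⟩ := exists_blockBound_derivCLM (E := E) P
  obtain ⟨D₂, hD₂, hd₂⟩ := exists_blockBound_derivCLM (E := F) P
  obtain ⟨I₁, hI₁, hi₁⟩ := exists_norm_block_sub_le (E := E) P
  obtain ⟨I₂, hI₂, hi₂⟩ := exists_norm_block_sub_le (E := F) P
  obtain ⟨H₁, hH₁, hh₁⟩ := exists_norm_integral_sum_bilin_block_le P B
    (q := 2 * (2 : ℝ) ^ (-α)) (r := (2 : ℝ) ^ (-β)) (by linarith) (by linarith)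
  obtain ⟨H₂, hH₂, hh₂⟩ := exists_norm_integral_sum_bilin_block_le P B.flip
    (q := 2 * (2 : ℝ) ^ (-β)) (r := (2 : ℝ) ^ (-α)) (by linarith) (by linarith)
  set x := (2 : ℝ) ^ (-α) with hxdef
  set y := (2 : ℝ) ^ (-β) with hydef
  have hx0 : 0 < x := by linarith
  have hy0 : 0 < y := by linarith
  have hx2 : 0 < 1 - x := by linarith
  have hy2 : 0 < 1 - y := by linarith
  -- The four summands belong to the four error terms of `hdec`: increments of low blocks of `u`
  -- against a high block of `v`, the integral of `∂u` low against `v` high, the integral of `u ≻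
  -- ∂v`, and blocks of `u` against increments of lower or comparable blocks of `v`.
  set Cf : ℝ := ‖B‖ * I₁ * (1 / (1 - y)) + H₁ * D₁ + H₂ * D₂ +
    ‖B‖ * I₂ * ((x ^ 2)⁻¹ * (1 / (1 - x)))
  have hCf : 0 ≤ Cf := by positivity
  refine ⟨Cf * Cs, by positivity, fun u v A₁ A₂ hu hv => ?_⟩
  have hA₁ : 0 ≤ A₁ := BlockBound.nonneg (γ := α) (P := P) (T := u) hu
  have hA₂ : 0 ≤ A₂ := BlockBound.nonneg (γ := β) (P := P) (T := v) hv
  set u' := TemperedDistribution.derivCLM E u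
  set v' := TemperedDistribution.derivCLM F v with hv'def
  have hu' := hd₁ u α A₁ hu
  have hv' := hd₂ v β A₂ hv
  rw [← hxdef] at hu'
  rw [← hydef] at hv'
  have hmin : ∀ (k : ℕ) (s t : ℝ), 0 ≤ min ((2 : ℝ) ^ k)⁻¹ |t - s| := fun k s t =>
    le_min (by positivity) (abs_nonneg _)
  have b1 : ∀ k s t, ‖∫ r in s..t, ∑ i ∈ Finset.range (k - 1), B (block P i u' r) (block P k v r)‖ ≤
      H₁ * D₁ * A₁ * A₂ * (min ((2 : ℝ) ^ k)⁻¹ |t - s| * (2 * (x * y)) ^ k) := fun k s t => by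
    have := hh₁ u' v (D₁ * A₁) A₂ (by positivity) hA₂ hu' hv k s t
    simpa only [mul_assoc] using this
  have b2 : ∀ k s t, ‖∫ r in s..t, highTerm P B u v k r‖ ≤
      H₂ * D₂ * A₁ * A₂ * (min ((2 : ℝ) ^ k)⁻¹ |t - s| * (2 * (x * y)) ^ k) := fun k s t => by
    refine (hh₂ v' u (D₂ * A₂) A₁ (by positivity) hA₁ hv' hu k s t).trans (le_of_eq ?_)
    rw [show 2 * y * x = 2 * (x * y) by ring]
    ring
  have hmz : ∀ (k : ℕ) (s t : ℝ), min ((2 : ℝ) ^ k)⁻¹ |t - s| * (2 * (x * y)) ^ k ≤ (x * y) ^ k :=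
    fun k s t => by
      rw [mul_pow 2]
      calc _ ≤ ((2 : ℝ) ^ k)⁻¹ * (2 ^ k * (x * y) ^ k) := by gcongr; exact min_le_left _ _
        _ = _ := by field_simp
  -- The boundary terms of the integration by parts decay only like `2 ^ (-k β)`. This suffices for
  -- convergence of the series; their contribution to order `β` is removed below by `u(s) (v(t) -
  -- v(s))`.
  have b3 : ∀ k t, ‖∑ i ∈ Finset.range (k - 1), B (block P i u t) (block P k v t)‖ ≤
      ‖B‖ * (A₁ * (1 / (1 - x))) * (A₂ * y ^ k) := by
    intro k t
    refine (norm_sum_le_of_le _ fun i _ => norm_bilin_le B (hu i t) (hv k t)).trans ?_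
    rw [← Finset.sum_mul, ← Finset.mul_sum, ← Finset.mul_sum]
    gcongr
    exact sum_range_pow_le_of_lt_one hx0.le hx1 _
  have hlow := integral_lowTerm P B hu hv
  have hgy : Summable fun k : ℕ => y ^ k := summable_geometric_of_lt_one hy0.le hy1
  have hgz : Summable fun k : ℕ => (x * y) ^ k := summable_geometric_of_lt_one (by positivity) hz1
  have habs : ∀ t : ℝ, (1 : ℝ) ≤ 1 + |t| := fun t => by simp
  obtain ⟨U₁, w₁, hw₁, -, hs₁, hU₁⟩ := exists_series_antiderivative
    (p := lowTerm P B u v) (continuous_lowTerm P B u v)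
    (c := fun k => 2 * (‖B‖ * (A₁ * (1 / (1 - x))) * (A₂ * y ^ k)) +
      H₁ * D₁ * A₁ * A₂ * (x * y) ^ k)
    (((((hgy.mul_left A₂).mul_left _)).mul_left 2).add (hgz.mul_left _)) (fun k t => by
      have hpos : 0 ≤ 2 * (‖B‖ * (A₁ * (1 / (1 - x))) * (A₂ * y ^ k)) +
        H₁ * D₁ * A₁ * A₂ * (x * y) ^ k := by positivity
      refine le_trans ?_ (le_mul_of_one_le_right hpos (habs t))
      rw [hlow, Finset.sum_sub_distrib]
      refine (norm_sub_le _ _).trans (add_le_add ((norm_sub_le _ _).trans ?_) ?_)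
      · linarith [b3 k t, b3 k 0]
      · refine (b1 k 0 t).trans ?_
        gcongr
        exact hmz k 0 t)
  obtain ⟨U₂, w₂, hw₂, -, hs₂, hU₂⟩ := exists_series_antiderivative
    (p := highTerm P B u v) (continuous_highTerm P B u v)
    (c := fun k => H₂ * D₂ * A₁ * A₂ * (x * y) ^ k) (hgz.mul_left _) (fun k t => by
      have hpos : 0 ≤ H₂ * D₂ * A₁ * A₂ * (x * y) ^ k := by positivity
      refine le_trans ?_ (le_mul_of_one_le_right hpos (habs t))
      refine (b2 k 0 t).trans ?_
      gcongr
      exact hmz k 0 t)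
  have e₁ : paraLow P B u v' = w₁ := IsParaproduct.paraLow_eq hs₁
  have e₂ : paraHigh P B u v' = w₂ := IsParaproduct.paraLow_eq hs₂
  refine ⟨U₁, U₂, e₁ ▸ hs₁, e₂ ▸ hs₂, e₁ ▸ hw₁, e₂ ▸ hw₂, fun f g hf hg s t hst hst1 => ?_⟩
  set h := |t - s|
  have hh : 0 < h := abs_pos.2 (sub_ne_zero.2 hst.symm)
  set m : ℕ → ℝ := fun k => min ((2 : ℝ) ^ k)⁻¹ h * (2 * (x * y)) ^ k
  have hm0 : ∀ k, 0 ≤ m k := fun k => mul_nonneg (hmin k s t) (by positivity)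
  -- the pairs of blocks in the expansion of `B (f s) (g t - g s)`
  let K : ℕ → ℕ → G := fun k i => B (block P i u s) (block P k v t - block P k v s)
  let J : ℕ → G := fun k => ∑ i ∈ Finset.range (k - 1), K i k +
      ∑ i ∈ Finset.range (k - 1), K k i + ∑ i ∈ Finset.Icc (k - 1) (k + 1), K i k
  -- The sums of `J` run over a square of pairs plus the single pair `K (n + 1) n`, which tends to
  -- zero because the blocks do.
  have hJ : Tendsto (fun n => ∑ k ∈ Finset.range (n + 1), J k) atTop (𝓝 (B (f s) (g t - g s))) := by
    have hsq : ∀ n, ∑ k ∈ Finset.range (n + 1), J k =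
        B (∑ i ∈ Finset.range (n + 1), block P i u s)
          (∑ k ∈ Finset.range (n + 1), (block P k v t - block P k v s)) + K (n + 1) n := by
      intro n
      rw [sum_low_high_diagonal K n]
      congr 1
      simp only [K, map_sum, sum_apply]
    simp only [hsq]
    have l1 : Tendsto (fun n => ∑ i ∈ Finset.range (n + 1), block P i u s) atTop (𝓝 (f s)) :=
      (hf s).tendsto_sum_nat.comp (tendsto_add_atTop_nat 1)
    have l2 : Tendsto (fun n => ∑ k ∈ Finset.range (n + 1), (block P k v t - block P k v s)) atTop
        (𝓝 (g t - g s)) := ((hg t).sub (hg s)).tendsto_sum_nat.comp (tendsto_add_atTop_nat 1)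
    have l3 : Tendsto (fun n => K (n + 1) n) atTop (𝓝 0) := by
      have l4 := ((hg t).sub (hg s)).summable.tendsto_atTop_zero.comp (tendsto_add_atTop_nat 1)
      have l5 := (B.isBoundedBilinearMap.continuous.tendsto (0, 0)).comp
        ((hf s).summable.tendsto_atTop_zero.prodMk_nhds l4)
      simpa [K, Function.comp_def] using l5
    have l6 := ((B.isBoundedBilinearMap.continuous.tendsto (f s, g t - g s)).comp
      (l1.prodMk_nhds l2)).add l3
    simpa using l6
  -- The boundary terms and the low-high part of `J` combine into increments of `u`. The high-low
  -- and diagonal parts of `J` merge into one sum over `i ≤ k + 1`. Every remaining term is of order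
  -- `α + β`.
  have hdec : ∀ k, (∫ r in s..t, lowTerm P B u v k r) + (∫ r in s..t, highTerm P B u v k r) - J k =
      ∑ i ∈ Finset.range (k - 1), B (block P i u t - block P i u s) (block P k v t) -
      (∫ r in s..t, ∑ i ∈ Finset.range (k - 1), B (block P i u' r) (block P k v r)) +
      (∫ r in s..t, highTerm P B u v k r) - ∑ i ∈ Finset.range (k + 2), K i k := by
    intro k
    have h1 : J k = ∑ i ∈ Finset.range (k - 1), K k i + ∑ i ∈ Finset.range (k + 2), K i k := by
      rw [← sum_range_add_sum_Icc (fun i => K i k) k]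
      simp only [J]
      abel
    have h2 : ∑ i ∈ Finset.range (k - 1), (B (block P i u t) (block P k v t) -
        B (block P i u s) (block P k v s)) - ∑ i ∈ Finset.range (k - 1), K k i =
        ∑ i ∈ Finset.range (k - 1), B (block P i u t - block P i u s) (block P k v t) := by
      rw [← Finset.sum_sub_distrib]
      refine Finset.sum_congr rfl fun i _ => ?_
      simp only [K, map_sub, sub_apply]
      abel
    rw [hlow, h1, ← h2]
    abel
  have t1 : ∀ k, ‖∑ i ∈ Finset.range (k - 1), B (block P i u t - block P i u s) (block P k v t)‖ ≤
      ‖B‖ * I₁ * A₁ * A₂ * (y ^ k * ∑ i ∈ Finset.range k, min ((2 : ℝ) ^ i)⁻¹ h * (2 * x) ^ i) := by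
    intro k
    refine (norm_sum_le_of_le _ fun i _ =>
      norm_bilin_le B (hi₁ u α A₁ hu i s t) (hv k t)).trans ?_
    rw [← hxdef, ← Finset.sum_mul, ← Finset.mul_sum, ← Finset.mul_sum]
    have : ∑ i ∈ Finset.range (k - 1), min ((2 : ℝ) ^ i)⁻¹ h * (2 * x) ^ i ≤
        ∑ i ∈ Finset.range k, min ((2 : ℝ) ^ i)⁻¹ h * (2 * x) ^ i :=
      Finset.sum_le_sum_of_subset_of_nonneg (Finset.range_mono (by omega))
        fun i _ _ => mul_nonneg (hmin i s t) (by positivity)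
    calc _ ≤ ‖B‖ * (I₁ * A₁ * ∑ i ∈ Finset.range k, min ((2 : ℝ) ^ i)⁻¹ h * (2 * x) ^ i) *
          (A₂ * y ^ k) := by gcongr
      _ = _ := by ring
  -- The inner sum has `k + 2` terms; writing `x ^ k` as `x ^ (-2) * x ^ (k + 2)` gives it the shape
  -- required by `sum_pow_mul_sum_le`.
  have t2 : ∀ k, ‖∑ i ∈ Finset.range (k + 2), K i k‖ ≤ ‖B‖ * I₂ * A₁ * A₂ * ((x ^ 2)⁻¹ *
      (x ^ (k + 2) * ∑ i ∈ Finset.range (k + 2), min ((2 : ℝ) ^ i)⁻¹ h * (2 * y) ^ i)) := by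
    intro k
    refine (norm_sum_le_of_le _ fun i _ =>
      norm_bilin_le B (hu k s) (hi₂ v β A₂ hv i s t)).trans (le_of_eq ?_)
    have q : ∀ S : ℝ, (x ^ 2)⁻¹ * (x ^ (k + 2) * S) = x ^ k * S := fun S => by
      rw [pow_add]
      field_simp
    rw [← hydef, ← Finset.mul_sum, ← Finset.mul_sum, q]
    ring
  have hfin : ∀ n, ‖∑ k ∈ Finset.range (n + 1), ((∫ r in s..t, lowTerm P B u v k r) +
      (∫ r in s..t, highTerm P B u v k r) - J k)‖ ≤ Cf * Cs * A₁ * A₂ * h ^ (α + β) := by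
    intro n
    have hM : ∀ N, ∑ k ∈ Finset.range N, m k ≤ Cs * h ^ (α + β) := hsum h hh hst1
    set M := Cs * h ^ (α + β)
    have s1 : ∑ k ∈ Finset.range (n + 1),
        y ^ k * ∑ i ∈ Finset.range k, min ((2 : ℝ) ^ i)⁻¹ h * (2 * x) ^ i ≤ 1 / (1 - y) * M := by
      refine (sum_pow_mul_sum_le hy0.le hy1
        (fun i => mul_nonneg (hmin i s t) (by positivity)) _).trans ?_
      gcongr
      refine le_trans (le_of_eq (Finset.sum_congr rfl fun i _ => ?_)) (hM (n + 1))
      simp only [m, mul_pow]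
      ring
    have s2 : ∑ k ∈ Finset.range (n + 1), (x ^ (k + 2) *
        ∑ i ∈ Finset.range (k + 2), min ((2 : ℝ) ^ i)⁻¹ h * (2 * y) ^ i) ≤ 1 / (1 - x) * M := by
      have hp : ∀ i, 0 ≤ min ((2 : ℝ) ^ i)⁻¹ h * (2 * y) ^ i := fun i =>
        mul_nonneg (hmin i s t) (by positivity)
      have s3 := sum_pow_mul_sum_le hx0.le hx1 hp (n + 1 + 2)
      have s4 : ∑ k ∈ Finset.range (n + 1), (x ^ (k + 2) *
          ∑ i ∈ Finset.range (k + 2), min ((2 : ℝ) ^ i)⁻¹ h * (2 * y) ^ i) ≤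
          ∑ k ∈ Finset.range (n + 1 + 2), (x ^ k *
          ∑ i ∈ Finset.range k, min ((2 : ℝ) ^ i)⁻¹ h * (2 * y) ^ i) := by
        rw [Finset.sum_range_succ' _ (n + 1 + 1), Finset.sum_range_succ' _ (n + 1)]
        have q0 : ∀ k, 0 ≤ x ^ k * ∑ i ∈ Finset.range k, min ((2 : ℝ) ^ i)⁻¹ h * (2 * y) ^ i :=
          fun k => mul_nonneg (by positivity) (Finset.sum_nonneg fun i _ => hp i)
        exact (le_add_of_nonneg_right (q0 (0 + 1))).trans (le_add_of_nonneg_right (q0 0))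
      refine s4.trans (s3.trans ?_)
      gcongr
      refine le_trans (le_of_eq (Finset.sum_congr rfl fun i _ => ?_)) (hM (n + 1 + 2))
      simp only [m, mul_pow]
      ring
    have s3 : ∑ k ∈ Finset.range (n + 1), min ((2 : ℝ) ^ k)⁻¹ h * (2 * (x * y)) ^ k ≤ M := hM _
    refine (norm_sum_le_of_le _ fun k _ => ?_ : _ ≤ ∑ k ∈ Finset.range (n + 1),
      (‖B‖ * I₁ * A₁ * A₂ * (y ^ k * ∑ i ∈ Finset.range k, min ((2 : ℝ) ^ i)⁻¹ h * (2 * x) ^ i) +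
      H₁ * D₁ * A₁ * A₂ * (min ((2 : ℝ) ^ k)⁻¹ h * (2 * (x * y)) ^ k) +
      H₂ * D₂ * A₁ * A₂ * (min ((2 : ℝ) ^ k)⁻¹ h * (2 * (x * y)) ^ k) +
      ‖B‖ * I₂ * A₁ * A₂ * ((x ^ 2)⁻¹ * (x ^ (k + 2) *
        ∑ i ∈ Finset.range (k + 2), min ((2 : ℝ) ^ i)⁻¹ h * (2 * y) ^ i)))).trans ?_
    · rw [hdec]
      refine (norm_sub_le _ _).trans (add_le_add ((norm_add_le _ _).trans (add_le_add
        ((norm_sub_le _ _).trans (add_le_add (t1 k) (b1 k s t))) (b2 k s t))) (t2 k))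
    · rw [Finset.sum_add_distrib, Finset.sum_add_distrib, Finset.sum_add_distrib,
        ← Finset.mul_sum, ← Finset.mul_sum, ← Finset.mul_sum, ← Finset.mul_sum, ← Finset.mul_sum]
      calc _ ≤ ‖B‖ * I₁ * A₁ * A₂ * (1 / (1 - y) * M) + H₁ * D₁ * A₁ * A₂ * M +
          H₂ * D₂ * A₁ * A₂ * M + ‖B‖ * I₂ * A₁ * A₂ * ((x ^ 2)⁻¹ * (1 / (1 - x) * M)) := by gcongr
        _ = _ := by simp only [Cf, M]; ring
  have hL := (((hU₁ s t).tendsto_sum_nat.comp (tendsto_add_atTop_nat 1)).add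
    ((hU₂ s t).tendsto_sum_nat.comp (tendsto_add_atTop_nat 1))).sub hJ
  refine le_of_tendsto hL.norm (Eventually.of_forall fun n => ?_)
  have := hfin n
  rwa [Finset.sum_sub_distrib, Finset.sum_add_distrib] at this

end Area

/-! ### Rates of convergence for continuously differentiable functions -/

section Mollification

variable {E F G : Type*} [NormedAddCommGroup E] [NormedSpace ℂ E]
  [NormedAddCommGroup F] [NormedSpace ℂ F] [NormedAddCommGroup G] [NormedSpace ℂ G]

theorem Represents.smear_eq {T : 𝓢'(ℝ, E)} {f : ℝ → E} (h : Represents T f) (hf : Continuous f)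
    {M : ℝ} (hM : ∀ x, ‖f x‖ ≤ M) (K : 𝓢(ℝ, ℂ)) : smear T K = convolve K f := by
  have hM0 : 0 ≤ M := (norm_nonneg _).trans (hM 0)
  obtain ⟨S, hS⟩ := exists_distribution_of_growth (C := M) hf fun x =>
    (hM x).trans (le_mul_of_one_le_right hM0 (by simp))
  have hTS : T = S := distribution_ext fun φ hφ => by rw [h φ hφ, hS]
  ext x
  rw [hTS, smear, hS, convolve_eq]
  simp only [reflAt_apply]

theorem integral_dilation_kernel_zero (P : DyadicPartition) (n : ℕ) :
    ∫ x, dilation n (P.kernel 0) x = 1 := by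
  have h := P.fourier_dilation_kernel_zero n 0
  rw [SchwartzMap.fourier_coe, Real.fourier_real_eq] at h
  obtain ⟨r, hr, h1⟩ := P.exists_χ_eq_one
  have h2 : P.χ 0 = 1 := h1 0 (by simpa using hr)
  simpa [h2] using h

theorem integrable_abs_mul_norm (K : 𝓢(ℝ, ℂ)) : Integrable fun x : ℝ => |x| * ‖K x‖ := by
  refine (integrable_weight_mul K).mono' (by fun_prop) (Eventually.of_forall fun x => ?_)
  rw [Real.norm_of_nonneg (by positivity)]
  gcongr
  simp

/-- Mollification at scale `2 ^ (-n)` of a function that is Lipschitz at a point. -/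
theorem norm_convolve_dilation_kernel_zero_sub_le [CompleteSpace E] (P : DyadicPartition) {f : ℝ → E}
    (hf : Continuous f) {M : ℝ} (hM : ∀ x, ‖f x‖ ≤ M) {x D : ℝ}
    (hD : ∀ y, ‖f (x - y) - f x‖ ≤ D * |y|) (n : ℕ) :
    ‖convolve (dilation n (P.kernel 0)) f x - f x‖ ≤
      D * ((2 ^ n)⁻¹ * ∫ y, |y| * ‖P.kernel 0 y‖) := by
  set K := dilation n (P.kernel 0)
  have h1 : f x = ∫ y, K y • f x := by
    rw [integral_smul_const, integral_dilation_kernel_zero, one_smul]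
  have h2 : Integrable fun y => K y • f (x - y) :=
    integrable_smul_of_bounded K (by fun_prop) (M := M) fun y => hM (x - y)
  have h3 : Integrable fun y => K y • f x := K.integrable.smul_const _
  nth_rw 1 [h1]
  rw [convolve, ← integral_sub h2 h3, ← integral_abs_mul_norm_dilation, ← integral_const_mul]
  refine norm_integral_le_of_norm_le ((integrable_abs_mul_norm K).const_mul D)
    (Eventually.of_forall fun y => ?_)
  rw [← smul_sub, norm_smul]
  calc _ ≤ ‖K y‖ * (D * |y|) := by gcongr; exact hD y
    _ = _ := by ring

/-- Steps of length at most 1 stay in a compact interval where the derivative is bounded; for longer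
steps `2 * M ≤ 2 * M * |y|`. -/
theorem exists_lipschitz_of_contDiff {f : ℝ → E} (hf : ContDiff ℝ 1 f) {M : ℝ}
    (hM : ∀ x, ‖f x‖ ≤ M) (R : ℝ) :
    ∃ D, 0 ≤ D ∧ ∀ x, |x| ≤ R → ∀ y, ‖f (x - y) - f x‖ ≤ D * |y| := by
  have hM0 : 0 ≤ M := (norm_nonneg _).trans (hM 0)
  obtain ⟨D, hD⟩ := (isCompact_Icc (a := -(R + 1)) (b := R + 1)).exists_bound_of_continuousOn
    (hf.continuous_deriv le_rfl).continuousOn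
  refine ⟨max D 0 + 2 * M, by positivity, fun x hx y => ?_⟩
  rcases le_or_gt |y| 1 with hy | hy
  · have h1 : ∀ z ∈ Set.Icc (-(R + 1)) (R + 1), ‖deriv f z‖ ≤ max D 0 := fun z hz =>
      (hD z hz).trans (le_max_left _ _)
    rw [abs_le] at hx hy
    have h2 := (convex_Icc (-(R + 1)) (R + 1)).norm_image_sub_le_of_norm_deriv_le (𝕜 := ℝ)
      (fun z _ => (hf.differentiable one_ne_zero) z) h1 (x := x) (y := x - y)
      ⟨by linarith, by linarith⟩ ⟨by linarith, by linarith⟩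
    rw [show x - y - x = -y by ring, norm_neg, Real.norm_eq_abs] at h2
    refine h2.trans ?_
    gcongr
    linarith
  · calc _ ≤ ‖f (x - y)‖ + ‖f x‖ := norm_sub_le _ _
      _ ≤ (max D 0 + 2 * M) * 1 := by linarith [hM (x - y), hM x, le_max_right D 0]
      _ ≤ _ := by gcongr

/-- Mollification at scale `2 ^ (-n)` of a locally Lipschitz function costs `2 ^ (-n)`. This rate
beats the growth `2 ^ (n (1 - β))` of the partial sums of blocks of `∂v`, which the Hölder rate `2 ^
(-n α)` need not do. -/
theorem exists_norm_sum_block_sub_le [CompleteSpace E] (P : DyadicPartition) {T : 𝓢'(ℝ, E)}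
    {f : ℝ → E} (h : Represents T f) (hf : ContDiff ℝ 1 f) {M : ℝ} (hM : ∀ x, ‖f x‖ ≤ M) (R : ℝ) :
    ∃ C, 0 ≤ C ∧ ∀ x, |x| ≤ R → ∀ n,
      ‖∑ k ∈ Finset.range (n + 1), block P k T x - f x‖ ≤ C * (2 ^ n)⁻¹ ∧
      ‖block P (n + 1) T x‖ ≤ C * (2 ^ n)⁻¹ := by
  obtain ⟨D, hD0, hD⟩ := exists_lipschitz_of_contDiff hf hM R
  have hI : 0 ≤ ∫ y, |y| * ‖P.kernel 0 y‖ := integral_nonneg fun y => by positivity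
  set C := D * ∫ y, |y| * ‖P.kernel 0 y‖
  have hC : 0 ≤ C := by positivity
  have h1 : ∀ x, |x| ≤ R → ∀ n,
      ‖∑ k ∈ Finset.range (n + 1), block P k T x - f x‖ ≤ C * (2 ^ n)⁻¹ := fun x hx n => by
    rw [← smear_dilation_kernel_zero, h.smear_eq hf.continuous hM]
    refine (norm_convolve_dilation_kernel_zero_sub_le P hf.continuous hM (hD x hx) n).trans
      (le_of_eq ?_)
    simp only [C]
    ring
  refine ⟨2 * C, by positivity, fun x hx n => ⟨(h1 x hx n).trans ?_, ?_⟩⟩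
  · gcongr
    linarith
  · have h2 : block P (n + 1) T x = (∑ k ∈ Finset.range (n + 1 + 1), block P k T x - f x) -
        (∑ k ∈ Finset.range (n + 1), block P k T x - f x) := by
      rw [Finset.sum_range_succ _ (n + 1)]
      abel
    rw [h2]
    refine (norm_sub_le _ _).trans ?_
    have h3 : C * (2 ^ (n + 1))⁻¹ ≤ C * ((2 : ℝ) ^ n)⁻¹ := by
      gcongr
      · norm_num
      · omega
    linarith [h1 x hx n, h1 x hx (n + 1)]

theorem tendsto_integral_smul_of_uniform {ψ : ℝ → ℂ} (hψ : Continuous ψ) (hψc : HasCompactSupport ψ)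
    {q : ℕ → ℝ → E} {p : ℝ → E} (hq : ∀ n, Continuous (q n)) (hp : Continuous p) {e : ℕ → ℝ}
    (he : Tendsto e atTop (𝓝 0)) (h : ∀ x ∈ tsupport ψ, ∀ n, ‖q n x - p x‖ ≤ e n) :
    Tendsto (fun n => ∫ x, ψ x • q n x) atTop (𝓝 (∫ x, ψ x • p x)) := by
  have hi : ∀ {r : ℝ → E}, Continuous r → Integrable fun x => ψ x • r x := fun hr =>
    (hψ.smul hr).integrable_of_hasCompactSupport hψc.smul_right
  rw [tendsto_iff_norm_sub_tendsto_zero]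
  have h0 : Tendsto (fun n => (∫ x, ‖ψ x‖) * e n) atTop (𝓝 0) := by
    simpa using he.const_mul (∫ x, ‖ψ x‖)
  refine squeeze_zero (fun _ => norm_nonneg _) (fun n => ?_) h0
  rw [← integral_sub (hi (hq n)) (hi hp), ← integral_mul_const]
  refine norm_integral_le_of_norm_le
    ((hψ.integrable_of_hasCompactSupport hψc).norm.mul_const _) (Eventually.of_forall fun x => ?_)
  rw [← smul_sub, norm_smul]
  by_cases hx : x ∈ tsupport ψ
  · gcongr
    exact h x hx n
  · simp [image_eq_zero_of_notMem_tsupport hx]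

end Mollification

/-! ### Product decomposition and area for smooth functions -/

section Smooth

variable {E F G : Type*} [NormedAddCommGroup E] [NormedSpace ℂ E]
  [NormedAddCommGroup F] [NormedSpace ℂ F] [NormedAddCommGroup G] [NormedSpace ℂ G]

/-- The terms of the resonant product `u ∘ ∂v`. -/
def resonantTerm (P : DyadicPartition) (B : E →L[ℂ] F →L[ℂ] G) (u : 𝓢'(ℝ, E)) (v : 𝓢'(ℝ, F))
    (k : ℕ) (r : ℝ) : G :=
  ∑ i ∈ Finset.Icc (k - 1) (k + 1),
    B (block P i u r) (block P k (TemperedDistribution.derivCLM F v) r)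

theorem isResonantProduct_iff_isSeriesSum (P : DyadicPartition) (B : E →L[ℂ] F →L[ℂ] G)
    (u : 𝓢'(ℝ, E)) (v : 𝓢'(ℝ, F)) (w : 𝓢'(ℝ, G)) :
    IsResonantProduct P B u (TemperedDistribution.derivCLM F v) w ↔
      IsSeriesSum (resonantTerm P B u v) w :=
  Iff.rfl

theorem continuous_resonantTerm (P : DyadicPartition) (B : E →L[ℂ] F →L[ℂ] G) (u : 𝓢'(ℝ, E))
    (v : 𝓢'(ℝ, F)) (k : ℕ) : Continuous (resonantTerm P B u v k) :=
  continuous_finsetSum _ fun _ _ =>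
    continuous_bilin B (continuous_block _ _ _) (continuous_block _ _ _)

theorem sum_terms_eq (P : DyadicPartition) (B : E →L[ℂ] F →L[ℂ] G) (u : 𝓢'(ℝ, E)) (v : 𝓢'(ℝ, F))
    (n : ℕ) (r : ℝ) :
    ∑ k ∈ Finset.range (n + 1),
      (lowTerm P B u v k r + highTerm P B u v k r + resonantTerm P B u v k r) =
    B (∑ i ∈ Finset.range (n + 1), block P i u r)
      (∑ k ∈ Finset.range (n + 1), block P k (TemperedDistribution.derivCLM F v) r) +
    B (block P (n + 1) u r) (block P n (TemperedDistribution.derivCLM F v) r) := by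
  have h := sum_low_high_diagonal
    (fun i k => B (block P i u r) (block P k (TemperedDistribution.derivCLM F v) r)) n
  simp only [lowTerm, highTerm, resonantTerm]
  rw [h]
  simp only [map_sum, sum_apply]
  rw [Finset.sum_comm]

/-- Integration by parts against a test function. -/
theorem integral_smul_bilin_eq [CompleteSpace G] (B : E →L[ℂ] F →L[ℂ] G) (φ : 𝓢(ℝ, ℂ)) (hφ : HasCompactSupport φ)
    {f f' : ℝ → E} {g g' : ℝ → F} (hf : ∀ x, HasDerivAt f (f' x) x) (hf' : Continuous f')
    (hg : ∀ x, HasDerivAt g (g' x) x) (hg' : Continuous g') :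
    ∫ x, φ x • B (f x) (g' x) =
      -(∫ x, deriv φ x • B (f x) (g x)) - ∫ x, φ x • B (f' x) (g x) := by
  have cf : Continuous f := continuous_iff_continuousAt.2 fun x => (hf x).continuousAt
  have cg : Continuous g := continuous_iff_continuousAt.2 fun x => (hg x).continuousAt
  have h := integral_test_smul_eq_neg φ hφ (f := fun x => B (f x) (g x))
    (f' := fun x => B (f x) (g' x) + B (f' x) (g x))
    (fun x => (B.bilinearRestrictScalars ℝ).hasDerivAt_of_bilinear
      (fun _ => hf x) (fun _ => hg x))
    ((continuous_bilin B cf hg').add (continuous_bilin B hf' cg))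
  simp only [smul_add] at h
  rw [integral_add (integrable_test_smul φ hφ (continuous_bilin B cf hg'))
    (integrable_test_smul φ hφ (continuous_bilin B hf' cg))] at h
  rw [← h]
  abel

variable [CompleteSpace E] [CompleteSpace F] [CompleteSpace G]

/-- The Littlewood-Paley decomposition of the product of a smooth function with the derivative of a
smooth function. -/
theorem tendsto_integral_sum_terms (P : DyadicPartition) (B : E →L[ℂ] F →L[ℂ] G) {α β A₁ A₂ : ℝ}
    (hα : α ∈ Set.Ioo (0 : ℝ) 1) (hβ : β ∈ Set.Ioo (0 : ℝ) 1)
    {u : 𝓢'(ℝ, E)} {v : 𝓢'(ℝ, F)} (hu : BlockBound P α A₁ u) (hv : BlockBound P β A₂ v)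
    {f : ℝ → E} {g : ℝ → F} (hf : ContDiff ℝ 1 f) (hg : ContDiff ℝ 1 g) (huf : Represents u f)
    (hvg : Represents v g) (φ : 𝓢(ℝ, ℂ)) (hφ : HasCompactSupport φ) :
    Tendsto (fun n => ∫ x, φ x • ∑ k ∈ Finset.range (n + 1),
      (lowTerm P B u v k x + highTerm P B u v k x + resonantTerm P B u v k x)) atTop
      (𝓝 (∫ x, φ x • B (f x) (deriv g x))) := by
  obtain ⟨hx, hx1⟩ := two_rpow_neg_bounds hα.1 hα.2
  obtain ⟨hy, hy1⟩ := two_rpow_neg_bounds hβ.1 hβ.2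
  have hA₁ := hu.nonneg
  have hA₂ := hv.nonneg
  obtain ⟨hsf, hsf'⟩ := hasSum_block_of_represents P hα.1 hu hf.continuous huf
  obtain ⟨hsg, hsg'⟩ := hasSum_block_of_represents P hβ.1 hv hg.continuous hvg
  have hMf : ∀ x, ‖f x‖ ≤ A₁ / (1 - (2 : ℝ) ^ (-α)) := fun x => by
    simpa using hsf' x 0
  obtain ⟨R, hR⟩ : ∃ R, ∀ x ∈ tsupport φ, |x| ≤ R := hφ.isBounded.exists_norm_le
  obtain ⟨C, hC0, hC⟩ := exists_norm_sum_block_sub_le P huf hf hMf R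
  obtain ⟨D, hD0, hD⟩ := exists_blockBound_derivCLM (E := F) P
  have hv' := hD v β A₂ hv
  set v' := TemperedDistribution.derivCLM F v
  set y := (2 : ℝ) ^ (-β)
  set M := A₁ / (1 - (2 : ℝ) ^ (-α))
  have hM0 : 0 ≤ M := (norm_nonneg _).trans (hMf 0)
  have hy0 : 0 < y := by linarith
  have hy2 : 0 < 2 * y - 1 := by linarith
  have cS : ∀ n, Continuous fun x => ∑ i ∈ Finset.range (n + 1), block P i u x := fun n =>
    continuous_finsetSum _ fun _ _ => continuous_block _ _ _
  have cV : ∀ n, Continuous fun x => ∑ i ∈ Finset.range (n + 1), block P i v x := fun n =>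
    continuous_finsetSum _ fun _ _ => continuous_block _ _ _
  have cV' : ∀ n, Continuous fun x => ∑ i ∈ Finset.range (n + 1), block P i v' x := fun n =>
    continuous_finsetSum _ fun _ _ => continuous_block _ _ _
  have cf := hf.continuous
  have cf' : Continuous (deriv f) := hf.continuous_deriv le_rfl
  have cg := hg.continuous
  have cg' : Continuous (deriv g) := hg.continuous_deriv le_rfl
  have df : ∀ x, HasDerivAt f (deriv f x) x := fun x =>
    ((hf.differentiable one_ne_zero) x).hasDerivAt
  have dg : ∀ x, HasDerivAt g (deriv g x) x := fun x =>
    ((hg.differentiable one_ne_zero) x).hasDerivAt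
  have dV : ∀ n x, HasDerivAt (fun x => ∑ i ∈ Finset.range (n + 1), block P i v x)
      (∑ i ∈ Finset.range (n + 1), block P i v' x) x := fun n x =>
    HasDerivAt.fun_sum fun i _ => hasDerivAt_block P i v (hv i) x
  have bV : ∀ n x, ‖∑ i ∈ Finset.range (n + 1), block P i v' x‖ ≤
      D * A₂ * ((2 * y) ^ (n + 1) / (2 * y - 1)) := fun n x => by
    refine (norm_sum_le_of_le _ fun i _ => hv' i x).trans ?_
    rw [← Finset.mul_sum]
    gcongr
    exact sum_range_pow_le_of_one_lt (by linarith) _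
  -- the remainder
  have rem : Tendsto (fun n => ∫ x, φ x • (B (∑ i ∈ Finset.range (n + 1), block P i u x - f x)
      (∑ i ∈ Finset.range (n + 1), block P i v' x) + B (block P (n + 1) u x) (block P n v' x)))
      atTop (𝓝 0) := by
    have cq : ∀ n, Continuous fun x => (B (∑ i ∈ Finset.range (n + 1), block P i u x - f x)
      (∑ i ∈ Finset.range (n + 1), block P i v' x) + B (block P (n + 1) u x) (block P n v' x)) :=
      fun n => (continuous_bilin B ((cS n).sub cf) (cV' n)).add
        (continuous_bilin B (continuous_block _ _ _) (continuous_block _ _ _))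
    -- The rate `2 ^ (-n)` of the approximation of `f` times the size `(2 * y) ^ n` of the sum of
    -- derivatives leaves `y ^ n`; the boundary pair of blocks has the same size.
    have he : Tendsto (fun n : ℕ => (‖B‖ * C * (D * A₂ * (2 * y / (2 * y - 1))) +
        ‖B‖ * C * (D * A₂)) * y ^ n) atTop (𝓝 0) := by
      simpa using (tendsto_pow_atTop_nhds_zero_of_lt_one hy0.le hy1).const_mul
        (‖B‖ * C * (D * A₂ * (2 * y / (2 * y - 1))) + ‖B‖ * C * (D * A₂))
    have h := tendsto_integral_smul_of_uniform (ψ := φ) φ.continuous hφ cq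
      (continuous_const (y := (0 : G))) he (fun x hx n => ?_)
    · simpa using h
    · rw [sub_zero]
      refine (norm_add_le_of_le (norm_bilin_le B (hC x (hR x hx) n).1 (bV n x))
        (norm_bilin_le B (hC x (hR x hx) n).2 (hv' n x))).trans (le_of_eq ?_)
      rw [mul_pow, mul_pow, pow_succ 2, pow_succ y]
      field_simp
  have eg : Tendsto (fun n : ℕ => A₂ * y ^ (n + 1) / (1 - y)) atTop (𝓝 0) := by
    have := ((tendsto_pow_atTop_nhds_zero_of_lt_one hy0.le hy1).comp
      (tendsto_add_atTop_nat 1)).const_mul (A₂ / (1 - y))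
    simp only [mul_zero] at this
    exact this.congr fun n => by simp only [Function.comp]; ring
  have bg : ∀ n x, ‖∑ i ∈ Finset.range (n + 1), block P i v x - g x‖ ≤ A₂ * y ^ (n + 1) / (1 - y) :=
    fun n x => by rw [norm_sub_rev]; exact hsg' x (n + 1)
  have key : ∀ (ψ : ℝ → ℂ), Continuous ψ → HasCompactSupport ψ → ∀ p : ℝ → E, Continuous p →
      Tendsto (fun n => ∫ x, ψ x • B (p x) (∑ i ∈ Finset.range (n + 1), block P i v x)) atTop
        (𝓝 (∫ x, ψ x • B (p x) (g x))) := by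
    intro ψ hψ hψc p hp
    obtain ⟨L, hL⟩ := hψc.exists_bound_of_continuousOn hp.continuousOn
    refine tendsto_integral_smul_of_uniform hψ hψc (fun n => continuous_bilin B hp (cV n))
      (continuous_bilin B hp cg) (e := fun n => ‖B‖ * L * (A₂ * y ^ (n + 1) / (1 - y)))
      (by simpa using eg.const_mul (‖B‖ * L)) fun x hx n => ?_
    rw [← map_sub]
    exact norm_bilin_le B (hL x hx) (bg n x)
  -- Only the partial sums for `v` are known to converge uniformly, not those for `∂v`. Integration
  -- by parts moves the derivative to `φ` and `f`.
  have main : Tendsto (fun n => ∫ x, φ x • B (f x) (∑ i ∈ Finset.range (n + 1), block P i v' x))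
      atTop (𝓝 (∫ x, φ x • B (f x) (deriv g x))) := by
    rw [integral_smul_bilin_eq B φ hφ df cf' dg cg']
    simp only [fun n => integral_smul_bilin_eq B φ hφ df cf' (dV n) (cV' n)]
    exact (key _ (φ.smooth 1 |>.continuous_deriv le_rfl) hφ.deriv f cf).neg.sub
      (key φ φ.continuous hφ _ cf')
  have := rem.add main
  rw [zero_add] at this
  refine this.congr fun n => ?_
  rw [← integral_add (integrable_test_smul φ hφ ?_) (integrable_test_smul φ hφ ?_)]
  · refine integral_congr_ae (Eventually.of_forall fun x => ?_)
    simp only [sum_terms_eq, ← smul_add]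
    rw [map_sub, sub_apply]
    congr 1
    abel
  · exact (continuous_bilin B ((cS n).sub cf) (cV' n)).add
        (continuous_bilin B (continuous_block _ _ _) (continuous_block _ _ _))
  · exact continuous_bilin B cf (cV' n)

theorem isAntiderivative_iff_represents {w : 𝓢'(ℝ, G)} {p : ℝ → G} (hp : Continuous p) :
    IsAntiderivative w (fun t => ∫ r in (0 : ℝ)..t, p r) ↔ Represents w p := by
  have hd := hasDerivAt_integral_zero hp
  refine ⟨fun h φ hφ => ?_, fun h => ⟨continuous_iff_continuousAt.2 fun x => (hd x).continuousAt,
    fun φ hφ => ?_⟩⟩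
  · rw [h.2 φ hφ, integral_test_smul_eq_neg φ hφ hd hp]
  · rw [h φ hφ, integral_test_smul_eq_neg φ hφ hd hp]

/-- For smooth functions `f` and `g` the resonant product is what remains of the product of `f` with
the derivative of `g` when the paraproducts are removed. -/
theorem isResonantProduct_iff_represents (P : DyadicPartition) (B : E →L[ℂ] F →L[ℂ] G)
    {α β A₁ A₂ : ℝ} (hα : α ∈ Set.Ioo (0 : ℝ) 1) (hβ : β ∈ Set.Ioo (0 : ℝ) 1)
    {u : 𝓢'(ℝ, E)} {v : 𝓢'(ℝ, F)} (hu : BlockBound P α A₁ u) (hv : BlockBound P β A₂ v)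
    (hl : IsSeriesSum (lowTerm P B u v) (paraLow P B u (TemperedDistribution.derivCLM F v)))
    (hh : IsSeriesSum (highTerm P B u v) (paraHigh P B u (TemperedDistribution.derivCLM F v)))
    {f : ℝ → E} {g : ℝ → F} (hf : ContDiff ℝ 1 f) (hg : ContDiff ℝ 1 g) (huf : Represents u f)
    (hvg : Represents v g) (w : 𝓢'(ℝ, G)) :
    IsResonantProduct P B u (TemperedDistribution.derivCLM F v) w ↔
      Represents (w + paraLow P B u (TemperedDistribution.derivCLM F v) +
        paraHigh P B u (TemperedDistribution.derivCLM F v)) (fun x => B (f x) (deriv g x)) := by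
  rw [isResonantProduct_iff_isSeriesSum]
  refine forall₂_congr fun φ hφ => ?_
  have h := tendsto_integral_sum_terms P B hα hβ hu hv hf hg huf hvg φ hφ
  have hl' := (hl φ hφ).comp (tendsto_add_atTop_nat 1)
  have hh' := (hh φ hφ).comp (tendsto_add_atTop_nat 1)
  have hs : ∀ n, ∫ x, φ x • ∑ k ∈ Finset.range (n + 1),
      (lowTerm P B u v k x + highTerm P B u v k x + resonantTerm P B u v k x) =
      ∑ k ∈ Finset.range (n + 1), (∫ x, φ x • lowTerm P B u v k x) +
      ∑ k ∈ Finset.range (n + 1), (∫ x, φ x • highTerm P B u v k x) +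
      ∑ k ∈ Finset.range (n + 1), (∫ x, φ x • resonantTerm P B u v k x) := fun n => by
    have i₁ := fun k => integrable_test_smul φ hφ (continuous_lowTerm P B u v k)
    have i₂ := fun k => integrable_test_smul φ hφ (continuous_highTerm P B u v k)
    have i₃ := fun k => integrable_test_smul φ hφ (continuous_resonantTerm P B u v k)
    rw [← Finset.sum_add_distrib, ← Finset.sum_add_distrib]
    simp only [Finset.smul_sum, smul_add]
    refine (integral_finsetSum (Finset.range (n + 1))
      fun k _ => ((i₁ k).add (i₂ k)).add (i₃ k)).trans (Finset.sum_congr rfl fun k _ => ?_)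
    rw [integral_add' ((i₁ k).add (i₂ k)) (i₃ k), integral_add' (i₁ k) (i₂ k)]
  rw [← tendsto_add_atTop_iff_nat 1]
  change _ ↔ w φ + paraLow P B u (TemperedDistribution.derivCLM F v) φ +
    paraHigh P B u (TemperedDistribution.derivCLM F v) φ = _
  -- Against `φ` the full decomposition and both paraproduct series converge, so the resonant sums
  -- converge to a value exactly when it is the difference of these limits.
  constructor
  · intro hr
    refine tendsto_nhds_unique ((hl'.add hh').add hr) (h.congr fun n => ?_) ▸ ?_
    · exact hs n
    · abel
  · intro hr
    have h1 := (h.sub hl').sub hh'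
    rw [← hr] at h1
    convert h1 using 2 with n
    · simp only [hs, Function.comp]
      abel
    · abel

theorem iteratedIntegral_eq (B : E →L[ℂ] F →L[ℂ] G) {f : ℝ → E} {g : ℝ → F} (hf : ContDiff ℝ 1 f)
    (hg : ContDiff ℝ 1 g) (s t : ℝ) : iteratedIntegral B f g s t =
      (∫ r in s..t, B (f r) (deriv g r)) - B (f s) (g t - g s) := by
  have cf' : Continuous (deriv f) := hf.continuous_deriv le_rfl
  have cg' : Continuous (deriv g) := hg.continuous_deriv le_rfl
  have h1 : ∀ r, ∫ x in s..r, deriv f x = f r - f s := fun r =>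
    intervalIntegral.integral_deriv_eq_sub (fun x _ => (hf.differentiable one_ne_zero) x)
      (cf'.intervalIntegrable _ _)
  have h2 : ∫ x in s..t, deriv g x = g t - g s :=
    intervalIntegral.integral_deriv_eq_sub (fun x _ => (hg.differentiable one_ne_zero) x)
      (cg'.intervalIntegrable _ _)
  simp only [iteratedIntegral, h1, map_sub, sub_apply]
  rw [intervalIntegral.integral_sub
    ((continuous_bilin B hf.continuous cg').intervalIntegrable _ _)
    ((continuous_bilin B continuous_const cg').intervalIntegrable _ _), ← map_sub, ← h2,
    ContinuousLinearMap.intervalIntegral_comp_comm _ (cg'.intervalIntegrable _ _)]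

theorem area_eq_iteratedIntegral (P : DyadicPartition) (B : E →L[ℂ] F →L[ℂ] G)
    {f : ℝ → E} {g : ℝ → F} (hf : ContDiff ℝ 1 f) (hg : ContDiff ℝ 1 g) {u : 𝓢'(ℝ, E)}
    {v : 𝓢'(ℝ, F)} (huf : Represents u f) (hvg : Represents v g) {w : 𝓢'(ℝ, G)}
    (hw : Represents (w + paraLow P B u (TemperedDistribution.derivCLM F v) +
        paraHigh P B u (TemperedDistribution.derivCLM F v)) (fun x => B (f x) (deriv g x)))
    (s t : ℝ) : area P B u v w s t = iteratedIntegral B f g s t := by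
  have hp : Continuous fun x => B (f x) (deriv g x) :=
    continuous_bilin B hf.continuous (hg.continuous_deriv le_rfl)
  rw [area, ((isAntiderivative_iff_represents hp).2 hw).distIntegral_eq,
    huf.toContinuousFun_eq hf.continuous, hvg.toContinuousFun_eq hg.continuous,
    iteratedIntegral_eq B hf hg, intervalIntegral.integral_interval_sub_left
      (hp.intervalIntegrable _ _) (hp.intervalIntegrable _ _)]

end Smooth

/-! ### From Hölder increments to block bounds -/

section Increments

variable {E : Type*} [NormedAddCommGroup E]

/-- A function with increments of size `a` over distances at most `ℓ` has linear growth. -/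
theorem norm_sub_le_of_increments {U : ℝ → E} {ℓ a : ℝ} (hℓ : 0 < ℓ)
    (h : ∀ s t, |t - s| ≤ ℓ → ‖U t - U s‖ ≤ a) (s t : ℝ) :
    ‖U t - U s‖ ≤ a * (1 + |t - s| / ℓ) := by
  have ha : 0 ≤ a := (norm_nonneg _).trans (h 0 0 (by simpa using hℓ.le))
  -- The interval is cut into `n` equal steps of length at most `ℓ`; afterwards `n` is the ceiling
  -- of `|t - s| / ℓ`.
  have key : ∀ n : ℕ, ∀ s t, |t - s| ≤ n * ℓ → ‖U t - U s‖ ≤ n * a := by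
    intro n
    induction n with
    | zero =>
      intro s t hst
      have : t = s := by
        have := abs_nonpos_iff.1 (by simpa using hst : |t - s| ≤ 0)
        linarith
      simp [this]
    | succ n ih =>
      intro s t hst
      have hn : (0 : ℝ) < (n : ℝ) + 1 := by positivity
      push_cast at hst ⊢
      have h1 := h s (s + (t - s) / (n + 1)) (by
        rw [add_sub_cancel_left, abs_div, abs_of_pos hn, div_le_iff₀ hn]
        linarith)
      have h2 := ih (s + (t - s) / (n + 1)) t (by
        rw [show t - (s + (t - s) / (n + 1)) = (t - s) * (n / (n + 1)) by field_simp; ring, abs_mul,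
          abs_of_nonneg (by positivity : (0 : ℝ) ≤ n / (n + 1))]
        calc _ ≤ ((n + 1) * ℓ) * (n / (n + 1)) := by gcongr
          _ = _ := by field_simp)
      calc _ = ‖(U t - U (s + (t - s) / (n + 1))) + (U (s + (t - s) / (n + 1)) - U s)‖ := by
            rw [sub_add_sub_cancel]
        _ ≤ n * a + a := norm_add_le_of_le h2 h1
        _ = _ := by ring
  have h0 : 0 ≤ |t - s| / ℓ := by positivity
  refine (key ⌈|t - s| / ℓ⌉₊ s t ?_).trans ?_
  · rw [← div_le_iff₀ hℓ]
    exact Nat.le_ceil _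
  · rw [mul_comm]
    gcongr
    linarith [Nat.ceil_lt_add_one h0]

variable [NormedSpace ℂ E] [CompleteSpace E]

/-- The derivative of a function that is locally Hölder continuous with exponent `γ`, uniformly, has
blocks of order `γ - 1`. -/
theorem exists_blockBound_of_increments (P : DyadicPartition) {γ : ℝ} (h0 : 0 < γ) (h1 : γ < 1) :
    ∃ C : ℝ, 0 ≤ C ∧ ∀ (U : ℝ → E) (δ : ℝ), Continuous U → 0 ≤ δ →
      (∀ s t, s ≠ t → |t - s| ≤ 1 → ‖U t - U s‖ ≤ δ * |t - s| ^ γ) →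
      ∃ w : 𝓢'(ℝ, E), IsAntiderivative w U ∧ BlockBound P (γ - 1) (C * δ) w := by
  obtain ⟨hx, -⟩ := two_rpow_neg_bounds h0 h1
  set K := SchwartzMap.derivCLM ℂ ℂ (P.kernel 0)
  set I := ∫ x : ℝ, (1 + |x|) * ‖K x‖
  have hI : 0 ≤ I := integral_nonneg fun y => by positivity
  refine ⟨2 * I, by positivity, fun U δ hU hδ h => ?_⟩
  set x := (2 : ℝ) ^ (-γ) with hxdef
  have hx0 : 0 < x := by linarith
  -- The Hölder bound at scale `2 ^ (-n)` is chained to all distances, at the price of a linear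
  -- factor that the kernel at this scale can integrate.
  have hinc : ∀ (n : ℕ) s t, ‖U t - U s‖ ≤ δ * x ^ n * (1 + 2 ^ n * |t - s|) := by
    intro n s t
    have h2 : ∀ s t, |t - s| ≤ ((2 : ℝ) ^ n)⁻¹ → ‖U t - U s‖ ≤ δ * x ^ n := by
      intro s t hst
      rcases eq_or_ne s t with rfl | hne
      · simp only [sub_self, norm_zero]
        positivity
      · refine (h s t hne (hst.trans (inv_le_one_of_one_le₀ (one_le_pow₀ one_le_two)))).trans ?_
        gcongr
        calc _ ≤ (((2 : ℝ) ^ n)⁻¹) ^ γ := by gcongr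
          _ = x ^ n := by
            rw [hxdef, Real.rpow_neg zero_le_two, inv_pow, Real.inv_rpow (by positivity),
              Real.rpow_pow_comm zero_le_two]
    refine (norm_sub_le_of_increments (by positivity) h2 s t).trans (le_of_eq ?_)
    rw [div_inv_eq_mul, mul_comm (|t - s|)]
  have hgrowth : ∀ t, ‖U t‖ ≤ (δ + ‖U 0‖) * (1 + |t|) := fun t => by
    have h3 := hinc 0 0 t
    simp only [pow_zero, mul_one, one_mul, sub_zero] at h3
    calc _ = ‖(U t - U 0) + U 0‖ := by rw [sub_add_cancel]
      _ ≤ δ * (1 + |t|) + ‖U 0‖ * 1 := by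
        rw [mul_one]
        exact norm_add_le_of_le h3 le_rfl
      _ ≤ δ * (1 + |t|) + ‖U 0‖ * (1 + |t|) := by
        gcongr
        simp
      _ = _ := by ring
  obtain ⟨S, hS⟩ := exists_distribution_of_growth hU hgrowth
  have hsm : ∀ n t, ‖smear (TemperedDistribution.derivCLM E S) (dilation n (P.kernel 0)) t‖ ≤
      I * δ * (2 * x) ^ n := by
    intro n t
    have e1 : smear S (dilation n K) t = convolve (dilation n K) U t := by
      rw [smear, hS, convolve_eq]
      simp only [reflAt_apply]
    -- The kernel is a derivative and has mean zero, so `U t` may be subtracted and only increments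
    -- of `U` enter.
    have e2 : ∫ y, dilation n K y = 0 := by
      have h4 := fourier_dilation n K 0
      rw [SchwartzMap.fourier_coe, Real.fourier_real_eq, zero_div, fourier_derivCLM] at h4
      simpa using h4
    have e3 : convolve (dilation n K) U t = ∫ y, dilation n K y • (U (t - y) - U t) := by
      simp only [smul_sub]
      rw [integral_sub, integral_smul_const, e2, zero_smul, sub_zero, convolve]
      · refine integrable_smul_of_growth (C := (δ + ‖U 0‖) * (1 + |t|)) _ (by fun_prop) fun y =>
          (hgrowth _).trans ?_
        rw [mul_assoc]
        gcongr
        nlinarith [abs_sub t y, abs_nonneg t, abs_nonneg y, mul_nonneg (abs_nonneg t) (abs_nonneg y)]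
      · exact (dilation n K).integrable.smul_const _
    rw [smear_derivCLM, derivCLM_dilation]
    have e4 : smear S ((2 ^ n : ℝ) • dilation n K) t = (2 ^ n : ℂ) • smear S (dilation n K) t := by
      have : reflAt ((2 ^ n : ℝ) • dilation n K) t = (2 ^ n : ℂ) • reflAt (dilation n K) t := by
        ext y
        simp
      rw [smear, this, map_smul, smear]
    have hd : Integrable fun y => ((1 + |2 ^ n * y|) * ‖dilation n K y‖) := by
      refine ((integrable_weight_mul (dilation n K)).const_mul (2 ^ n)).mono'
        (by fun_prop) (Eventually.of_forall fun y => ?_)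
      rw [Real.norm_of_nonneg (by positivity), abs_mul, abs_of_pos (by positivity : (0 : ℝ) < 2 ^ n),
        ← mul_assoc]
      gcongr
      nlinarith [one_le_pow₀ (one_le_two (α := ℝ)) (n := n)]
    have e5 : ‖∫ y, dilation n K y • (U (t - y) - U t)‖ ≤ δ * x ^ n * I := by
      simp only [I]
      rw [← integral_dilation_eq n K fun z => 1 + |z|, ← integral_const_mul]
      refine norm_integral_le_of_norm_le (hd.const_mul _) (Eventually.of_forall fun y => ?_)
      rw [norm_smul]
      have h5 := hinc n t (t - y)
      rw [show t - y - t = -y by ring, abs_neg] at h5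
      calc _ ≤ ‖dilation n K y‖ * (δ * x ^ n * (1 + 2 ^ n * |y|)) := by gcongr
        _ = _ := by
          rw [abs_mul, abs_of_pos (by positivity : (0 : ℝ) < 2 ^ n)]
          ring
    rw [e4, e1, e3, norm_smul, norm_pow, Complex.norm_ofNat, mul_pow]
    calc _ ≤ 2 ^ n * (δ * x ^ n * I) := by gcongr
      _ = _ := by ring
  refine ⟨TemperedDistribution.derivCLM E S, ⟨hU, fun φ _ => ?_⟩, fun j t => ?_⟩
  · rw [TemperedDistribution.derivCLM_apply_apply, map_neg, hS]
    rfl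
  · rw [two_rpow_neg_sub_one, ← hxdef]
    cases j with
    | zero =>
      have h6 := hsm 0 t
      rw [smear_dilation_kernel_zero] at h6
      simp only [zero_add, Finset.sum_range_one] at h6
      refine h6.trans ?_
      have : 0 ≤ I * δ := by positivity
      simp only [pow_zero]
      linarith
    | succ n =>
      have h7 := hsm n t
      have h8 := hsm (n + 1) t
      rw [smear_dilation_kernel_zero] at h7 h8
      set T := TemperedDistribution.derivCLM E S
      -- A block is the difference of two consecutive low-frequency truncations, whence the factor 2
      -- in the constant.
      have h9 : block P (n + 1) T t = ∑ k ∈ Finset.range (n + 1 + 1), block P k T t -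
          ∑ k ∈ Finset.range (n + 1), block P k T t := by
        rw [Finset.sum_range_succ _ (n + 1)]
        abel
      rw [h9]
      have h10 : (2 * x) ^ n ≤ (2 * x) ^ (n + 1) := pow_le_pow_right₀ (by linarith) (by omega)
      calc _ ≤ I * δ * (2 * x) ^ (n + 1) + I * δ * (2 * x) ^ n := norm_sub_le_of_le h8 h7
        _ ≤ I * δ * (2 * x) ^ (n + 1) + I * δ * (2 * x) ^ (n + 1) := by gcongr
        _ = _ := by ring

end Increments

/-! ### Joint continuity of the paraproducts -/

section Continuity

variable {E F G : Type*} [NormedAddCommGroup E] [NormedSpace ℂ E]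
  [NormedAddCommGroup F] [NormedSpace ℂ F] [NormedAddCommGroup G] [NormedSpace ℂ G]

theorem BlockBound.add {P : DyadicPartition} {γ A A' : ℝ} {T S : 𝓢'(ℝ, E)}
    (hT : BlockBound P γ A T) (hS : BlockBound P γ A' S) : BlockBound P γ (A + A') (T + S) :=
  fun j x => by
    rw [block_add, add_mul]
    exact norm_add_le_of_le (hT j x) (hS j x)

theorem BlockBound.sub_comm {P : DyadicPartition} {γ A : ℝ} {T S : 𝓢'(ℝ, E)}
    (h : BlockBound P γ A (T - S)) : BlockBound P γ A (S - T) :=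
  fun j x => by
    rw [block_sub, norm_sub_rev, ← block_sub]
    exact h j x

theorem IsSeriesSum.sub {p q : ℕ → ℝ → G} {T S : 𝓢'(ℝ, G)} (hp : ∀ k, Continuous (p k))
    (hq : ∀ k, Continuous (q k)) (hT : IsSeriesSum p T) (hS : IsSeriesSum q S) :
    IsSeriesSum (fun k x => p k x - q k x) (T - S) := fun φ hφ => by
  refine ((hT φ hφ).sub (hS φ hφ)).congr fun n => ?_
  rw [← Finset.sum_sub_distrib]
  refine Finset.sum_congr rfl fun k _ => ?_
  rw [← integral_sub (integrable_test_smul φ hφ (hp k)) (integrable_test_smul φ hφ (hq k))]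
  simp only [smul_sub]

theorem lowTerm_sub_left (P : DyadicPartition) (B : E →L[ℂ] F →L[ℂ] G) (u₁ u₂ : 𝓢'(ℝ, E))
    (v : 𝓢'(ℝ, F)) (k : ℕ) (r : ℝ) :
    lowTerm P B (u₁ - u₂) v k r = lowTerm P B u₁ v k r - lowTerm P B u₂ v k r := by
  simp only [lowTerm, ← Finset.sum_sub_distrib, block_sub, map_sub, sub_apply]

theorem lowTerm_sub_right (P : DyadicPartition) (B : E →L[ℂ] F →L[ℂ] G) (u : 𝓢'(ℝ, E))
    (v₁ v₂ : 𝓢'(ℝ, F)) (k : ℕ) (r : ℝ) :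
    lowTerm P B u (v₁ - v₂) k r = lowTerm P B u v₁ k r - lowTerm P B u v₂ k r := by
  simp only [lowTerm, ← Finset.sum_sub_distrib, block_sub, map_sub]

theorem highTerm_sub_left (P : DyadicPartition) (B : E →L[ℂ] F →L[ℂ] G) (u₁ u₂ : 𝓢'(ℝ, E))
    (v : 𝓢'(ℝ, F)) (k : ℕ) (r : ℝ) :
    highTerm P B (u₁ - u₂) v k r = highTerm P B u₁ v k r - highTerm P B u₂ v k r := by
  simp only [highTerm, ← Finset.sum_sub_distrib, block_sub, map_sub, sub_apply]

theorem highTerm_sub_right (P : DyadicPartition) (B : E →L[ℂ] F →L[ℂ] G) (u : 𝓢'(ℝ, E))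
    (v₁ v₂ : 𝓢'(ℝ, F)) (k : ℕ) (r : ℝ) :
    highTerm P B u (v₁ - v₂) k r = highTerm P B u v₁ k r - highTerm P B u v₂ k r := by
  simp only [highTerm, ← Finset.sum_sub_distrib, block_sub, map_sub]

variable [CompleteSpace E] [CompleteSpace F] [CompleteSpace G]

/-- Joint continuity of the paraproducts, minus the leading term of their integrals. -/
theorem exists_paraproduct_sub_antiderivative (P : DyadicPartition) (B : E →L[ℂ] F →L[ℂ] G)
    {α β : ℝ} (hα : 0 < α) (hβ : 0 < β) (hαβ : α + β < 1) : ∃ C : ℝ, 0 ≤ C ∧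
    ∀ (u₁ u₂ : 𝓢'(ℝ, E)) (v₁ v₂ : 𝓢'(ℝ, F)) (A₁ A₂ δ₁ δ₂ : ℝ) (f₁ f₂ : ℝ → E) (g₁ g₂ : ℝ → F),
      BlockBound P α δ₁ (u₁ - u₂) → BlockBound P α A₁ u₁ →
      BlockBound P β δ₂ (v₁ - v₂) → BlockBound P β A₂ v₁ →
      Continuous f₁ → Continuous f₂ → Continuous g₁ → Continuous g₂ →
      Represents u₁ f₁ → Represents u₂ f₂ → Represents v₁ g₁ → Represents v₂ g₂ →
      ∃ Q : ℝ → G, IsAntiderivative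
        ((paraLow P B u₁ (TemperedDistribution.derivCLM F v₁) +
          paraHigh P B u₁ (TemperedDistribution.derivCLM F v₁)) -
        (paraLow P B u₂ (TemperedDistribution.derivCLM F v₂) +
          paraHigh P B u₂ (TemperedDistribution.derivCLM F v₂))) Q ∧
        ∀ s t, s ≠ t → |t - s| ≤ 1 →
          ‖(Q t - Q s) - (B (f₁ s) (g₁ t - g₁ s) - B (f₂ s) (g₂ t - g₂ s))‖ ≤
            C * (δ₁ * A₂ + (A₁ + δ₁) * δ₂) * |t - s| ^ (α + β) := by
  obtain ⟨C, hC, h⟩ := exists_paraproduct_antiderivative P B hα hβ hαβ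
  refine ⟨C, hC, fun u₁ u₂ v₁ v₂ A₁ A₂ δ₁ δ₂ f₁ f₂ g₁ g₂ hδ₁ hu₁ hδ₂ hv₁ cf₁ cf₂ cg₁ cg₂
    hf₁ hf₂ hg₁ hg₂ => ?_⟩
  have hu₂ : BlockBound P α (A₁ + δ₁) u₂ := by
    simpa using hu₁.add hδ₁.sub_comm
  have hv₂ : BlockBound P β (A₂ + δ₂) v₂ := by
    simpa using hv₁.add hδ₂.sub_comm
  obtain ⟨-, -, l11, h11, -⟩ := h u₁ v₁ A₁ A₂ hu₁ hv₁
  obtain ⟨-, -, l22, h22, -⟩ := h u₂ v₂ _ _ hu₂ hv₂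
  obtain ⟨-, -, l21, h21, -⟩ := h u₂ v₁ _ _ hu₂ hv₁
  obtain ⟨Q₁, Q₂, ld1, hd1, i1, i2, b1⟩ := h (u₁ - u₂) v₁ _ _ hδ₁ hv₁
  obtain ⟨Q₃, Q₄, ld2, hd2, i3, i4, b2⟩ := h u₂ (v₁ - v₂) _ _ hu₂ hδ₂
  -- The paraproducts are chosen limits, so their bilinearity comes from linearity of the terms and
  -- uniqueness of sums. The difference is split as `(u₁ - u₂, v₁)` plus `(u₂, v₁ - v₂)`.
  have e1 := (l11.sub (continuous_lowTerm P B _ _) (continuous_lowTerm P B _ _) l21).unique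
    (by simpa only [← lowTerm_sub_left] using ld1)
  have e2 := (h11.sub (continuous_highTerm P B _ _) (continuous_highTerm P B _ _) h21).unique
    (by simpa only [← highTerm_sub_left] using hd1)
  have e3 := (l21.sub (continuous_lowTerm P B _ _) (continuous_lowTerm P B _ _) l22).unique
    (by simpa only [← lowTerm_sub_right] using ld2)
  have e4 := (h21.sub (continuous_highTerm P B _ _) (continuous_highTerm P B _ _) h22).unique
    (by simpa only [← highTerm_sub_right] using hd2)
  have hs1 := (hasSum_block_of_represents P hα hu₁ cf₁ hf₁).1
  have hs2 := (hasSum_block_of_represents P hα hu₂ cf₂ hf₂).1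
  have hs3 := (hasSum_block_of_represents P hβ hv₁ cg₁ hg₁).1
  have hs4 := (hasSum_block_of_represents P hβ hv₂ cg₂ hg₂).1
  refine ⟨fun t => ((Q₁ t + Q₂ t) + (Q₃ t + Q₄ t)), ?_, fun s t hst hst1 => ?_⟩
  · have := (i1.add i2).add (i3.add i4)
    rw [← e1, ← e2, ← e3, ← e4] at this
    convert this using 1
    abel
  · have c1 := b1 (fun t => f₁ t - f₂ t) g₁ (fun t => (hs1 t).sub (hs2 t)) hs3 s t hst hst1
    have c2 := b2 f₂ (fun t => g₁ t - g₂ t) hs2 (fun t => (hs3 t).sub (hs4 t)) s t hst hst1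
    have c3 := norm_add_le_of_le c1 c2
    refine le_trans (le_of_eq ?_) (c3.trans (le_of_eq (by ring)))
    congr 1
    simp only [map_sub, sub_apply]
    abel

end Continuity

/-! ### The two quantitative implications and the theorem -/

section Convergence

theorem localHolderNorm_le_ofReal_iff {κ L : ℝ} (hL : 0 ≤ L) {G : Type*} [NormedAddCommGroup G]
    {A : ℝ → ℝ → G} :
    localHolderNorm κ A ≤ ENNReal.ofReal L ↔
      ∀ s t, s ≠ t → |t - s| ≤ 1 → ‖A s t‖ ≤ L * |t - s| ^ κ := by
  simp only [localHolderNorm, iSup_le_iff]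
  refine forall₄_congr fun s t hst _ => ?_
  have : 0 < |t - s| := abs_pos.2 (sub_ne_zero.2 hst.symm)
  rw [ENNReal.ofReal_le_ofReal_iff hL, div_le_iff₀ (by positivity)]

variable {E F G : Type*} [NormedAddCommGroup E] [NormedSpace ℂ E]
  [NormedAddCommGroup F] [NormedSpace ℂ F] [NormedAddCommGroup G] [NormedSpace ℂ G]

theorem blockBound_of_besovNorm_lt_top {P : DyadicPartition} {γ : ℝ} (hγ : γ ≤ 1)
    {T : 𝓢'(ℝ, E)} (h : besovNorm P γ T < ⊤) : BlockBound P γ (2 * (besovNorm P γ T).toReal) T :=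
  blockBound_of_besovNorm_le (ENNReal.ofReal_toReal h.ne).ge hγ ENNReal.toReal_nonneg

theorem exists_blockBound_of_tendsto {P : DyadicPartition} {γ : ℝ} (hγ : γ ≤ 1) {T : 𝓢'(ℝ, E)}
    {W : ℝ → 𝓢'(ℝ, E)} {l : Filter ℝ} (h : Tendsto (fun ε => besovNorm P γ (W ε - T)) l (𝓝 0)) :
    ∃ δ : ℝ → ℝ, Tendsto δ l (𝓝 0) ∧ ∀ᶠ ε in l, BlockBound P γ (δ ε) (W ε - T) := by
  refine ⟨fun ε => 2 * (besovNorm P γ (W ε - T)).toReal, ?_, ?_⟩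
  · have := ((ENNReal.tendsto_toReal ENNReal.zero_ne_top).comp h).const_mul 2
    simpa [Function.comp_def] using this
  · filter_upwards [h.eventually (gt_mem_nhds ENNReal.zero_lt_top)] with ε hε
    exact blockBound_of_besovNorm_lt_top hγ hε

theorem Represents.unique {T S : 𝓢'(ℝ, E)} {f : ℝ → E} (hT : Represents T f)
    (hS : Represents S f) : T = S :=
  distribution_ext fun φ hφ => (hT φ hφ).trans (hS φ hφ).symm

variable [CompleteSpace E] [CompleteSpace F] [CompleteSpace G]

/-- The area depends continuously on the functions and on their resonant product. -/
theorem exists_norm_area_sub_iteratedIntegral_le (P : DyadicPartition) (B : E →L[ℂ] F →L[ℂ] G)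
    {α β : ℝ} (hα : α ∈ Set.Ioo (0 : ℝ) 1) (hβ : β ∈ Set.Ioo (0 : ℝ) 1) (hαβ : α + β < 1) :
    ∃ C : ℝ, 0 ≤ C ∧ ∀ (u u' : 𝓢'(ℝ, E)) (v v' : 𝓢'(ℝ, F)) (η w : 𝓢'(ℝ, G))
      (A₁ A₂ δ₁ δ₂ δ₃ : ℝ) (f : ℝ → E) (g : ℝ → F),
      BlockBound P α A₁ u → BlockBound P β A₂ v → BlockBound P α δ₁ (u' - u) →
      BlockBound P β δ₂ (v' - v) → BlockBound P (α + β - 1) δ₃ (w - η) →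
      ContDiff ℝ 1 f → ContDiff ℝ 1 g → Represents u' f → Represents v' g →
      IsResonantProduct P B u' (TemperedDistribution.derivCLM F v') w →
      ∀ s t, s ≠ t → |t - s| ≤ 1 → ‖area P B u v η s t - iteratedIntegral B f g s t‖ ≤
        C * (δ₁ * A₂ + (A₁ + δ₁) * δ₂ + δ₃) * |t - s| ^ (α + β) := by
  obtain ⟨C₁, hC₁, h₁⟩ := exists_paraproduct_sub_antiderivative P B hα.1 hβ.1 hαβ
  obtain ⟨C₂, hC₂, h₂⟩ := exists_isAntiderivative_of_blockBound (E := G) P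
    (add_pos hα.1 hβ.1) hαβ
  obtain ⟨_, _, h₃⟩ := exists_paraproduct_antiderivative P B hα.1 hβ.1 hαβ
  refine ⟨C₁ + C₂, by positivity, fun u u' v v' η w A₁ A₂ δ₁ δ₂ δ₃ f g hu hv hδ₁ hδ₂ hδ₃ hf hg
    hu'f hv'g hw s t hst hst1 => ?_⟩
  have hu' : BlockBound P α (A₁ + δ₁) u' := by simpa using hu.add hδ₁
  have hv' : BlockBound P β (A₂ + δ₂) v' := by simpa using hv.add hδ₂
  obtain ⟨fu, cfu, rfu, -⟩ := exists_represents_of_blockBound P hα.1 hu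
  obtain ⟨gv, cgv, rgv, -⟩ := exists_represents_of_blockBound P hβ.1 hv
  obtain ⟨Q, hQ, bQ⟩ := h₁ u u' v v' A₁ A₂ δ₁ δ₂ fu f gv g hδ₁.sub_comm hu hδ₂.sub_comm hv cfu
    hf.continuous cgv hg.continuous rfu hu'f rgv hv'g
  obtain ⟨N, hN, bN⟩ := h₂ (η - w) δ₃ hδ₃.sub_comm
  obtain ⟨-, -, hl, hh, -⟩ := h₃ u' v' _ _ hu' hv'
  rw [isResonantProduct_iff_represents P B hα hβ hu' hv' hl hh hf hg hu'f hv'g] at hw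
  have hp : Continuous fun x => B (f x) (deriv g x) :=
    continuous_bilin B hf.continuous (hg.continuous_deriv le_rfl)
  have hI := (isAntiderivative_iff_represents hp).2 hw
  have hJ := (hI.add hN).add hQ
  -- The distribution in the area of `(u, v, η)` is that of the smooth triple plus `η - w` plus the
  -- difference of the paraproducts; their antiderivatives are `I`, `N` and `Q`.
  rw [show w + paraLow P B u' (TemperedDistribution.derivCLM F v') +
    paraHigh P B u' (TemperedDistribution.derivCLM F v') + (η - w) +
    ((paraLow P B u (TemperedDistribution.derivCLM F v) +
          paraHigh P B u (TemperedDistribution.derivCLM F v)) -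
        (paraLow P B u' (TemperedDistribution.derivCLM F v') +
          paraHigh P B u' (TemperedDistribution.derivCLM F v'))) =
    η + paraLow P B u (TemperedDistribution.derivCLM F v) +
      paraHigh P B u (TemperedDistribution.derivCLM F v) by abel] at hJ
  rw [← area_eq_iteratedIntegral P B hf hg hu'f hv'g hw s t, area, area, hJ.distIntegral_eq,
    hI.distIntegral_eq, rfu.toContinuousFun_eq cfu, rgv.toContinuousFun_eq cgv,
    hu'f.toContinuousFun_eq hf.continuous, hv'g.toContinuousFun_eq hg.continuous]
  have c := norm_add_le_of_le (bQ s t hst hst1) (bN s t hst hst1)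
  have hδ₁0 := hδ₁.nonneg
  have hδ₂0 := hδ₂.nonneg
  have hδ₃0 := hδ₃.nonneg
  have hA₁ := hu.nonneg
  have hA₂ := hv.nonneg
  calc _ ≤ C₁ * (δ₁ * A₂ + (A₁ + δ₁) * δ₂) * |t - s| ^ (α + β) + C₂ * δ₃ * |t - s| ^ (α + β) := by
        refine le_trans (le_of_eq ?_) c
        congr 1
        abel
    _ ≤ C₁ * (δ₁ * A₂ + (A₁ + δ₁) * δ₂ + δ₃) * |t - s| ^ (α + β) +
        C₂ * (δ₁ * A₂ + (A₁ + δ₁) * δ₂ + δ₃) * |t - s| ^ (α + β) := by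
        have : 0 ≤ δ₁ * A₂ + (A₁ + δ₁) * δ₂ := by positivity
        refine add_le_add (mul_le_mul_of_nonneg_right (mul_le_mul_of_nonneg_left ?_ hC₁) ?_)
          (mul_le_mul_of_nonneg_right (mul_le_mul_of_nonneg_left ?_ hC₂) ?_)
        · linarith
        · positivity
        · linarith
        · positivity
    _ = _ := by ring

/-- The resonant product depends continuously on the functions and on their area. -/
theorem exists_isResonantProduct_of_area (P : DyadicPartition) (B : E →L[ℂ] F →L[ℂ] G)
    {α β : ℝ} (hα : α ∈ Set.Ioo (0 : ℝ) 1) (hβ : β ∈ Set.Ioo (0 : ℝ) 1) (hαβ : α + β < 1) :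
    ∃ C : ℝ, 0 ≤ C ∧ ∀ (u u' : 𝓢'(ℝ, E)) (v v' : 𝓢'(ℝ, F)) (η : 𝓢'(ℝ, G))
      (A₁ A₂ A₃ δ₁ δ₂ L : ℝ) (f : ℝ → E) (g : ℝ → F),
      BlockBound P α A₁ u → BlockBound P β A₂ v → BlockBound P (α + β - 1) A₃ η →
      BlockBound P α δ₁ (u' - u) → BlockBound P β δ₂ (v' - v) → 0 ≤ L →
      ContDiff ℝ 1 f → ContDiff ℝ 1 g → Represents u' f → Represents v' g →
      (∀ s t, s ≠ t → |t - s| ≤ 1 →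
        ‖area P B u v η s t - iteratedIntegral B f g s t‖ ≤ L * |t - s| ^ (α + β)) →
      ∃ w, IsResonantProduct P B u' (TemperedDistribution.derivCLM F v') w ∧
        BlockBound P (α + β - 1) (C * (δ₁ * A₂ + (A₁ + δ₁) * δ₂) + C * L) (w - η) := by
  obtain ⟨C₁, hC₁, h₁⟩ := exists_paraproduct_sub_antiderivative P B hα.1 hβ.1 hαβ
  obtain ⟨_, _, h₂⟩ := exists_isAntiderivative_of_blockBound (E := G) P (add_pos hα.1 hβ.1) hαβ
  obtain ⟨_, _, h₃⟩ := exists_paraproduct_antiderivative P B hα.1 hβ.1 hαβ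
  obtain ⟨C₄, hC₄, h₄⟩ := exists_blockBound_of_increments (E := G) P (add_pos hα.1 hβ.1) hαβ
  refine ⟨C₄ * (C₁ + 1), by positivity, fun u u' v v' η A₁ A₂ A₃ δ₁ δ₂ L f g hu hv hη hδ₁ hδ₂ hL
    hf hg hu'f hv'g harea => ?_⟩
  have hu' : BlockBound P α (A₁ + δ₁) u' := by simpa using hu.add hδ₁
  have hv' : BlockBound P β (A₂ + δ₂) v' := by simpa using hv.add hδ₂
  obtain ⟨fu, cfu, rfu, -⟩ := exists_represents_of_blockBound P hα.1 hu
  obtain ⟨gv, cgv, rgv, -⟩ := exists_represents_of_blockBound P hβ.1 hv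
  obtain ⟨Q, hQ, bQ⟩ := h₁ u u' v v' A₁ A₂ δ₁ δ₂ fu f gv g hδ₁.sub_comm hu hδ₂.sub_comm hv cfu
    hf.continuous cgv hg.continuous rfu hu'f rgv hv'g
  -- Antiderivatives of `η` and of both paraproducts ensure that `distIntegral` in `area` does not
  -- take its default value.
  obtain ⟨N₀, hN₀, -⟩ := h₂ η A₃ hη
  obtain ⟨Q₁, Q₂, -, -, hQ₁, hQ₂, -⟩ := h₃ u v _ _ hu hv
  obtain ⟨-, -, hl, hh, -⟩ := h₃ u' v' _ _ hu' hv'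
  have hJ := (hN₀.add hQ₁).add hQ₂
  have hp : Continuous fun x => B (f x) (deriv g x) :=
    continuous_bilin B hf.continuous (hg.continuous_deriv le_rfl)
  set J : ℝ → G := fun t => N₀ t + Q₁ t + Q₂ t
  set I : ℝ → G := fun t => ∫ r in (0 : ℝ)..t, B (f r) (deriv g r)
  have hI : ∀ s t, ∫ r in s..t, B (f r) (deriv g r) = I t - I s := fun s t =>
    (intervalIntegral.integral_interval_sub_left
      (hp.intervalIntegrable _ _) (hp.intervalIntegrable _ _)).symm
  have cI : Continuous I :=
    continuous_iff_continuousAt.2 fun x => (hasDerivAt_integral_zero hp x).continuousAt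
  have hδ₁0 := hδ₁.nonneg
  have hδ₂0 := hδ₂.nonneg
  have hA₁ := hu.nonneg
  have hA₂ := hv.nonneg
  set D := δ₁ * A₂ + (A₁ + δ₁) * δ₂
  have hD : 0 ≤ D := by positivity
  -- The increments of `J - I - Q` are the area difference minus the paraproduct remainder, both of
  -- order `α + β` with small constants. Its derivative `w'` is what separates `η` from the resonant
  -- product.
  obtain ⟨w', hw', bw'⟩ := h₄ (fun t => J t - I t - Q t) (C₁ * D + L)
    ((hJ.1.sub cI).sub hQ.1) (by positivity) fun s t hst hst1 => by
      have c1 := bQ s t hst hst1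
      have c2 := harea s t hst hst1
      rw [area, hJ.distIntegral_eq, iteratedIntegral_eq B hf hg, hI, rfu.toContinuousFun_eq cfu,
        rgv.toContinuousFun_eq cgv] at c2
      refine le_trans (le_of_eq ?_) ((norm_sub_le_of_le c2 c1).trans (le_of_eq (by ring)))
      congr 1
      abel
  refine ⟨η - w', ?_, ?_⟩
  · rw [isResonantProduct_iff_represents P B hα hβ hu' hv' hl hh hf hg hu'f hv'g,
      ← isAntiderivative_iff_represents hp]
    -- Subtracting `J - I - Q` and `Q` from `J` leaves `I`, an antiderivative of the product of `f`
    -- with the derivative of `g`. This identifies `η - w'` as the resonant product.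
    have := (hJ.sub hw').sub hQ
    convert this using 1
    · abel
    · funext t
      simp only [I]
      abel
  · have h5 : BlockBound P (α + β - 1) (C₄ * (C₁ * D + L)) (η - w' - η) := fun j x => by
      have : block P j (η - w' - η) x = -block P j w' x := by
        simp only [block_sub]
        abel
      rw [this, norm_neg]
      exact bw' j x
    refine fun j x => (h5 j x).trans ?_
    gcongr
    nlinarith [mul_nonneg hC₄ hD, mul_nonneg (mul_nonneg hC₄ hC₁) hL]

end Convergence

end Paracontrolled

end

theorem mainTheorem9 (P : Paracontrolled.DyadicPartition)
    {E F G : Type*} [NormedAddCommGroup E] [NormedSpace ℂ E] [CompleteSpace E]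
    [NormedAddCommGroup F] [NormedSpace ℂ F] [CompleteSpace F]
    [NormedAddCommGroup G] [NormedSpace ℂ G] [CompleteSpace G]
    (B : E →L[ℂ] F →L[ℂ] G)
    (α β : ℝ) (hα : α ∈ Set.Ioo (0 : ℝ) 1) (hβ : β ∈ Set.Ioo (0 : ℝ) 1) (hαβ : α + β < 1)
    (uε : ℝ → ℝ → E) (vε : ℝ → ℝ → F)
    (huε : ∀ ε > 0, ContDiff ℝ ∞ (uε ε)) (hvε : ∀ ε > 0, ContDiff ℝ ∞ (vε ε))
    (u : 𝓢'(ℝ, E)) (v : 𝓢'(ℝ, F)) (η : 𝓢'(ℝ, G))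
    (hu : Paracontrolled.besovNorm P α u < ⊤) (hv : Paracontrolled.besovNorm P β v < ⊤)
    (hη : Paracontrolled.besovNorm P (α + β - 1) η < ⊤) :
    (Paracontrolled.FunBesovTendsto P α uε u ∧ Paracontrolled.FunBesovTendsto P β vε v ∧
      Paracontrolled.ResonantBesovTendsto P B (α + β - 1) uε vε η) ↔
    (Paracontrolled.FunBesovTendsto P α uε u ∧ Paracontrolled.FunBesovTendsto P β vε v ∧
      Tendsto (fun ε => Paracontrolled.localHolderNorm (α + β) (fun s t =>
        Paracontrolled.area P B u v η s t
          - Paracontrolled.iteratedIntegral B (uε ε) (vε ε) s t)) (𝓝[>] 0) (𝓝 0)) := by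
  have hγ0 : α + β - 1 ≤ 1 := by linarith
  have hγ1 : -1 ≤ α + β - 1 := by linarith [hα.1, hβ.1]
  have bu := Paracontrolled.blockBound_of_besovNorm_lt_top hα.2.le hu
  have bv := Paracontrolled.blockBound_of_besovNorm_lt_top hβ.2.le hv
  have bη := Paracontrolled.blockBound_of_besovNorm_lt_top hγ0 hη
  set A₁ := 2 * (Paracontrolled.besovNorm P α u).toReal
  set A₂ := 2 * (Paracontrolled.besovNorm P β v).toReal
  -- Both sides contain the convergence of the two functions, so only the third conditions are
  -- compared, with these convergences available.
  refine and_congr_right fun hU => and_congr_right fun hV => ?_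
  obtain ⟨U, rU, tU⟩ := hU
  obtain ⟨V, rV, tV⟩ := hV
  obtain ⟨δ₁, tδ₁, bδ₁⟩ := Paracontrolled.exists_blockBound_of_tendsto hα.2.le tU
  obtain ⟨δ₂, tδ₂, bδ₂⟩ := Paracontrolled.exists_blockBound_of_tendsto hβ.2.le tV
  have tD : Tendsto (fun ε => δ₁ ε * A₂ + (A₁ + δ₁ ε) * δ₂ ε) (𝓝[>] 0) (𝓝 0) := by
    simpa using (tδ₁.mul_const A₂).add ((tδ₁.const_add A₁).mul tδ₂)
  have hpos : ∀ᶠ ε : ℝ in 𝓝[>] 0, 0 < ε := self_mem_nhdsWithin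
  constructor
  · rintro ⟨W, rW, tW⟩
    obtain ⟨δ₃, tδ₃, bδ₃⟩ := Paracontrolled.exists_blockBound_of_tendsto hγ0 tW
    obtain ⟨C, hC, h⟩ := Paracontrolled.exists_norm_area_sub_iteratedIntegral_le P B hα hβ hαβ
    have t0 := ENNReal.tendsto_ofReal ((tD.add tδ₃).const_mul C)
    rw [add_zero, mul_zero, ENNReal.ofReal_zero] at t0
    refine tendsto_of_tendsto_of_tendsto_of_le_of_le' tendsto_const_nhds t0
      (Eventually.of_forall fun _ => zero_le) ?_
    filter_upwards [hpos, rU, rV, rW, bδ₁, bδ₂, bδ₃] with ε h0 h1 h2 h3 h4 h5 h6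
    obtain ⟨U', V', hU', hV', hres⟩ := h3
    -- The distributions hidden in the resonant condition are those of the first two convergences,
    -- since a function represents only one distribution.
    rw [hU'.unique h1, hV'.unique h2] at hres
    have := h4.nonneg
    have := h5.nonneg
    have := h6.nonneg
    have := bu.nonneg
    have := bv.nonneg
    exact (Paracontrolled.localHolderNorm_le_ofReal_iff (by positivity)).2
      (h u (U ε) v (V ε) η (W ε) A₁ A₂ _ _ _ _ _ bu bv h4 h5 h6 ((huε ε h0).of_le (by simp))
        ((hvε ε h0).of_le (by simp)) h1 h2 hres)
  · intro tA
    obtain ⟨C, hC, h⟩ := Paracontrolled.exists_isResonantProduct_of_area P B hα hβ hαβ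
    set N := fun ε => Paracontrolled.localHolderNorm (α + β) fun s t =>
        Paracontrolled.area P B u v η s t
          - Paracontrolled.iteratedIntegral B (uε ε) (vε ε) s t
    -- The norm may be infinite for some `ε`, but it is eventually finite, and from then on `toReal`
    -- loses nothing.
    have tN : Tendsto (fun ε => (N ε).toReal) (𝓝[>] 0) (𝓝 0) :=
      (ENNReal.tendsto_toReal ENNReal.zero_ne_top).comp tA
    have key : ∀ᶠ ε in 𝓝[>] (0 : ℝ), ∃ w,
        Paracontrolled.IsResonantProduct P B (U ε) (TemperedDistribution.derivCLM F (V ε)) w ∧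
        Paracontrolled.BlockBound P (α + β - 1)
          (C * (δ₁ ε * A₂ + (A₁ + δ₁ ε) * δ₂ ε) + C * (N ε).toReal) (w - η) := by
      filter_upwards [hpos, rU, rV, bδ₁, bδ₂, tA.eventually (gt_mem_nhds ENNReal.zero_lt_top)]
        with ε h0 h1 h2 h4 h5 h6
      exact h u (U ε) v (V ε) η A₁ A₂ _ _ _ _ _ _ bu bv bη h4 h5 ENNReal.toReal_nonneg
        ((huε ε h0).of_le (by simp)) ((hvε ε h0).of_le (by simp)) h1 h2
        ((Paracontrolled.localHolderNorm_le_ofReal_iff ENNReal.toReal_nonneg).1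
          (ENNReal.ofReal_toReal h6.ne).ge)
    -- The resonant product exists only for small `ε`; a family defined for all `ε` is chosen with
    -- the property eventually.
    obtain ⟨W, hW⟩ := key.choice
    refine ⟨W, ?_, ?_⟩
    · filter_upwards [hW, rU, rV] with ε h3 h1 h2
      exact ⟨U ε, V ε, h1, h2, h3.1⟩
    · have t0 := ENNReal.tendsto_ofReal (((tD.const_mul C).add (tN.const_mul C)).const_mul 2)
      simp only [mul_zero, add_zero, ENNReal.ofReal_zero] at t0
      refine tendsto_of_tendsto_of_tendsto_of_le_of_le' tendsto_const_nhds t0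
        (Eventually.of_forall fun _ => zero_le) ?_
      filter_upwards [hW] with ε h3
      exact h3.2.besovNorm_le hγ1
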